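/- Let $d\ge 1$, $s>d$, let $\Omega\subset\mathbb R^d$ be closed with positive Lebesgue measure and $C^1$ boundary, and let $V$ be continuous and non-negative on $\Omega$. If $\Omega$ is unbounded, assume also that $V(x)\to+\infty$ as $|x|\to\infty$ in $\Omega$ and that $\int_\Omega e^{-MV}\,dx<\infty$ for some $M>0$. Notation. $K_R$ is the closed cube of center $0$ and side length $R$ with sides parallel to the axes. For a stationary random point configuration with law $P$ in $\mathbb R^d$, its intensity is $E_P[\,|\mathcal C\cap K_1|\,]$, its Riesz energy is $\mathbb W_s(P)=\liminf_{R\to\infty}R^{-d}\,E_P\big[\sum_{p\ne q\in\mathcal C\cap K_R}|p-q|^{-s}\big]$ (sum over ordered pairs of distinct particles, two particles at the same place contributing $+\infty$), and its specific relative entropy is $\mathrm{ent}[P|\Pi]=\lim_{R\to\infty}R^{-d}\,\mathrm{KL}(P_{|K_R}\,|\,\Pi_{|K_R})$, where $\Pi$ is the Poisson point process of intensity $1$. For $\beta>0$ and a probability density $\rho$ on $\Omega$ let $$I_\beta(\rho)=\int_\Omega\ \inf_{P\ \text{stationary of intensity }\rho(x)}\big(\beta\,\mathbb W_s(P)+\mathrm{ent}[P|\Pi]-1\big)\,dx+\beta\int_\Omega\rho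 V\,dx+1 ,$$ with $I_\beta(\rho)=+\infty$ if $\int_\Omega\rho V=\infty$. Let $C_{s,d}=\lim_{N\to\infty}N^{-1-s/d}\inf_{x\in (K_1)^N}\sum_{i\ne j}|x_i-x_j|^{-s}$. A minimizer of a functional of densities is a probability measure on $\Omega$ whose density minimizes it among all probability densities on $\Omega$. (0) $I_\beta$ has a minimizer for every $\beta>0$ such that $\int_\Omega e^{-MV}\,dx<\infty$ for some $M<\beta$; this covers every $\beta>0$ if $\Omega$ is bounded, and every sufficiently large $\beta$ in general. (1) If $V=0$ on $\Omega$ and $\Omega$ is bounded, then for every $\beta>0$ the uniform probability measure on $\Omega$ is a minimizer of $I_\beta$; hence, if $\mu_{V,\beta}$ is the unique minimizer of $I_\beta$, then $\mu_{V,\beta}$ is the uniform probability measure on $\Omega$. (2) If $\Omega$ is bounded, the minimizers $\mu_{V,\beta}$ of $I_\beta$ converge in total variation to the uniform probability measure on $\Omega$ as $\beta\to0^+$, uniformly in the choice of the minimizers. (3) The functional $\rho\mapsto C_{s,d}\int_\Omega\rho^{1+s/d}\,dx+\int_\Omega V\rho\,dx$ has a unique minimizer $\mu_{V,\infty}$ among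 probability densities on $\Omega$, and for any choice of minimizers $\mu_{V,\beta}$ of $I_\beta$ (for all large $\beta$), $\mu_{V,\beta}$ converges weakly to $\mu_{V,\infty}$ as $\beta\to+\infty$. -/

import Mathlib

open MeasureTheory ProbabilityTheory Filter Topology Set
open scoped ENNReal NNReal

/-- The closed hypercube of center `0` and side length `R`, with sides parallel to the axes. -/
def cube (d : ℕ) (R : ℝ) : Set (EuclideanSpace ℝ (Fin d)) :=
  {x | ∀ i, |x i| ≤ R / 2}

/-- A (locally finite) point configuration in `ℝ^d`, identified with its counting measure: a
measure whose value on every bounded Borel set is a (finite) natural number.  Multiple points are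
allowed. -/
def IsPointConfig {d : ℕ} (C : Measure (EuclideanSpace ℝ (Fin d))) : Prop :=
  ∀ B, MeasurableSet B → Bornology.IsBounded B → ∃ n : ℕ, C B = n

/-- The Riesz interaction `∑_{p ≠ q ∈ C ∩ A} |p - q| ^ (-s)`, the sum being over ordered pairs of
distinct particles of `C` in `A`: every particle `p` of `C` interacts with the configuration
`C - δ_p` of the other particles.  Two particles at the same place have infinite interaction
(`0 ^ (-s) = ∞`). -/
noncomputable def rieszInteraction {d : ℕ} (s : ℝ) (A : Set (EuclideanSpace ℝ (Fin d)))
    (C : Measure (EuclideanSpace ℝ (Fin d))) : ℝ≥0∞ :=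
  ∫⁻ p in A, ∫⁻ q in A, ‖p - q‖ₑ ^ (-s) ∂(C - Measure.dirac p) ∂C

/-- The Riesz `s`-energy of a random point configuration with law `P`:
`liminf_{R → ∞} R^{-d} E_P [Int[K_R, K_R]]`. -/
noncomputable def rieszEnergy {d : ℕ} (s : ℝ)
    (P : Measure (Measure (EuclideanSpace ℝ (Fin d)))) : ℝ≥0∞ :=
  liminf (fun R : ℝ =>
    (∫⁻ C, rieszInteraction s (cube d R) C ∂P) / ENNReal.ofReal (R ^ d)) atTop

/-- The law of the Poisson point process of intensity `1` in a window `A` of finite volume: the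
number of points is Poisson of parameter `|A|` and, given that there are `n` points, they are
independent and uniform in `A`, that is,
`e^{-|A|} ∑_n (1 / n!) (law of δ_{x_1} + ... + δ_{x_n} under Lebesgue measure on A^n)`. -/
noncomputable def poissonLaw {d : ℕ} (A : Set (EuclideanSpace ℝ (Fin d))) :
    Measure (Measure (EuclideanSpace ℝ (Fin d))) :=
  ENNReal.ofReal (Real.exp (-(volume A).toReal)) •
    Measure.sum fun n : ℕ => (Nat.factorial n : ℝ≥0∞)⁻¹ •
      (Measure.pi fun _ : Fin n => (volume : Measure (EuclideanSpace ℝ (Fin d))).restrict A).map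
        (fun x => ∑ i, Measure.dirac (x i))

/-- The specific relative entropy of a (stationary) law `P` with respect to the Poisson point
process of intensity `1`: the limit as `R → ∞` of `R^{-d}` times the Kullback-Leibler divergence
of the restrictions of the two processes to `K_R`.  The limit exists for stationary `P`; it is
written as a lower limit so as to be defined for all `P`. -/
noncomputable def specificEntropy {d : ℕ}
    (P : Measure (Measure (EuclideanSpace ℝ (Fin d)))) : ℝ≥0∞ :=
  liminf (fun R : ℝ =>
    InformationTheory.klDiv (P.map fun C => C.restrict (cube d R)) (poissonLaw (cube d R))
      / ENNReal.ofReal (R ^ d)) atTop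

/-- The set of laws of stationary random point configurations in `ℝ^d` of intensity `m`, the
intensity being the mean number of points in a unit cube. -/
def stationaryLaws (d : ℕ) (m : ℝ≥0∞) :
    Set (Measure (Measure (EuclideanSpace ℝ (Fin d)))) :=
  {P | IsProbabilityMeasure P ∧ (∀ᵐ C ∂P, IsPointConfig C) ∧
    (∀ x : EuclideanSpace ℝ (Fin d), P.map (fun C => C.map fun p => p - x) = P) ∧
    ∫⁻ C, C (cube d 1) ∂P = m}

/-- The infimum of `β W_s(P) + ERS[P | Poisson] - 1` over stationary `P` of intensity `m`. -/
noncomputable def microFreeEnergy (d : ℕ) (s β : ℝ) (m : ℝ≥0) : EReal :=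
  ((⨅ P ∈ stationaryLaws d m,
    (ENNReal.ofReal β * rieszEnergy s P + specificEntropy P) : ℝ≥0∞) : EReal) - 1

/-- `ρ` (restricted to `Ω`) is a probability density on `Ω`. -/
def IsProbDensity {d : ℕ} (Ω : Set (EuclideanSpace ℝ (Fin d)))
    (ρ : EuclideanSpace ℝ (Fin d) → ℝ≥0) : Prop :=
  Measurable ρ ∧ ∫⁻ x in Ω, ρ x = 1

/-- The potential energy `∫_Ω ρ V`. -/
noncomputable def potentialEnergy {d : ℕ} (Ω : Set (EuclideanSpace ℝ (Fin d)))
    (V : EuclideanSpace ℝ (Fin d) → ℝ) (ρ : EuclideanSpace ℝ (Fin d) → ℝ≥0) : ℝ≥0∞ :=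
  ∫⁻ x in Ω, ρ x * ENNReal.ofReal (V x)

/-- The rate function
`I_β(ρ) = ∫_Ω inf_{P of intensity ρ(x)} (β W_s(P) + ERS[P | Poisson] - 1) dx + β ∫_Ω ρ V + 1`.
The first integral is the difference of the integrals of the positive and negative parts.  If
`∫_Ω ρ V = ∞` the value is `+∞` (this only matters for unbounded `Ω`, where the integral of the
negative part might then be infinite as well). -/
noncomputable def rateFunction {d : ℕ} (s : ℝ) (Ω : Set (EuclideanSpace ℝ (Fin d)))
    (V : EuclideanSpace ℝ (Fin d) → ℝ) (β : ℝ) (ρ : EuclideanSpace ℝ (Fin d) → ℝ≥0) : EReal :=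
  if potentialEnergy Ω V ρ = ⊤ then ⊤ else
    ((∫⁻ x in Ω, (microFreeEnergy d s β (ρ x)).toENNReal : ℝ≥0∞) : EReal)
      - ((∫⁻ x in Ω, (-microFreeEnergy d s β (ρ x)).toENNReal : ℝ≥0∞) : EReal)
      + ((ENNReal.ofReal β * potentialEnergy Ω V ρ : ℝ≥0∞) : EReal) + 1

/-- The Riesz energy `∑_{i ≠ j} |x_i - x_j| ^ (-s)` of an `N`-tuple of points. -/
noncomputable def tupleEnergy {d N : ℕ} (s : ℝ) (x : Fin N → EuclideanSpace ℝ (Fin d)) : ℝ≥0∞ :=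
  ∑ i, ∑ j ∈ Finset.univ.erase i, ‖x i - x j‖ₑ ^ (-s)

/-- The constant `C_{s,d} = lim_N N^{-(1 + s/d)} inf {E_s(x) | x ∈ (K_1)^N}`.  The limit exists;
it is written as a lower limit. -/
noncomputable def rieszConstant (d : ℕ) (s : ℝ) : ℝ≥0∞ :=
  liminf (fun N : ℕ =>
    (⨅ x : Fin N → EuclideanSpace ℝ (Fin d), ⨅ _ : ∀ i, x i ∈ cube d 1, tupleEnergy s x)
      / (N : ℝ≥0∞) ^ (1 + s / d)) atTop

/-- The functional `C_{s,d} ∫_Ω ρ^{1 + s/d} + ∫_Ω V ρ`. -/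
noncomputable def groundFunctional {d : ℕ} (s : ℝ) (Ω : Set (EuclideanSpace ℝ (Fin d)))
    (V : EuclideanSpace ℝ (Fin d) → ℝ) (ρ : EuclideanSpace ℝ (Fin d) → ℝ≥0) : EReal :=
  ((rieszConstant d s * ∫⁻ x in Ω, (ρ x : ℝ≥0∞) ^ (1 + s / d)) + potentialEnergy Ω V ρ : ℝ≥0∞)

/-- The measure `μ` has a density with respect to Lebesgue measure on `Ω`, and this density
minimizes `J` among all probability densities on `Ω`. -/
def IsMinimizerOn {d : ℕ} (Ω : Set (EuclideanSpace ℝ (Fin d)))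
    (J : (EuclideanSpace ℝ (Fin d) → ℝ≥0) → EReal) (μ : Measure (EuclideanSpace ℝ (Fin d))) :
    Prop :=
  ∃ ρ, IsProbDensity Ω ρ ∧ μ = (volume.restrict Ω).withDensity (fun x => (ρ x : ℝ≥0∞)) ∧
    ∀ ρ', IsProbDensity Ω ρ' → J ρ ≤ J ρ'

/-- The boundary of `Ω` is `C^1`: near each of its points it is the zero set of a `C^1` function
whose differential does not vanish there. -/
def HasC1Boundary {d : ℕ} (Ω : Set (EuclideanSpace ℝ (Fin d))) : Prop :=
  ∀ x ∈ frontier Ω, ∃ U : Set (EuclideanSpace ℝ (Fin d)), IsOpen U ∧ x ∈ U ∧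
    ∃ φ : EuclideanSpace ℝ (Fin d) → ℝ, ContDiffOn ℝ 1 φ U ∧ fderiv ℝ φ x ≠ 0 ∧
      ∀ y ∈ U, y ∈ frontier Ω ↔ φ y = 0

/-!
The functional `I_β` depends on point processes only through the free energy per unit volume
`F_β(m) = inf (β W_s(P) + ent[P | Π] - 1)` over the stationary laws `P` of intensity `m`
(`bulkFreeEnergy`). Once enough is known about this function of one variable, the theorem is a
statement about the integral functionals `∫ (F_β(ρ) + β V ρ)` of densities. No compactness of the
space of point processes is used.

*The free energy.* The interaction of a configuration is superadditive in the window, and so is the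
entropy, because the Poisson law factorizes over disjoint windows and the Kullback-Leibler
divergence with respect to a product dominates the sum of the divergences of the marginals. For a
stationary law the lower limits `W_s` and `ent` are therefore suprema over all cubes
(`div_le_liminf_of_superadditive`). Consequently they are convex in the law, so that `F_β` is convex
(`convexOn_bulkFreeEnergy`), and they are bounded below: the energy by `C_{s,d} m^{1 + s/d}`
(optimal configurations and Jensen's inequality), the entropy by `t m - e^t + 1` for every `t` (dual
formula for the divergence, tested with `t` times the number of points). The sum of both bounds is
`le_bulkFreeEnergy`.

Upper bounds come from explicit processes: a lattice of cells, shifted by a uniform vector, with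
independent contents of the cells (`exists_mem_stationaryLaws_of_cells`). The points stay away from
the boundaries of the cells, so that the interaction of different cells is bounded by a convergent
lattice sum. Tiny cells with at most one point have almost the entropy of a Poisson process and
finite energy (`exists_specificEntropy_le`); large cells which contain a slightly blurred optimal
configuration have almost the ground state energy and finite entropy (`exists_rieszEnergy_le`).
Hence `F_β(m)` tends to `m log m - m` as `β → 0`, and `F_β(m) / β` to `C_{s,d} m^{1 + s/d}` as
`β → ∞`.

*Minimizers.* By convexity, a density `ρ` of mass one minimizes as soon as, for some multiplier `l`,
`ρ(x)` minimizes `F_β(m) - (l - β V(x)) m` for every `x`. Such a density exists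
(`exists_density_isArgmin`): a selection of pointwise minimizers is monotone in `l`, and at the
critical `l` its left and right limits have mass at most and at least `1`. The bound
`F_β(m) ≥ t m - e^t` and the integrability of `e^{-MV}` make all masses finite. The same argument
applies to the ground state functional.

*No external field.* The uniform density is a minimizer by Jensen's inequality
(`isMinimizerOn_uniform`).

*Infinite temperature.* Let `a` be the value of the uniform density. The lower bounds of slopes
`log a ± η` show that the excess of `∫ F_β(ρ)` over its value at the uniform density controls the
`L¹` distance of `ρ` to `a` (`eventually_integral_abs_sub_uniform_le`).

*Zero temperature.* The lower bound of slope `-M V(x)`, and dominated convergence at the minimizing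
density `ρ₀` of the ground state functional for the upper bound, show that the minimizers of `I_β`
almost minimize the ground state functional (`exists_excess_tendsto_zero`). The latter is uniformly
convex, because `1 + s/d ≥ 2`, so its almost minimizers are close to `ρ₀` in `L¹`
(`integral_abs_sub_le_of_isArgmin`). This gives uniqueness and convergence, even in total variation.
-/


/-! ### Dual formula for the Kullback-Leibler divergence -/

section KullbackLeibler

open InformationTheory

variable {α β : Type*} [MeasurableSpace α] [MeasurableSpace β]

/-- Young's inequality for the conjugate pair `a log a + 1 - a`, `exp x - 1`. -/
lemma mul_sub_exp_sub_one_le_klFun {a : ℝ} (ha : 0 ≤ a) (x : ℝ) :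
    a * x - (Real.exp x - 1) ≤ klFun a := by
  rw [klFun_apply]
  rcases ha.eq_or_lt with rfl | ha
  · have := Real.exp_pos x
    simp only [zero_mul]; linarith
  · have h1 := Real.add_one_le_exp (x - Real.log a)
    have h2 : Real.exp (x - Real.log a) = Real.exp x / a := by
      rw [Real.exp_sub, Real.exp_log ha]
    rw [h2, le_div_iff₀ ha] at h1
    nlinarith

lemma ofReal_integral_le_lintegral_ofReal {μ : Measure α} {f : α → ℝ} (hf : Integrable f μ) :
    ENNReal.ofReal (∫ x, f x ∂μ) ≤ ∫⁻ x, ENNReal.ofReal (f x) ∂μ := by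
  calc ENNReal.ofReal (∫ x, f x ∂μ) ≤ ENNReal.ofReal (∫ x, max (f x) 0 ∂μ) :=
        ENNReal.ofReal_le_ofReal (integral_mono hf hf.pos_part fun x => le_max_left _ _)
    _ = ∫⁻ x, ENNReal.ofReal (max (f x) 0) ∂μ :=
        ofReal_integral_eq_lintegral_ofReal hf.pos_part (ae_of_all _ fun x => le_max_right _ _)
    _ = ∫⁻ x, ENNReal.ofReal (f x) ∂μ := by simp

/-- The easy half of the Donsker-Varadhan formula, in the form adapted to unnormalized
exponentials. -/
lemma ofReal_integral_sub_le_klDiv {μ ν : Measure α} [IsFiniteMeasure μ] [IsFiniteMeasure ν]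
    {φ : α → ℝ} (hφ : Integrable φ μ) (hexp : Integrable (fun x => Real.exp (φ x)) ν) :
    ENNReal.ofReal (∫ x, φ x ∂μ - ∫ x, (Real.exp (φ x) - 1) ∂ν) ≤ klDiv μ ν := by
  by_cases hμν : μ ≪ ν
  swap; · simp [hμν]
  rw [klDiv_eq_lintegral_klFun_of_ac hμν]
  have h1 : ∫ x, φ x ∂μ = ∫ x, (μ.rnDeriv ν x).toReal * φ x ∂ν := by
    rw [← integral_rnDeriv_smul hμν]; rfl
  have hi : Integrable (fun x => (μ.rnDeriv ν x).toReal * φ x) ν :=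
    (integrable_rnDeriv_smul_iff hμν).2 hφ
  have hi2 : Integrable (fun x => Real.exp (φ x) - 1) ν := hexp.sub (integrable_const _)
  rw [h1, ← integral_sub hi hi2]
  refine (ofReal_integral_le_lintegral_ofReal (hi.sub hi2)).trans ?_
  refine lintegral_mono fun x => ENNReal.ofReal_le_ofReal ?_
  exact mul_sub_exp_sub_one_le_klFun ENNReal.toReal_nonneg _

lemma integrable_of_measurable_of_abs_le {μ : Measure α} [IsFiniteMeasure μ] {φ : α → ℝ}
    (hφ : Measurable φ) {c : ℝ} (hc : ∀ x, |φ x| ≤ c) : Integrable φ μ :=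
  Integrable.of_bound hφ.aestronglyMeasurable c (ae_of_all _ hc)

lemma integrable_exp_of_abs_le {μ : Measure α} [IsFiniteMeasure μ] {φ : α → ℝ}
    (hφ : Measurable φ) {c : ℝ} (hc : ∀ x, |φ x| ≤ c) :
    Integrable (fun x => Real.exp (φ x)) μ :=
  integrable_of_measurable_of_abs_le hφ.exp (c := Real.exp c) fun x => by
    rw [abs_of_pos (Real.exp_pos _)]
    exact Real.exp_le_exp.2 ((le_abs_self _).trans (hc x))

lemma ofReal_integral_le_klDiv {μ ν : Measure α} [IsProbabilityMeasure μ] [IsProbabilityMeasure ν]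
    {φ : α → ℝ} (hφ : Measurable φ) {c : ℝ} (hc : ∀ x, |φ x| ≤ c)
    (h1 : ∫ x, Real.exp (φ x) ∂ν = 1) :
    ENNReal.ofReal (∫ x, φ x ∂μ) ≤ klDiv μ ν := by
  have := ofReal_integral_sub_le_klDiv (μ := μ) (ν := ν)
    (integrable_of_measurable_of_abs_le hφ hc) (integrable_exp_of_abs_le hφ hc)
  rwa [integral_sub (integrable_exp_of_abs_le hφ hc) (integrable_const _), h1, integral_const,
    probReal_univ, one_smul, sub_self, sub_zero] at this

/-- Removing the normalization `∫ exp φ = 1` from the test functions of the dual formula. -/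
lemma ofReal_integral_sub_le_of_normalized {μ ν : Measure α} [IsProbabilityMeasure μ]
    [IsProbabilityMeasure ν] {K : ℝ≥0∞}
    (h : ∀ φ : α → ℝ, Measurable φ → (∃ c, ∀ x, |φ x| ≤ c) → ∫ x, Real.exp (φ x) ∂ν = 1 →
      ENNReal.ofReal (∫ x, φ x ∂μ) ≤ K)
    {φ : α → ℝ} (hφ : Measurable φ) {c : ℝ} (hc : ∀ x, |φ x| ≤ c) :
    ENNReal.ofReal (∫ x, φ x ∂μ - ∫ x, (Real.exp (φ x) - 1) ∂ν) ≤ K := by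
  have hi := integrable_of_measurable_of_abs_le (μ := μ) hφ hc
  have he := integrable_exp_of_abs_le (μ := ν) hφ hc
  set Z := ∫ x, Real.exp (φ x) ∂ν with hZ
  have hZpos : 0 < Z := integral_exp_pos he
  have key := h (fun x => φ x - Real.log Z) (hφ.sub_const _)
    ⟨c + |Real.log Z|, fun x => (abs_sub _ _).trans (by gcongr; exact hc x)⟩ (by
      simp_rw [Real.exp_sub, Real.exp_log hZpos]
      rw [integral_div, ← hZ, div_self hZpos.ne'])
  refine le_trans (ENNReal.ofReal_le_ofReal ?_) key
  rw [integral_sub hi (integrable_const _), integral_sub he (integrable_const _)]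
  simp only [integral_const, probReal_univ, one_smul, ← hZ]
  linarith [Real.log_le_sub_one_of_pos hZpos]

/-- The hard half of the Donsker-Varadhan formula: a bound on `∫ φ dμ` for all bounded `φ` with
`∫ exp φ dν = 1` is a bound on the divergence. -/
lemma klDiv_le_of_forall_integral_le {μ ν : Measure α} [IsProbabilityMeasure μ]
    [IsProbabilityMeasure ν] {K : ℝ≥0∞}
    (h : ∀ φ : α → ℝ, Measurable φ → (∃ c, ∀ x, |φ x| ≤ c) → ∫ x, Real.exp (φ x) ∂ν = 1 →
      ENNReal.ofReal (∫ x, φ x ∂μ) ≤ K) :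
    klDiv μ ν ≤ K := by
  by_cases hμν : μ ≪ ν
  swap
  · -- test with large multiples of the indicator of a `ν`-null set charged by `μ`
    obtain ⟨B, hB, hνB, hμB⟩ : ∃ B, MeasurableSet B ∧ ν B = 0 ∧ μ B ≠ 0 := by
      by_contra! hcon
      exact hμν (Measure.AbsolutelyContinuous.mk fun s hs hs0 => hcon s hs hs0)
    suffices hK : K = ∞ by simp [hK]
    refine ENNReal.eq_top_of_forall_nnreal_le fun r => ?_
    have hpos : 0 < μ.real B := ENNReal.toReal_pos hμB (measure_ne_top _ _)
    set t : ℝ := r / μ.real B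
    have ht : 0 ≤ t := by positivity
    have := ofReal_integral_sub_le_of_normalized h (φ := B.indicator fun _ => t)
      (measurable_const.indicator hB) (c := t) (fun x => by
        by_cases hx : x ∈ B <;> simp [hx, abs_of_nonneg ht, ht])
    have h0 : ∫ x, (Real.exp (B.indicator (fun _ => t) x) - 1) ∂ν = 0 := by
      refine integral_eq_zero_of_ae ?_
      have : ∀ᵐ x ∂ν, x ∉ B := measure_eq_zero_iff_ae_notMem.1 hνB
      filter_upwards [this] with x hx
      simp [hx]
    rw [h0, integral_indicator_const _ hB, sub_zero, smul_eq_mul, mul_div_cancel₀ _ hpos.ne'] at this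
    simpa using this
  · rw [klDiv_eq_lintegral_klFun_of_ac hμν]
    -- test with the logarithm of the truncated density
    set a : α → ℝ := fun x => (μ.rnDeriv ν x).toReal with ha
    have ham : Measurable a := (Measure.measurable_rnDeriv _ _).ennreal_toReal
    have ha0 : ∀ x, 0 ≤ a x := fun x => ENNReal.toReal_nonneg
    set y : ℕ → α → ℝ := fun n x => max (min (a x) (n + 1)) (1 / (n + 1)) with hy
    have hym : ∀ n, Measurable (y n) := fun n => (ham.min measurable_const).max measurable_const
    have hypos : ∀ n x, 0 < y n x := fun n x => lt_max_of_lt_right (by positivity)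
    set G : ℕ → α → ℝ := fun n x => a x * Real.log (y n x) - (y n x - 1) with hG
    have hG0 : ∀ n x, 0 ≤ G n x := by
      intro n x
      have h1 : 0 ≤ (a x - y n x) * Real.log (y n x) := by
        have hn : (0 : ℝ) < n + 1 := by positivity
        have hn1 : (1 : ℝ) ≤ n + 1 := by linarith [Nat.cast_nonneg (α := ℝ) n]
        have hn2 : 1 / ((n : ℝ) + 1) ≤ 1 := by rw [div_le_one hn]; exact hn1
        rcases le_total (a x) (1 / (n + 1)) with h1 | h1
        · have : y n x = 1 / (n + 1) := by
            simp only [hy]; rw [max_eq_right ((min_le_left _ _).trans h1)]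
          rw [this]
          exact mul_nonneg_of_nonpos_of_nonpos (by linarith)
            (Real.log_nonpos (by positivity) hn2)
        · rcases le_total (a x) (n + 1) with h2 | h2
          · have : y n x = a x := by
              simp only [hy]; rw [min_eq_left h2, max_eq_left h1]
            rw [this, sub_self, zero_mul]
          · have : y n x = n + 1 := by
              simp only [hy]; rw [min_eq_right h2, max_eq_left (hn2.trans hn1)]
            rw [this]
            exact mul_nonneg (by linarith) (Real.log_nonneg hn1)
      have h2 := klFun_nonneg (hypos n x).le
      rw [klFun_apply] at h2
      simp only [hG]; nlinarith
    have hlim : ∀ x, Tendsto (fun n => ENNReal.ofReal (G n x)) atTop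
        (𝓝 (ENNReal.ofReal (klFun (a x)))) := by
      intro x
      refine (ENNReal.continuous_ofReal.tendsto _).comp ?_
      have hyx : Tendsto (fun n => y n x) atTop (𝓝 (a x)) := by
        have h1 : Tendsto (fun n : ℕ => min (a x) ((n : ℝ) + 1)) atTop (𝓝 (a x)) := by
          refine tendsto_const_nhds.congr' ?_
          filter_upwards [eventually_ge_atTop ⌈a x⌉₊] with n hn
          have := Nat.ceil_le.1 hn
          rw [min_eq_left (by linarith)]
        have := h1.max (tendsto_one_div_add_atTop_nhds_zero_nat (𝕜 := ℝ))
        rwa [max_eq_left (ha0 x)] at this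
      have hlog : Tendsto (fun n => a x * Real.log (y n x)) atTop
          (𝓝 (a x * Real.log (a x))) := by
        rcases (ha0 x).eq_or_lt with h0 | h0
        · simp [← h0]
        · exact ((Real.continuousAt_log h0.ne').tendsto.comp hyx).const_mul _
      have := hlog.sub (hyx.sub_const 1)
      rw [klFun_apply]
      convert this using 2
      ring
    have hGm : ∀ n, Measurable (G n) := fun n =>
      (ham.mul (hym n).log).sub ((hym n).sub_const 1)
    have hGK : ∀ n, ∫⁻ x, ENNReal.ofReal (G n x) ∂ν ≤ K := by
      intro n
      have hn : (0 : ℝ) < n + 1 := by positivity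
      have hb : ∀ x, |Real.log (y n x)| ≤ Real.log (n + 1) := by
        intro x
        have hn1 : (1 : ℝ) ≤ n + 1 := by linarith [Nat.cast_nonneg (α := ℝ) n]
        have hn2 : 1 / ((n : ℝ) + 1) ≤ 1 := by rw [div_le_one hn]; exact hn1
        rw [abs_le]
        constructor
        · rw [← Real.log_inv, ← one_div]
          exact Real.log_le_log (by positivity) (le_max_right _ _)
        · exact Real.log_le_log (hypos n x) (max_le (min_le_right _ _) (hn2.trans hn1))
      have key := ofReal_integral_sub_le_of_normalized h (φ := fun x => Real.log (y n x))
        (hym n).log hb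
      have hi := integrable_of_measurable_of_abs_le (μ := μ) (hym n).log hb
      have he := integrable_exp_of_abs_le (μ := ν) (hym n).log hb
      have h1 : ∫ x, Real.log (y n x) ∂μ = ∫ x, a x * Real.log (y n x) ∂ν := by
        rw [← integral_rnDeriv_smul hμν]; rfl
      have hi' : Integrable (fun x => a x * Real.log (y n x)) ν :=
        (integrable_rnDeriv_smul_iff hμν).2 hi
      have hi2 : Integrable (fun x => Real.exp (Real.log (y n x)) - 1) ν :=
        he.sub (integrable_const _)
      rw [h1, ← integral_sub hi' hi2] at key
      have heq : (fun x => a x * Real.log (y n x) - (Real.exp (Real.log (y n x)) - 1)) = G n := by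
        ext x; simp only [hG]; rw [Real.exp_log (hypos n x)]
      have hGi : Integrable (G n) ν := heq ▸ hi'.sub hi2
      rw [heq, ofReal_integral_eq_lintegral_ofReal hGi (ae_of_all _ (hG0 n))] at key
      exact key
    calc ∫⁻ x, ENNReal.ofReal (klFun (a x)) ∂ν
        = ∫⁻ x, liminf (fun n => ENNReal.ofReal (G n x)) atTop ∂ν :=
          lintegral_congr fun x => ((hlim x).liminf_eq).symm
      _ ≤ liminf (fun n => ∫⁻ x, ENNReal.ofReal (G n x) ∂ν) atTop :=
          lintegral_liminf_le fun n => (hGm n).ennreal_ofReal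
      _ ≤ K := by
          refine (liminf_le_liminf (Eventually.of_forall hGK)).trans ?_
          simp

/-- The relative entropy with respect to a product measure is at least the sum of the relative
entropies of the marginals. -/
lemma klDiv_fst_add_klDiv_snd_le {μ : Measure (α × β)} [IsProbabilityMeasure μ]
    {ν₁ : Measure α} {ν₂ : Measure β} [IsProbabilityMeasure ν₁] [IsProbabilityMeasure ν₂] :
    klDiv μ.fst ν₁ + klDiv μ.snd ν₂ ≤ klDiv μ (ν₁.prod ν₂) := by
  have hfst : klDiv μ.fst ν₁ ≤ klDiv μ (ν₁.prod ν₂) := by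
    have := klDiv_map_le μ (ν₁.prod ν₂) (g := Prod.fst) measurable_fst
    simpa [Measure.fst] using this
  have hsnd : klDiv μ.snd ν₂ ≤ klDiv μ (ν₁.prod ν₂) := by
    have := klDiv_map_le μ (ν₁.prod ν₂) (g := Prod.snd) measurable_snd
    simpa [Measure.snd] using this
  by_cases htop : klDiv μ.fst ν₁ = ∞
  · rw [htop] at hfst ⊢; simpa using hfst
  rw [add_comm]
  refine add_le_of_le_tsub_right_of_le hfst (klDiv_le_of_forall_integral_le ?_)
  rintro φ₂ hφ₂ ⟨c₂, hc₂⟩ h₂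
  refine ENNReal.le_sub_of_add_le_left htop ?_
  rcases le_or_gt (∫ x, φ₂ x ∂μ.snd) 0 with hneg | hpos₂
  · simpa [ENNReal.ofReal_of_nonpos hneg] using hfst
  have hle₂ := ofReal_integral_le_klDiv (μ := μ.snd) hφ₂ hc₂ h₂
  refine add_le_of_le_tsub_right_of_le (hle₂.trans hsnd) (klDiv_le_of_forall_integral_le ?_)
  rintro φ₁ hφ₁ ⟨c₁, hc₁⟩ h₁
  refine ENNReal.le_sub_of_add_le_left ENNReal.ofReal_ne_top ?_
  rcases le_or_gt (∫ x, φ₁ x ∂μ.fst) 0 with hneg | hpos₁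
  · simpa [ENNReal.ofReal_of_nonpos hneg] using hle₂.trans hsnd
  rw [← ENNReal.ofReal_add hpos₂.le hpos₁.le]
  have hm1 : Measurable (fun z : α × β => φ₁ z.1) := hφ₁.comp measurable_fst
  have hm2 : Measurable (fun z : α × β => φ₂ z.2) := hφ₂.comp measurable_snd
  have key := ofReal_integral_le_klDiv (μ := μ) (ν := ν₁.prod ν₂)
    (φ := fun z => φ₁ z.1 + φ₂ z.2) (hm1.add hm2) (c := c₁ + c₂)
    (fun z => (abs_add_le _ _).trans (add_le_add (hc₁ _) (hc₂ _))) (by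
      simp_rw [Real.exp_add]
      rw [integral_prod_mul (fun x => Real.exp (φ₁ x)) (fun y => Real.exp (φ₂ y)), h₁, h₂, one_mul])
  rw [integral_add (integrable_of_measurable_of_abs_le hm1 fun z => hc₁ z.1)
    (integrable_of_measurable_of_abs_le hm2 fun z => hc₂ z.2)] at key
  rw [Measure.fst, Measure.snd, integral_map measurable_fst.aemeasurable
    hφ₁.aestronglyMeasurable, integral_map measurable_snd.aemeasurable
    hφ₂.aestronglyMeasurable, add_comm]
  exact key

lemma klDiv_prod_eq_add {μ₁ ν₁ : Measure α} {μ₂ ν₂ : Measure β} [IsProbabilityMeasure μ₁]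
    [IsProbabilityMeasure ν₁] [IsProbabilityMeasure μ₂] [IsProbabilityMeasure ν₂] :
    klDiv (μ₁.prod μ₂) (ν₁.prod ν₂) = klDiv μ₁ ν₁ + klDiv μ₂ ν₂ := by
  have h1 := klDiv_compProd_eq_add (μ := μ₁) (ν := ν₁) (κ := Kernel.const α μ₂)
    (η := Kernel.const α ν₂)
  simp only [Measure.compProd_const] at h1
  rw [h1]
  congr 1
  have hswap : ∀ {γ δ : Type _} [MeasurableSpace γ] [MeasurableSpace δ] (κ : Measure γ)
      (τ τ' : Measure δ) [IsProbabilityMeasure κ] [IsProbabilityMeasure τ]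
      [IsProbabilityMeasure τ'], klDiv (κ.prod τ) (κ.prod τ') ≤ klDiv (τ.prod κ) (τ'.prod κ) := by
    intro γ δ _ _ κ τ τ' _ _ _
    have := klDiv_map_le (τ.prod κ) (τ'.prod κ) (g := Prod.swap) measurable_swap
    simpa [Measure.prod_swap] using this
  have h2 := klDiv_compProd_left μ₂ ν₂ (Kernel.const β μ₁)
  simp only [Measure.compProd_const] at h2
  refine le_antisymm ((hswap _ _ _).trans h2.le) (h2.symm.le.trans ?_)
  have := klDiv_map_le (μ₁.prod μ₂) (μ₁.prod ν₂) (g := Prod.swap) measurable_swap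
  simpa [Measure.prod_swap] using this

lemma klDiv_conv_le {M : Type*} [AddMonoid M] [MeasurableSpace M] [MeasurableAdd₂ M]
    {μ₁ ν₁ μ₂ ν₂ : Measure M} [IsProbabilityMeasure μ₁]
    [IsProbabilityMeasure ν₁] [IsProbabilityMeasure μ₂] [IsProbabilityMeasure ν₂] :
    klDiv (μ₁ ∗ μ₂) (ν₁ ∗ ν₂) ≤ klDiv μ₁ ν₁ + klDiv μ₂ ν₂ := by
  rw [← klDiv_prod_eq_add]
  exact klDiv_map_le _ _ measurable_add

/-- Convexity of the relative entropy in its first argument, for arbitrary mixtures. -/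
lemma klDiv_map_prod_le {γ : Type*} [MeasurableSpace γ] {U : Measure γ} [IsProbabilityMeasure U]
    {Q : Measure β} [IsProbabilityMeasure Q] {ν : Measure α} [IsProbabilityMeasure ν]
    {g : γ × β → α} (hg : Measurable g) {K : ℝ≥0∞} (hK : K ≠ ∞)
    (h : ∀ᵐ u ∂U, klDiv (Q.map fun w => g (u, w)) ν ≤ K) :
    klDiv ((U.prod Q).map g) ν ≤ K := by
  have := Measure.isProbabilityMeasure_map (μ := U.prod Q) hg.aemeasurable
  refine klDiv_le_of_forall_integral_le ?_
  rintro φ hφ ⟨c, hc⟩ h1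
  have hint : Integrable (fun z => φ (g z)) (U.prod Q) :=
    integrable_of_measurable_of_abs_le (hφ.comp hg) fun z => hc _
  rw [integral_map hg.aemeasurable hφ.aestronglyMeasurable, integral_prod _ hint]
  refine ENNReal.ofReal_le_of_le_toReal ?_
  calc ∫ u, ∫ w, φ (g (u, w)) ∂Q ∂U ≤ ∫ _, K.toReal ∂U := by
        refine integral_mono_ae hint.integral_prod_left (integrable_const _) ?_
        filter_upwards [h] with u hu
        have hgu : Measurable fun w => g (u, w) := hg.comp measurable_prodMk_left
        have := Measure.isProbabilityMeasure_map (μ := Q) hgu.aemeasurable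
        have h2 := (ofReal_integral_le_klDiv (μ := Q.map fun w => g (u, w)) hφ hc h1).trans hu
        rw [integral_map hgu.aemeasurable hφ.aestronglyMeasurable] at h2
        exact (ENNReal.ofReal_le_iff_le_toReal hK).1 h2
    _ = K.toReal := by simp

lemma klDiv_convexComb_le {μ₁ μ₂ ν : Measure α} [IsProbabilityMeasure μ₁]
    [IsProbabilityMeasure μ₂] [IsProbabilityMeasure ν] {a b : ℝ≥0} (hab : a + b = 1) :
    klDiv (a • μ₁ + b • μ₂) ν ≤ a * klDiv μ₁ ν + b * klDiv μ₂ ν := by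
  have : IsProbabilityMeasure (a • μ₁ + b • μ₂) := ⟨by
    simp only [Measure.coe_add, Measure.coe_nnreal_smul_apply, Pi.add_apply, measure_univ, mul_one]
    exact_mod_cast hab⟩
  refine klDiv_le_of_forall_integral_le ?_
  rintro φ hφ ⟨c, hc⟩ h1
  have hi : ∀ μ : Measure α, [IsFiniteMeasure μ] → Integrable φ μ := fun μ _ =>
    integrable_of_measurable_of_abs_le hφ hc
  rw [integral_add_measure (hi _) (hi _), integral_smul_nnreal_measure,
    integral_smul_nnreal_measure]
  refine ENNReal.ofReal_add_le.trans (add_le_add ?_ ?_)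
  · rw [NNReal.smul_def, smul_eq_mul, ENNReal.ofReal_mul (by positivity), ENNReal.ofReal_coe_nnreal]
    gcongr; exact ofReal_integral_le_klDiv hφ hc h1
  · rw [NNReal.smul_def, smul_eq_mul, ENNReal.ofReal_mul (by positivity), ENNReal.ofReal_coe_nnreal]
    gcongr; exact ofReal_integral_le_klDiv hφ hc h1

/-- Upper bound on the entropy of a two-component mixture whose components are both dominated by
the reference measure.  This is Jensen's inequality in the dual formula. -/
lemma klDiv_mixture_le {κ₁ κ₂ ν : Measure α} [IsProbabilityMeasure κ₁] [IsProbabilityMeasure κ₂]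
    [IsProbabilityMeasure ν] {p q : ℝ≥0} (hpq : q + p = 1) {a₁ a₂ : ℝ≥0} (h1 : 0 < a₁)
    (h2 : 0 < a₂) (hν : a₁ • κ₁ + a₂ • κ₂ ≤ ν) :
    klDiv (q • κ₁ + p • κ₂) ν ≤
      ENNReal.ofReal (q * Real.log (q / a₁) + p * Real.log (p / a₂)) := by
  have : IsProbabilityMeasure (q • κ₁ + p • κ₂) := ⟨by
    simp only [Measure.coe_add, Measure.coe_nnreal_smul_apply, Pi.add_apply, measure_univ, mul_one]
    exact_mod_cast hpq⟩
  refine klDiv_le_of_forall_integral_le ?_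
  rintro φ hφ ⟨c, hc⟩ hone
  have hi : ∀ μ : Measure α, [IsFiniteMeasure μ] → Integrable φ μ := fun μ _ =>
    integrable_of_measurable_of_abs_le hφ hc
  have he : ∀ μ : Measure α, [IsFiniteMeasure μ] → Integrable (fun x => Real.exp (φ x)) μ :=
    fun μ _ => integrable_exp_of_abs_le hφ hc
  have hjen : ∀ μ : Measure α, [IsProbabilityMeasure μ] →
      ∫ x, φ x ∂μ ≤ Real.log (∫ x, Real.exp (φ x) ∂μ) := by
    intro μ _
    have hpos : 0 < ∫ x, Real.exp (φ x) ∂μ := integral_exp_pos (he μ)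
    rw [Real.le_log_iff_exp_le hpos]
    exact convexOn_exp.map_integral_le Real.continuous_exp.continuousOn isClosed_univ
      (ae_of_all _ fun _ => mem_univ _) (hi μ) (he μ)
  set E₁ := ∫ x, Real.exp (φ x) ∂κ₁ with hE₁
  set E₂ := ∫ x, Real.exp (φ x) ∂κ₂ with hE₂
  have hE₁pos : 0 < E₁ := integral_exp_pos (he _)
  have hE₂pos : 0 < E₂ := integral_exp_pos (he _)
  have hsum : a₁ * E₁ + a₂ * E₂ ≤ 1 := by
    have := integral_mono_measure hν (ae_of_all _ fun x => (Real.exp_pos (φ x)).le) (he ν)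
    rwa [hone, integral_add_measure (he _) (he _), integral_smul_nnreal_measure,
      integral_smul_nnreal_measure] at this
  rw [integral_add_measure (hi _) (hi _), integral_smul_nnreal_measure,
    integral_smul_nnreal_measure]
  refine ENNReal.ofReal_le_ofReal ?_
  have h1' : (0 : ℝ) < a₁ := h1
  have h2' : (0 : ℝ) < a₂ := h2
  -- Gibbs' inequality for the two weights
  have hG : ∀ (w a E : ℝ), 0 ≤ w → 0 < a → 0 < E →
      w * Real.log E ≤ w * Real.log (w / a) + (a * E - w) := by
    intro w a E hw ha hE
    rcases hw.eq_or_lt with rfl | hw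
    · simp; positivity
    · have := Real.log_le_sub_one_of_pos (show 0 < a * E / w by positivity)
      have h3 : Real.log (a * E / w) = Real.log E - Real.log (w / a) := by
        rw [Real.log_div (by positivity) hw.ne', Real.log_mul ha.ne' hE.ne',
          Real.log_div hw.ne' ha.ne']; ring
      rw [h3] at this
      have h4 := mul_le_mul_of_nonneg_left this hw.le
      have h5 : w * (a * E / w - 1) = a * E - w := by field_simp
      linarith
  have e1 := hG q a₁ E₁ q.2 h1' hE₁pos
  have e2 := hG p a₂ E₂ p.2 h2' hE₂pos
  have e3 := mul_le_mul_of_nonneg_left (hjen κ₁) q.2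
  have e4 := mul_le_mul_of_nonneg_left (hjen κ₂) p.2
  have e5 : (q : ℝ) + p = 1 := by exact_mod_cast hpq
  simp only [NNReal.smul_def, smul_eq_mul]
  simp only [NNReal.val_eq_coe] at e3 e4
  linarith

end KullbackLeibler

/-! ### Poisson laws -/

section Poisson

open InformationTheory

variable {X : Type*} [MeasurableSpace X]

lemma measurable_measure_restrict {A : Set X} (hA : MeasurableSet A) :
    Measurable fun C : Measure X => C.restrict A :=
  Measure.measurable_of_measurable_coe _ fun s hs => by
    simp only [Measure.restrict_apply hs]
    exact Measure.measurable_coe (hs.inter hA)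

lemma measurable_sum_dirac {n : ℕ} :
    Measurable fun x : Fin n → X => ∑ i, Measure.dirac (x i) :=
  Finset.measurable_fun_sum _ fun i _ => Measure.measurable_dirac.comp (measurable_pi_apply i)

/-- The image of the `n`-fold power of `m` under `x ↦ δ_{x_1} + ... + δ_{x_n}`. -/
noncomputable def sumDiracLaw (m : Measure X) (n : ℕ) : Measure (Measure X) :=
  (Measure.pi fun _ : Fin n => m).map fun x => ∑ i, Measure.dirac (x i)

/-- The `n`-point part `m^{⊗ n} / n!` of the Poisson law, before normalization. -/
noncomputable def poissonPart (m : Measure X) (n : ℕ) : Measure (Measure X) :=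
  (Nat.factorial n : ℝ≥0∞)⁻¹ • sumDiracLaw m n

/-- The law of the Poisson point process with finite intensity measure `m`. -/
noncomputable def poissonOf (m : Measure X) : Measure (Measure X) :=
  ENNReal.ofReal (Real.exp (-(m univ).toReal)) • Measure.sum fun n : ℕ => poissonPart m n

lemma poissonLaw_eq_poissonOf {d : ℕ} (A : Set (EuclideanSpace ℝ (Fin d))) :
    poissonLaw A = poissonOf (volume.restrict A) := by
  simp [poissonLaw, poissonOf, poissonPart, sumDiracLaw]

instance (m : Measure X) [IsFiniteMeasure m] (n : ℕ) : IsFiniteMeasure (sumDiracLaw m n) := by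
  unfold sumDiracLaw; infer_instance

instance (m : Measure X) [IsFiniteMeasure m] (n : ℕ) : SFinite (poissonPart m n) := by
  unfold poissonPart; infer_instance

lemma sumDiracLaw_univ (m : Measure X) [IsFiniteMeasure m] (n : ℕ) :
    sumDiracLaw m n univ = m univ ^ n := by
  rw [sumDiracLaw, Measure.map_apply measurable_sum_dirac MeasurableSet.univ, preimage_univ,
    Measure.pi_univ]
  simp

/-- `sumDiracLaw m n` is the `n`-fold convolution power of the law of `δ_x`, `x ∼ m`. -/
lemma sumDiracLaw_succ (m : Measure X) [IsFiniteMeasure m] (n : ℕ) :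
    sumDiracLaw m (n + 1) = (m.map Measure.dirac) ∗ sumDiracLaw m n := by
  have h := (measurePreserving_piFinSuccAbove (fun _ : Fin (n + 1) => m) 0).symm
  rw [sumDiracLaw, ← h.map_eq, Measure.map_map measurable_sum_dirac h.measurable, sumDiracLaw,
    Measure.conv, Measure.map_prod_map _ _ Measure.measurable_dirac measurable_sum_dirac,
    Measure.map_map measurable_add
      (Measure.measurable_dirac.prodMap measurable_sum_dirac)]
  congr 1
  ext x : 1
  simp [Fin.sum_univ_succ, MeasurableEquiv.piFinSuccAbove, Fin.insertNthEquiv]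

lemma poissonPart_succ (m : Measure X) [IsFiniteMeasure m] (n : ℕ) :
    ((n : ℝ≥0∞) + 1) • poissonPart m (n + 1) = (m.map Measure.dirac) ∗ poissonPart m n := by
  rw [poissonPart, sumDiracLaw_succ, poissonPart, Measure.conv_smul_right, smul_smul]
  congr 1
  have h1 : ((n : ℝ≥0∞) + 1) ≠ 0 := by simp
  have h2 : ((n : ℝ≥0∞) + 1) ≠ ∞ := by simp
  rw [Nat.factorial_succ]
  push_cast
  rw [ENNReal.mul_inv (Or.inl h1) (Or.inl h2), ← mul_assoc, ENNReal.mul_inv_cancel h1 h2, one_mul]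

lemma sFinite_finset_sum {ι : Type*} (s : Finset ι) {Y : Type*} [MeasurableSpace Y]
    (μ : ι → Measure Y) [∀ i, SFinite (μ i)] : SFinite (∑ i ∈ s, μ i) := by
  rw [← Measure.sum_coe_finset]
  infer_instance

lemma conv_finset_sum {ι Y : Type*} [AddMonoid Y] [MeasurableSpace Y] [MeasurableAdd₂ Y]
    (s : Finset ι) (a : Measure Y) [SFinite a] (μ : ι → Measure Y) [∀ i, SFinite (μ i)] :
    a ∗ (∑ i ∈ s, μ i) = ∑ i ∈ s, a ∗ μ i := by
  classical
  induction s using Finset.induction_on with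
  | empty => simp
  | insert i s hi ih =>
    have := sFinite_finset_sum s μ
    rw [Finset.sum_insert hi, Finset.sum_insert hi, Measure.conv_add, ih]

/-- The binomial theorem for the convolution product. -/
lemma poissonPart_add (a b : Measure X) [IsFiniteMeasure a] [IsFiniteMeasure b] (n : ℕ) :
    poissonPart (a + b) n =
      ∑ kl ∈ Finset.HasAntidiagonal.antidiagonal n, poissonPart a kl.1 ∗ poissonPart b kl.2 := by
  induction n with
  | zero =>
    have h0 : ∀ m : Measure X, poissonPart m 0 = Measure.dirac 0 := by
      intro m
      simp [poissonPart, sumDiracLaw]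
    simp [h0]
  | succ n ih =>
    have h1 : ((n : ℝ≥0∞) + 1) ≠ 0 := by simp
    have h2 : ((n : ℝ≥0∞) + 1) ≠ ∞ := by simp
    have key : ((n : ℝ≥0∞) + 1) • poissonPart (a + b) (n + 1) = ((n : ℝ≥0∞) + 1) •
        ∑ kl ∈ Finset.HasAntidiagonal.antidiagonal (n + 1), poissonPart a kl.1 ∗ poissonPart b kl.2 := by
      set W : ℕ × ℕ → Measure (Measure X) := fun kl => poissonPart a kl.1 ∗ poissonPart b kl.2
        with hW
      have e1 : ∀ kl : ℕ × ℕ, (a.map Measure.dirac) ∗ W kl =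
          ((kl.1 : ℝ≥0∞) + 1) • W (kl.1 + 1, kl.2) := by
        intro kl
        simp only [hW]
        rw [← Measure.conv_assoc, ← poissonPart_succ, Measure.conv_smul_left]
      have e2 : ∀ kl : ℕ × ℕ, (b.map Measure.dirac) ∗ W kl =
          ((kl.2 : ℝ≥0∞) + 1) • W (kl.1, kl.2 + 1) := by
        intro kl
        simp only [hW]
        rw [← Measure.conv_assoc, Measure.conv_comm (b.map Measure.dirac), Measure.conv_assoc,
          ← poissonPart_succ, Measure.conv_smul_right]
      have ih' : poissonPart (a + b) n = ∑ kl ∈ Finset.HasAntidiagonal.antidiagonal n, W kl := ih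
      rw [poissonPart_succ, ih', Measure.map_add _ _ Measure.measurable_dirac]
      have := sFinite_finset_sum (Finset.HasAntidiagonal.antidiagonal n) W
      rw [Measure.add_conv, conv_finset_sum, conv_finset_sum]
      simp only [e1, e2]
      have s1 := Finset.Nat.sum_antidiagonal_succ (n := n)
        (f := fun kl : ℕ × ℕ => (kl.1 : ℝ≥0∞) • W kl)
      have s2 := Finset.Nat.sum_antidiagonal_succ' (n := n)
        (f := fun kl : ℕ × ℕ => (kl.2 : ℝ≥0∞) • W kl)
      simp only [Nat.cast_zero, zero_smul, zero_add, Nat.cast_add, Nat.cast_one] at s1 s2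
      rw [← s1, ← s2, ← Finset.sum_add_distrib, Finset.smul_sum]
      refine Finset.sum_congr rfl fun kl hkl => ?_
      rw [← add_smul]
      congr 1
      rw [Finset.HasAntidiagonal.mem_antidiagonal] at hkl
      exact_mod_cast hkl
    have := congrArg (fun μ => ((n : ℝ≥0∞) + 1)⁻¹ • μ) key
    simpa only [smul_smul, ENNReal.inv_mul_cancel h1 h2, one_smul] using this

/-- A Poisson process with intensity `a + b` is the superposition of independent Poisson processes
with intensities `a` and `b`. -/
lemma poissonOf_add (a b : Measure X) [IsFiniteMeasure a] [IsFiniteMeasure b] :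
    poissonOf (a + b) = poissonOf a ∗ poissonOf b := by
  have hexp : ENNReal.ofReal (Real.exp (-((a + b) univ).toReal)) =
      ENNReal.ofReal (Real.exp (-(a univ).toReal)) *
        ENNReal.ofReal (Real.exp (-(b univ).toReal)) := by
    rw [← ENNReal.ofReal_mul (Real.exp_pos _).le, ← Real.exp_add, Measure.add_apply,
      ENNReal.toReal_add (measure_ne_top _ _) (measure_ne_top _ _)]
    congr 2; ring
  rw [poissonOf, poissonOf, poissonOf, Measure.conv_smul_right, Measure.conv_smul_left, smul_smul,
    hexp, mul_comm]
  congr 1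
  ext S hS
  rw [Measure.conv, Measure.prod_sum, Measure.map_sum measurable_add.aemeasurable,
    Measure.sum_apply _ hS, Measure.sum_apply _ hS]
  simp only [poissonPart_add, Measure.coe_finsetSum, Finset.sum_apply]
  rw [← Equiv.tsum_eq (Finset.HasAntidiagonal.sigmaAntidiagonalEquivProd (A := ℕ)), ENNReal.tsum_sigma']
  refine tsum_congr fun n => ?_
  rw [tsum_fintype, Finset.univ_eq_attach, ← Finset.sum_attach]
  rfl

lemma ofReal_exp_eq_tsum {x : ℝ} (hx : 0 ≤ x) :
    ENNReal.ofReal (Real.exp x) = ∑' n : ℕ, (Nat.factorial n : ℝ≥0∞)⁻¹ * ENNReal.ofReal x ^ n := by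
  rw [Real.exp_eq_exp_ℝ, NormedSpace.exp_eq_tsum_div,
    ENNReal.ofReal_tsum_of_nonneg (fun n => by positivity) (Real.summable_pow_div_factorial x)]
  refine tsum_congr fun n => ?_
  rw [div_eq_inv_mul, ENNReal.ofReal_mul (by positivity),
    ENNReal.ofReal_inv_of_pos (by positivity), ENNReal.ofReal_natCast, ENNReal.ofReal_pow hx]

/-- The exponential moments of the number of points of a Poisson process. -/
lemma lintegral_exp_poissonOf (m : Measure X) [IsFiniteMeasure m] (t : ℝ) :
    ∫⁻ C, ENNReal.ofReal (Real.exp (t * (C univ).toReal)) ∂poissonOf m =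
      ENNReal.ofReal (Real.exp ((Real.exp t - 1) * (m univ).toReal)) := by
  have hmeas : Measurable fun C : Measure X =>
      ENNReal.ofReal (Real.exp (t * (C univ).toReal)) :=
    ((Measure.measurable_coe MeasurableSet.univ).ennreal_toReal.const_mul t).exp.ennreal_ofReal
  have hm : ENNReal.ofReal (m univ).toReal = m univ := ENNReal.ofReal_toReal (measure_ne_top _ _)
  rw [poissonOf, lintegral_smul_measure, lintegral_sum_measure]
  have : ∀ n : ℕ, ∫⁻ C, ENNReal.ofReal (Real.exp (t * (C univ).toReal)) ∂poissonPart m n =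
      (Nat.factorial n : ℝ≥0∞)⁻¹ * ENNReal.ofReal (Real.exp t * (m univ).toReal) ^ n := by
    intro n
    rw [poissonPart, lintegral_smul_measure, sumDiracLaw,
      lintegral_map hmeas measurable_sum_dirac, smul_eq_mul]
    congr 1
    simp only [Measure.coe_finsetSum, Finset.sum_apply, measure_univ, Finset.sum_const,
      Finset.card_univ, Fintype.card_fin, nsmul_eq_mul, mul_one, ENNReal.toReal_natCast,
      lintegral_const, Measure.pi_univ, Finset.prod_const]
    rw [ENNReal.ofReal_mul (Real.exp_pos _).le, mul_pow, hm, mul_comm t, Real.exp_nat_mul,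
      ENNReal.ofReal_pow (Real.exp_pos _).le]
  simp_rw [this]
  rw [← ofReal_exp_eq_tsum (by positivity), smul_eq_mul, ← ENNReal.ofReal_mul (Real.exp_pos _).le,
    ← Real.exp_add]
  congr 2; ring

instance (m : Measure X) [IsFiniteMeasure m] : IsProbabilityMeasure (poissonOf m) := ⟨by
  simpa using lintegral_exp_poissonOf m 0⟩

lemma sumDiracLaw_map {Y : Type*} [MeasurableSpace Y] (m : Measure X) [IsFiniteMeasure m]
    {f : X → Y} (hf : Measurable f) (n : ℕ) :
    (sumDiracLaw m n).map (fun C => C.map f) = sumDiracLaw (m.map f) n := by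
  rw [sumDiracLaw, sumDiracLaw, Measure.map_map (Measure.measurable_map f hf) measurable_sum_dirac,
    ← Measure.pi_map_pi (fun _ => hf.aemeasurable),
    Measure.map_map measurable_sum_dirac (by fun_prop)]
  congr 1
  ext x : 1
  simp only [Function.comp_apply]
  rw [← Measure.mapₗ_apply_of_measurable hf, map_sum]
  simp [Measure.mapₗ_apply_of_measurable hf, Measure.map_dirac' hf]

lemma poissonOf_map {Y : Type*} [MeasurableSpace Y] (m : Measure X) [IsFiniteMeasure m]
    {f : X → Y} (hf : Measurable f) :
    (poissonOf m).map (fun C => C.map f) = poissonOf (m.map f) := by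
  rw [poissonOf, poissonOf, Measure.map_smul,
    Measure.map_sum (Measure.measurable_map f hf).aemeasurable]
  simp only [poissonPart, Measure.map_smul, sumDiracLaw_map m hf]
  rw [Measure.map_apply hf MeasurableSet.univ, preimage_univ]

lemma ae_poissonOf_apply_eq_zero (m : Measure X) [IsFiniteMeasure m] {S : Set X}
    (hS : MeasurableSet S) (h0 : m S = 0) : ∀ᵐ C ∂poissonOf m, C S = 0 := by
  have hset : MeasurableSet {C : Measure X | C S = 0} :=
    Measure.measurable_coe hS (measurableSet_singleton 0)
  refine Measure.ae_smul_measure ?_ _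
  rw [Measure.ae_sum_iff' hset]
  intro n
  refine Measure.ae_smul_measure ?_ _
  rw [sumDiracLaw, ae_map_iff measurable_sum_dirac.aemeasurable hset]
  have : ∀ i : Fin n, ∀ᵐ x ∂(Measure.pi fun _ : Fin n => m), x i ∉ S := fun i =>
    (Measure.quasiMeasurePreserving_eval (fun _ : Fin n => m) i).ae
      (measure_eq_zero_iff_ae_notMem.1 h0)
  filter_upwards [ae_all_iff.2 this] with x hx
  simp [Measure.dirac_apply' _ hS, hx]

/-- Restrictions of a Poisson process to disjoint windows are independent Poisson processes. -/
lemma poissonOf_map_restrict_prod (m : Measure X) {A B : Set X} (hA : MeasurableSet A)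
    (hB : MeasurableSet B) (hAB : Disjoint A B) (hmA : m A ≠ ∞) (hmB : m B ≠ ∞) :
    (poissonOf (m.restrict (A ∪ B))).map (fun C => (C.restrict A, C.restrict B)) =
      (poissonOf (m.restrict A)).prod (poissonOf (m.restrict B)) := by
  have : IsFiniteMeasure (m.restrict A) := ⟨by simpa using hmA.lt_top⟩
  have : IsFiniteMeasure (m.restrict B) := ⟨by simpa using hmB.lt_top⟩
  have hr : Measurable fun C : Measure X => (C.restrict A, C.restrict B) :=
    (measurable_measure_restrict hA).prodMk (measurable_measure_restrict hB)
  rw [Measure.restrict_union hAB hB, poissonOf_add, Measure.conv,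
    Measure.map_map hr measurable_add]
  conv_rhs => rw [← Measure.map_id (μ := (poissonOf (m.restrict A)).prod _)]
  refine Measure.map_congr ?_
  have k1 : ∀ᵐ C ∂poissonOf (m.restrict A), C.restrict A = C ∧ C.restrict B = 0 := by
    have h1 := ae_poissonOf_apply_eq_zero (m.restrict A) hA.compl (by
      rw [Measure.restrict_apply hA.compl, compl_inter_self, measure_empty])
    have h2 := ae_poissonOf_apply_eq_zero (m.restrict A) hB (by
      rw [Measure.restrict_apply hB, hAB.symm.inter_eq]; simp)
    filter_upwards [h1, h2] with C c1 c2
    exact ⟨Measure.restrict_eq_self_of_ae_mem (by rwa [ae_iff]), Measure.restrict_eq_zero.2 c2⟩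
  have k2 : ∀ᵐ C ∂poissonOf (m.restrict B), C.restrict B = C ∧ C.restrict A = 0 := by
    have h1 := ae_poissonOf_apply_eq_zero (m.restrict B) hB.compl (by
      rw [Measure.restrict_apply hB.compl, compl_inter_self, measure_empty])
    have h2 := ae_poissonOf_apply_eq_zero (m.restrict B) hA (by
      rw [Measure.restrict_apply hA, hAB.inter_eq]; simp)
    filter_upwards [h1, h2] with C c1 c2
    exact ⟨Measure.restrict_eq_self_of_ae_mem (by rwa [ae_iff]), Measure.restrict_eq_zero.2 c2⟩
  filter_upwards [Measure.quasiMeasurePreserving_fst.ae k1,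
    Measure.quasiMeasurePreserving_snd.ae k2] with z h1 h2
  simp [Measure.restrict_add, h1.1, h1.2, h2.1, h2.2]

end Poisson

/-! ### The entropy of a point process in a window -/

section WindowEntropy

open InformationTheory

variable {d : ℕ}

/-- The relative entropy, with respect to the Poisson law, of a random point configuration seen in
the window `A`. -/
noncomputable def windowEntropy (P : Measure (Measure (EuclideanSpace ℝ (Fin d))))
    (A : Set (EuclideanSpace ℝ (Fin d))) : ℝ≥0∞ :=
  klDiv (P.map fun C => C.restrict A) (poissonLaw A)

lemma isProbabilityMeasure_poissonLaw {A : Set (EuclideanSpace ℝ (Fin d))} (hA : volume A ≠ ∞) :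
    IsProbabilityMeasure (poissonLaw A) := by
  have : IsFiniteMeasure ((volume : Measure (EuclideanSpace ℝ (Fin d))).restrict A) :=
    ⟨by simpa using hA.lt_top⟩
  rw [poissonLaw_eq_poissonOf]; infer_instance

/-- Superadditivity of the entropy: the Poisson law factorizes over disjoint windows. -/
lemma windowEntropy_add_le (P : Measure (Measure (EuclideanSpace ℝ (Fin d))))
    [IsProbabilityMeasure P] {A B : Set (EuclideanSpace ℝ (Fin d))} (hA : MeasurableSet A)
    (hB : MeasurableSet B) (hAB : Disjoint A B) (hvA : volume A ≠ ∞) (hvB : volume B ≠ ∞) :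
    windowEntropy P A + windowEntropy P B ≤ windowEntropy P (A ∪ B) := by
  have := isProbabilityMeasure_poissonLaw hvA
  have := isProbabilityMeasure_poissonLaw hvB
  have hvAB : volume (A ∪ B) ≠ ∞ := measure_union_ne_top hvA hvB
  have := isProbabilityMeasure_poissonLaw hvAB
  have hmA := measurable_measure_restrict hA
  have hmB := measurable_measure_restrict hB
  have hmAB := measurable_measure_restrict (hA.union hB)
  have hr : Measurable fun C : Measure (EuclideanSpace ℝ (Fin d)) =>
      (C.restrict A, C.restrict B) := hmA.prodMk hmB
  have hP := Measure.isProbabilityMeasure_map (μ := P) hr.aemeasurable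
  have hP' := Measure.isProbabilityMeasure_map (μ := P) hmAB.aemeasurable
  have h1 := klDiv_fst_add_klDiv_snd_le (μ := P.map fun C => (C.restrict A, C.restrict B))
    (ν₁ := poissonLaw A) (ν₂ := poissonLaw B)
  rw [Measure.fst_map_prodMk hmB, Measure.snd_map_prodMk hmA] at h1
  refine h1.trans ?_
  have h2 := klDiv_map_le (P.map fun C => C.restrict (A ∪ B)) (poissonLaw (A ∪ B)) hr
  rw [Measure.map_map hr hmAB, poissonLaw_eq_poissonOf (A ∪ B),
    poissonOf_map_restrict_prod _ hA hB hAB hvA hvB, ← poissonLaw_eq_poissonOf,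
    ← poissonLaw_eq_poissonOf] at h2
  rw [windowEntropy, poissonLaw_eq_poissonOf (A ∪ B)]
  refine le_trans (le_of_eq ?_) h2
  congr 2
  ext C : 1
  simp [Measure.restrict_restrict, hA, hB, inter_eq_self_of_subset_left]

lemma windowEntropy_mono (P : Measure (Measure (EuclideanSpace ℝ (Fin d))))
    [IsProbabilityMeasure P] {A B : Set (EuclideanSpace ℝ (Fin d))} (hA : MeasurableSet A)
    (hB : MeasurableSet B) (hAB : A ⊆ B) (hvB : volume B ≠ ∞) :
    windowEntropy P A ≤ windowEntropy P B := by
  have := windowEntropy_add_le P hA (hB.diff hA) disjoint_sdiff_right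
    (measure_ne_top_of_subset hAB hvB) (measure_ne_top_of_subset sdiff_subset hvB)
  rw [union_sdiff_cancel hAB] at this
  exact le_self_add.trans this

lemma poissonLaw_map_sub (A : Set (EuclideanSpace ℝ (Fin d))) (hvA : volume A ≠ ∞)
    (x : EuclideanSpace ℝ (Fin d)) :
    (poissonLaw A).map (fun C => C.map fun p => p - x) = poissonLaw ((fun p => p + x) ⁻¹' A) := by
  have : IsFiniteMeasure ((volume : Measure (EuclideanSpace ℝ (Fin d))).restrict A) :=
    ⟨by simpa using hvA.lt_top⟩
  rw [poissonLaw_eq_poissonOf, poissonLaw_eq_poissonOf, poissonOf_map _ (by fun_prop)]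
  congr 1
  have he : MeasurableEmbedding fun p : EuclideanSpace ℝ (Fin d) => p - x :=
    (MeasurableEquiv.subRight x).measurableEmbedding
  have hpre : A = (fun p => p - x) ⁻¹' ((fun p => p + x) ⁻¹' A) := by ext p; simp
  conv_lhs => rw [hpre]
  rw [← he.restrict_map, (measurePreserving_sub_right volume x).map_eq]

/-- Translating both the process and the window does not increase the entropy (and hence, translating
back, leaves it unchanged). -/
lemma windowEntropy_map_sub_le (P : Measure (Measure (EuclideanSpace ℝ (Fin d))))
    [IsProbabilityMeasure P] {A : Set (EuclideanSpace ℝ (Fin d))} (hA : MeasurableSet A)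
    (hvA : volume A ≠ ∞) (x : EuclideanSpace ℝ (Fin d)) :
    windowEntropy (P.map fun C => C.map fun p => p - x) ((fun p => p + x) ⁻¹' A) ≤
      windowEntropy P A := by
  have := isProbabilityMeasure_poissonLaw hvA
  have hP' := Measure.isProbabilityMeasure_map (μ := P) (measurable_measure_restrict hA).aemeasurable
  have hm : Measurable fun p : EuclideanSpace ℝ (Fin d) => p - x := by fun_prop
  have hmm := Measure.measurable_map _ hm
  have h := klDiv_map_le (P.map fun C => C.restrict A) (poissonLaw A) hmm
  rw [poissonLaw_map_sub A hvA, Measure.map_map hmm (measurable_measure_restrict hA)] at h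
  refine le_trans (le_of_eq ?_) h
  have hA' : MeasurableSet ((fun p => p + x) ⁻¹' A) := by
    exact (measurable_id.add_const x) hA
  rw [windowEntropy, Measure.map_map (measurable_measure_restrict hA') hmm]
  congr 2
  ext C : 1
  have he : MeasurableEmbedding fun p : EuclideanSpace ℝ (Fin d) => p - x :=
    (MeasurableEquiv.subRight x).measurableEmbedding
  simp only [Function.comp_apply]
  rw [he.restrict_map]
  congr 2
  ext p; simp

/-- Lower bound on the entropy in terms of the mean number of points: compare with a Poisson
process of intensity `exp t`. -/
lemma le_windowEntropy (P : Measure (Measure (EuclideanSpace ℝ (Fin d))))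
    [IsProbabilityMeasure P] {A : Set (EuclideanSpace ℝ (Fin d))} (hA : MeasurableSet A)
    (hvA : volume A ≠ ∞) (hPA : ∫⁻ C, C A ∂P ≠ ∞) (t : ℝ) :
    ENNReal.ofReal (t * (∫⁻ C, C A ∂P).toReal - (Real.exp t - 1) * (volume A).toReal) ≤
      windowEntropy P A := by
  have := isProbabilityMeasure_poissonLaw hvA
  have : IsFiniteMeasure ((volume : Measure (EuclideanSpace ℝ (Fin d))).restrict A) :=
    ⟨by simpa using hvA.lt_top⟩
  have hmA := measurable_measure_restrict hA
  have hP' := Measure.isProbabilityMeasure_map (μ := P) hmA.aemeasurable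
  have hcm : Measurable fun C : Measure (EuclideanSpace ℝ (Fin d)) => C univ :=
    Measure.measurable_coe MeasurableSet.univ
  set v := (volume A).toReal
  set φ : Measure (EuclideanSpace ℝ (Fin d)) → ℝ :=
    fun C => t * (C univ).toReal - (Real.exp t - 1) * v with hφ
  have hNint : Integrable (fun C : Measure (EuclideanSpace ℝ (Fin d)) => (C A).toReal) P :=
    integrable_toReal_of_lintegral_ne_top (Measure.measurable_coe hA).aemeasurable hPA
  have hN : ∫ C, (C A).toReal ∂P = (∫⁻ C, C A ∂P).toReal :=
    integral_toReal (Measure.measurable_coe hA).aemeasurable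
      (ae_lt_top (Measure.measurable_coe hA) hPA)
  have hφm : Measurable φ := (hcm.ennreal_toReal.const_mul t).sub_const _
  have hφint : Integrable φ (P.map fun C => C.restrict A) := by
    rw [integrable_map_measure hφm.aestronglyMeasurable hmA.aemeasurable]
    simp only [hφ, Function.comp_def, Measure.restrict_apply_univ]
    exact (hNint.const_mul t).sub (integrable_const _)
  have hlint : ∫⁻ C, ENNReal.ofReal (Real.exp (φ C)) ∂poissonLaw A = 1 := by
    have h := lintegral_exp_poissonOf (volume.restrict A) t
    simp only [hφ, sub_eq_add_neg, Real.exp_add, ENNReal.ofReal_mul (Real.exp_pos _).le]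
    rw [lintegral_mul_const _ (hcm.ennreal_toReal.const_mul t).exp.ennreal_ofReal, poissonLaw_eq_poissonOf, h,
      ← ENNReal.ofReal_mul (Real.exp_pos _).le, ← Real.exp_add]
    simp only [Measure.restrict_apply_univ, v]
    rw [← sub_eq_add_neg, ← sub_eq_add_neg, sub_self, Real.exp_zero, ENNReal.ofReal_one]
  have hexpi : Integrable (fun C => Real.exp (φ C)) (poissonLaw A) := by
    refine ⟨hφm.exp.aestronglyMeasurable, ?_⟩
    rw [hasFiniteIntegral_iff_ofReal (ae_of_all _ fun _ => (Real.exp_pos _).le), hlint]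
    exact ENNReal.one_lt_top
  have hexp1 : ∫ C, Real.exp (φ C) ∂poissonLaw A = 1 := by
    rw [integral_eq_lintegral_of_nonneg_ae (ae_of_all _ fun _ => (Real.exp_pos _).le)
      hφm.exp.aestronglyMeasurable, hlint, ENNReal.toReal_one]
  have h := ofReal_integral_sub_le_klDiv hφint hexpi
  rw [integral_sub hexpi (integrable_const _), hexp1, integral_map hmA.aemeasurable
    hφm.aestronglyMeasurable] at h
  simp only [hφ, Measure.restrict_apply_univ, integral_const, probReal_univ, one_smul, sub_self,
    sub_zero] at h
  rw [integral_sub (hNint.const_mul t) (integrable_const _), integral_const_mul, hN] at h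
  simpa [windowEntropy] using h

end WindowEntropy

/-! ### Point configurations as finite sums of Dirac masses -/

section Configurations

/-- A finite measure with natural number values is a finite sum of Dirac masses. -/
lemma exists_eq_sum_dirac {X : Type*} [MetricSpace X] [SecondCountableTopology X]
    [MeasurableSpace X] [BorelSpace X] {n : ℕ} {μ : Measure X}
    (hμ : ∀ B, MeasurableSet B → ∃ k : ℕ, μ B = k) (hn : μ univ = n) :
    ∃ x : Fin n → X, μ = ∑ i, Measure.dirac (x i) := by
  induction n generalizing μ with
  | zero =>
    refine ⟨Fin.elim0, ?_⟩
    simpa using hn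
  | succ n ih =>
    have : IsFiniteMeasure μ := ⟨by rw [hn]; exact ENNReal.natCast_lt_top _⟩
    have h0 : μ univ ≠ 0 := by rw [hn]; simp
    obtain ⟨p, -, hp⟩ := exists_mem_forall_mem_nhdsWithin_pos_measure h0
    have hp1 : 1 ≤ μ {p} := by
      by_contra! hlt
      obtain ⟨U, hU, hUo, hU1⟩ := Set.exists_isOpen_lt_of_lt {p} 1 hlt
      obtain ⟨k, hk⟩ := hμ U hUo.measurableSet
      have := hp U (mem_nhdsWithin_of_mem_nhds (hUo.mem_nhds (by simpa using hU)))
      rw [hk] at this hU1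
      have h1 : 0 < k := by exact_mod_cast this
      have h2 : k < 1 := by exact_mod_cast hU1
      omega
    have hle : Measure.dirac p ≤ μ := by
      refine Measure.le_iff.2 fun B hB => ?_
      rw [Measure.dirac_apply' _ hB]
      by_cases hpB : p ∈ B
      · simpa [hpB] using hp1.trans (measure_mono (singleton_subset_iff.2 hpB))
      · simp [hpB]
    obtain ⟨x, hx⟩ := ih (μ := μ - Measure.dirac p) (by
        intro B hB
        obtain ⟨k, hk⟩ := hμ B hB
        rw [Measure.sub_apply hB hle, hk, Measure.dirac_apply' _ hB]
        by_cases hpB : p ∈ B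
        · exact ⟨k - 1, by simp [hpB]⟩
        · exact ⟨k, by simp [hpB]⟩) (by
        rw [Measure.sub_apply MeasurableSet.univ hle, hn]
        simp)
    refine ⟨Fin.cons p x, ?_⟩
    rw [Fin.sum_univ_succ]
    simp only [Fin.cons_zero, Fin.cons_succ]
    rw [← hx, add_comm, Measure.sub_add_cancel_of_le hle]

variable {d : ℕ}

/-- The interaction of a configuration with finitely many points in the window. -/
lemma rieszInteraction_eq_sum {s : ℝ} {A : Set (EuclideanSpace ℝ (Fin d))} (hA : MeasurableSet A)
    {C : Measure (EuclideanSpace ℝ (Fin d))} {ι : Type*} [Fintype ι] [DecidableEq ι]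
    {x : ι → EuclideanSpace ℝ (Fin d)} (hC : C.restrict A = ∑ i, Measure.dirac (x i)) :
    rieszInteraction s A C = ∑ i, ∑ j ∈ Finset.univ.erase i, ‖x i - x j‖ₑ ^ (-s) := by
  have hxA : ∀ i, x i ∈ A := by
    intro i
    by_contra hi
    have h0 : C.restrict A Aᶜ = 0 := by
      rw [Measure.restrict_apply hA.compl, compl_inter_self, measure_empty]
    rw [hC, Measure.coe_finsetSum, Finset.sum_apply, Finset.sum_eq_zero_iff] at h0
    have := h0 i (Finset.mem_univ _)
    rw [Measure.dirac_apply' _ hA.compl] at this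
    simp [hi] at this
  rw [rieszInteraction, hC, lintegral_finsetSum_measure]
  refine Finset.sum_congr rfl fun i _ => ?_
  rw [lintegral_dirac, Measure.restrict_sub_eq_restrict_sub_restrict hA, hC,
    Measure.restrict_eq_self_of_ae_mem ((ae_dirac_iff hA).2 (hxA i)),
    ← Finset.sum_erase_add _ _ (Finset.mem_univ i), Measure.add_sub_cancel,
    lintegral_finsetSum_measure]
  simp only [lintegral_dirac]

lemma IsPointConfig.exists_restrict_eq_sum_dirac {C : Measure (EuclideanSpace ℝ (Fin d))}
    (hC : IsPointConfig C) {A : Set (EuclideanSpace ℝ (Fin d))} (hA : MeasurableSet A)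
    (hAb : Bornology.IsBounded A) :
    ∃ (n : ℕ) (x : Fin n → EuclideanSpace ℝ (Fin d)), C A = n ∧
      C.restrict A = ∑ i, Measure.dirac (x i) ∧ ∀ i, x i ∈ A := by
  obtain ⟨n, hn⟩ := hC A hA hAb
  obtain ⟨x, hx⟩ := exists_eq_sum_dirac (μ := C.restrict A) (n := n) (fun B hB => by
    rw [Measure.restrict_apply hB]
    exact hC _ (hB.inter hA) (hAb.subset inter_subset_right)) (by simpa using hn)
  refine ⟨n, x, hn, hx, fun i => ?_⟩
  by_contra hi
  have h0 : C.restrict A Aᶜ = 0 := by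
    rw [Measure.restrict_apply hA.compl, compl_inter_self, measure_empty]
  rw [hx, Measure.coe_finsetSum, Finset.sum_apply, Finset.sum_eq_zero_iff] at h0
  have := h0 i (Finset.mem_univ _)
  rw [Measure.dirac_apply' _ hA.compl] at this
  simp [hi] at this

lemma rieszInteraction_add_le (s : ℝ) {A B : Set (EuclideanSpace ℝ (Fin d))}
    (hB : MeasurableSet B) (hAB : Disjoint A B) (C : Measure (EuclideanSpace ℝ (Fin d))) :
    rieszInteraction s A C + rieszInteraction s B C ≤ rieszInteraction s (A ∪ B) C := by
  simp only [rieszInteraction]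
  rw [lintegral_union hB hAB]
  gcongr
  · exact subset_union_left
  · exact subset_union_right

lemma rieszInteraction_map_sub (s : ℝ) {A : Set (EuclideanSpace ℝ (Fin d))}
    (hA : MeasurableSet A) (hAb : Bornology.IsBounded A)
    {C : Measure (EuclideanSpace ℝ (Fin d))} (hC : IsPointConfig C)
    (x : EuclideanSpace ℝ (Fin d)) :
    rieszInteraction s ((fun p => p + x) ⁻¹' A) (C.map fun p => p - x) =
      rieszInteraction s A C := by
  obtain ⟨n, y, -, hy, -⟩ := hC.exists_restrict_eq_sum_dirac hA hAb
  have he : MeasurableEmbedding fun p : EuclideanSpace ℝ (Fin d) => p - x :=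
    (MeasurableEquiv.subRight x).measurableEmbedding
  have hm : Measurable fun p : EuclideanSpace ℝ (Fin d) => p - x := by fun_prop
  have hA' : MeasurableSet ((fun p => p + x) ⁻¹' A) := (measurable_id.add_const x) hA
  have hpre : (fun p => p - x) ⁻¹' ((fun p => p + x) ⁻¹' A) = A := by ext p; simp
  have h1 : (C.map fun p => p - x).restrict ((fun p => p + x) ⁻¹' A) =
      ∑ i, Measure.dirac (y i - x) := by
    rw [he.restrict_map, hpre, hy, ← Measure.mapₗ_apply_of_measurable hm, map_sum]
    simp [Measure.mapₗ_apply_of_measurable hm, Measure.map_dirac' hm]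
  rw [rieszInteraction_eq_sum hA hy, rieszInteraction_eq_sum hA' h1]
  simp

/-- The family of point configurations is measurable: integrality on bounded sets can be tested on
a countable algebra of sets. -/
lemma measurableSet_isPointConfig :
    MeasurableSet {C : Measure (EuclideanSpace ℝ (Fin d)) | IsPointConfig C} := by
  obtain ⟨b, hbc, -, hb⟩ := TopologicalSpace.exists_countable_basis (EuclideanSpace ℝ (Fin d))
  set 𝒜 := generateSetAlgebra b with h𝒜
  have h𝒜alg : IsSetAlgebra 𝒜 := isSetAlgebra_generateSetAlgebra
  have h𝒜c : 𝒜.Countable := countable_generateSetAlgebra hbc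
  have hgen : (inferInstance : MeasurableSpace (EuclideanSpace ℝ (Fin d))) =
      MeasurableSpace.generateFrom 𝒜 := by
    rw [h𝒜, generateFrom_generateSetAlgebra_eq]
    exact hb.borel_eq_generateFrom ▸ BorelSpace.measurable_eq
  have h𝒜m : ∀ B ∈ 𝒜, MeasurableSet B := fun B hB => by
    have h := MeasurableSpace.measurableSet_generateFrom hB
    rwa [← hgen] at h
  have key : {C : Measure (EuclideanSpace ℝ (Fin d)) | IsPointConfig C} =
      ⋂ n : ℕ, ⋂ B ∈ 𝒜, {C | C (B ∩ Metric.closedBall 0 n) ∈ range ((↑) : ℕ → ℝ≥0∞)} := by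
    ext C
    simp only [mem_ofPred_eq, mem_iInter, mem_range]
    constructor
    · intro hC n B hB
      obtain ⟨k, hk⟩ := hC (B ∩ Metric.closedBall 0 n)
        ((h𝒜m B hB).inter Metric.isClosed_closedBall.measurableSet)
        (Metric.isBounded_closedBall.subset inter_subset_right)
      exact ⟨k, hk.symm⟩
    · intro h B hB hBb
      obtain ⟨r, hr⟩ := hBb.subset_closedBall 0
      obtain ⟨n, hn⟩ := exists_nat_ge r
      set K : Set (EuclideanSpace ℝ (Fin d)) := Metric.closedBall 0 n with hK
      have hKm : MeasurableSet K := Metric.isClosed_closedBall.measurableSet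
      have hBK : B ⊆ K := hr.trans (Metric.closedBall_subset_closedBall hn)
      obtain ⟨N, hN⟩ := h n univ h𝒜alg.univ_mem
      rw [univ_inter] at hN
      have hKfin : C K ≠ ∞ := by rw [← hK] at hN; rw [← hN]; exact ENNReal.natCast_ne_top _
      suffices hall : ∀ t, MeasurableSet t → ∃ k : ℕ, (k : ℝ≥0∞) = C (t ∩ K) by
        obtain ⟨k, hk⟩ := hall B hB
        exact ⟨k, by rw [hk, inter_eq_self_of_subset_left hBK]⟩
      intro t ht
      induction t, ht using MeasurableSpace.induction_on_inter hgen
        (fun s hs t ht _ => h𝒜alg.inter_mem hs ht) with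
      | empty => exact ⟨0, by simp⟩
      | basic t ht => exact h n t ht
      | compl t ht ih =>
        obtain ⟨k, hk⟩ := ih
        refine ⟨N - k, ?_⟩
        have h1 : tᶜ ∩ K = K \ (t ∩ K) := by ext p; simp; tauto
        rw [h1, measure_sdiff inter_subset_right (ht.inter hKm).nullMeasurableSet
          (measure_ne_top_of_subset inter_subset_right hKfin), ← hk, ← hN]
        simp
      | iUnion f hd hf ih =>
        choose k hk using ih
        have h1 : C ((⋃ i, f i) ∩ K) = ∑' i, C (f i ∩ K) := by
          rw [iUnion_inter, measure_iUnion (fun i j hij => (hd hij).mono inter_subset_left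
            inter_subset_left) (fun i => (hf i).inter hKm)]
        have hfin : ∑' i, ((k i : ℕ) : ℝ≥0∞) ≠ ∞ := by
          simp_rw [hk]; rw [← h1]; exact measure_ne_top_of_subset inter_subset_right hKfin
        have hsupp : (Function.support k).Finite := by
          have hf1 := ENNReal.finite_const_le_of_tsum_ne_top hfin one_ne_zero
          refine hf1.subset fun i hi => ?_
          simp only [mem_ofPred_eq]
          exact_mod_cast Nat.one_le_iff_ne_zero.2 hi
        refine ⟨∑ i ∈ hsupp.toFinset, k i, ?_⟩
        rw [h1]
        simp_rw [← hk]
        rw [tsum_eq_sum (s := hsupp.toFinset)]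
        · push_cast; rfl
        · intro i hi
          simp only [Finite.mem_toFinset, Function.mem_support, not_not] at hi
          simp [hi]
  rw [key]
  refine MeasurableSet.iInter fun n => MeasurableSet.biInter h𝒜c fun B hB => ?_
  exact Measure.measurable_coe ((h𝒜m B hB).inter Metric.isClosed_closedBall.measurableSet)
    (countable_range _).measurableSet

end Configurations

/-! ### Cubes and mean measures -/

section Cubes

variable {d : ℕ}

lemma cube_eq_preimage (d : ℕ) (R : ℝ) : cube d R =
    (WithLp.ofLp : EuclideanSpace ℝ (Fin d) → Fin d → ℝ) ⁻¹'
      (univ.pi fun _ => Icc (-(R / 2)) (R / 2)) := by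
  ext x; simp [cube, abs_le, -pi_univ_Icc]

lemma isClosed_cube (d : ℕ) (R : ℝ) : IsClosed (cube d R) := by
  rw [cube_eq_preimage]
  exact (isClosed_set_pi fun _ _ => isClosed_Icc).preimage (PiLp.continuous_ofLp 2 _)

lemma measurableSet_cube (d : ℕ) (R : ℝ) : MeasurableSet (cube d R) :=
  (isClosed_cube d R).measurableSet

lemma volume_cube (d : ℕ) {R : ℝ} (hR : 0 ≤ R) : volume (cube d R) = ENNReal.ofReal (R ^ d) := by
  rw [cube_eq_preimage, (PiLp.volume_preserving_ofLp (Fin d)).measure_preimage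
    (MeasurableSet.univ_pi fun _ => measurableSet_Icc).nullMeasurableSet, volume_pi_pi]
  simp [ENNReal.ofReal_pow hR]

lemma volume_cube_ne_top (d : ℕ) (R : ℝ) : volume (cube d R) ≠ ∞ := by
  rw [cube_eq_preimage, (PiLp.volume_preserving_ofLp (Fin d)).measure_preimage
    (MeasurableSet.univ_pi fun _ => measurableSet_Icc).nullMeasurableSet, volume_pi_pi]
  simp [Real.volume_Icc]

lemma isBounded_cube (d : ℕ) (R : ℝ) : Bornology.IsBounded (cube d R) := by
  have : Bornology.IsBounded ((WithLp.ofLp : EuclideanSpace ℝ (Fin d) → Fin d → ℝ) ⁻¹'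
      (univ.pi fun _ => Icc (-(R / 2)) (R / 2))) :=
    (PiLp.antilipschitzWith_ofLp 2 _).isBounded_preimage
      (Bornology.IsBounded.pi fun _ => Metric.isBounded_Icc _ _)
  rwa [cube_eq_preimage]

lemma interior_cube_nonempty (d : ℕ) {R : ℝ} (hR : 0 < R) : (interior (cube d R)).Nonempty := by
  refine ⟨0, mem_interior.2 ⟨Metric.ball 0 (R / 2), fun x hx i => ?_, Metric.isOpen_ball, by
    simpa using hR⟩⟩
  rw [mem_ball_zero_iff] at hx
  exact (PiLp.norm_apply_le x i).trans hx.le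

/-- The mean measure of a translation invariant law is a multiple of Lebesgue measure. -/
lemma exists_lintegral_apply_eq_mul_volume
    {P : Measure (Measure (EuclideanSpace ℝ (Fin d)))}
    (hstat : ∀ x : EuclideanSpace ℝ (Fin d), P.map (fun C => C.map fun p => p - x) = P)
    {A₀ : Set (EuclideanSpace ℝ (Fin d))} (hA₀ : MeasurableSet A₀)
    (hA₀i : (interior A₀).Nonempty) (hfin : ∫⁻ C, C A₀ ∂P ≠ ∞) :
    ∃ r : ℝ≥0, ∀ A, MeasurableSet A → ∫⁻ C, C A ∂P = r * volume A := by
  have hinv : (Measure.join P).IsAddLeftInvariant := ⟨fun x => by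
    have h1 := hstat (-x)
    simp only [sub_neg_eq_add] at h1
    have h2 : (fun p : EuclideanSpace ℝ (Fin d) => x + p) = fun p => p + x := by
      ext1 p; exact add_comm _ _
    rw [h2]
    conv_rhs => rw [← h1]
    rw [Measure.join_map_map (by fun_prop)]⟩
  have hfc : IsFiniteMeasureOnCompacts (Measure.join P) := ⟨fun K hK =>
    measure_lt_top_of_isCompact_of_isAddLeftInvariant' hA₀i
      (by rwa [Measure.join_apply hA₀]) hK⟩
  have heq := Measure.isAddLeftInvariant_eq_smul (Measure.join P)
    (volume : Measure (EuclideanSpace ℝ (Fin d)))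
  refine ⟨Measure.addHaarScalarFactor (Measure.join P)
    (volume : Measure (EuclideanSpace ℝ (Fin d))), fun A hA => ?_⟩
  rw [← Measure.join_apply hA]
  conv_lhs => rw [heq]
  rw [Measure.coe_nnreal_smul_apply]

/-- For a stationary law of intensity `m`, the mean number of points in a set is `m` times its
volume. -/
lemma lintegral_apply_eq_of_mem_stationaryLaws {m : ℝ≥0}
    {P : Measure (Measure (EuclideanSpace ℝ (Fin d)))} (hP : P ∈ stationaryLaws d m)
    {A : Set (EuclideanSpace ℝ (Fin d))} (hA : MeasurableSet A) :
    ∫⁻ C, C A ∂P = m * volume A := by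
  obtain ⟨-, -, hstat, hint⟩ := hP
  obtain ⟨r, hr⟩ := exists_lintegral_apply_eq_mul_volume hstat (measurableSet_cube d 1)
    (interior_cube_nonempty d one_pos) (by rw [hint]; exact ENNReal.coe_ne_top)
  have h1 := hr _ (measurableSet_cube d 1)
  rw [hint, volume_cube d zero_le_one, one_pow, ENNReal.ofReal_one, mul_one] at h1
  rw [hr A hA, h1]

end Cubes

/-! ### Thermodynamic limits of superadditive set functions -/

section Superadditive

variable {d : ℕ}

lemma sum_le_of_superadditive {v : Set (EuclideanSpace ℝ (Fin d)) → ℝ≥0∞}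
    (hadd : ∀ A B, MeasurableSet A → MeasurableSet B → Bornology.IsBounded A →
      Bornology.IsBounded B → Disjoint A B → v A + v B ≤ v (A ∪ B))
    {ι : Type*} (T : Finset ι) {A : ι → Set (EuclideanSpace ℝ (Fin d))}
    (hA : ∀ i, MeasurableSet (A i)) (hAb : ∀ i, Bornology.IsBounded (A i))
    (hd : Pairwise (Function.onFun Disjoint A))
    {B : Set (EuclideanSpace ℝ (Fin d))} (hB : MeasurableSet B) (hBb : Bornology.IsBounded B)
    (hAB : ∀ i, A i ⊆ B) : ∑ i ∈ T, v (A i) ≤ v B := by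
  classical
  have h1 : ∀ T : Finset ι, ∑ i ∈ T, v (A i) ≤ v (⋃ i ∈ T, A i) := by
    intro T
    induction T using Finset.induction_on with
    | empty => simp
    | insert i T hi ih =>
      rw [Finset.sum_insert hi, Finset.set_biUnion_insert]
      refine (add_le_add_right ih _).trans (hadd _ _ (hA i) (T.measurableSet_biUnion fun j _ => hA j)
        (hAb i) ((Bornology.isBounded_biUnion_finset T).2 fun j _ => hAb j) ?_)
      refine disjoint_iUnion₂_right.2 fun j hj => hd fun hij => hi (hij ▸ hj)
  refine (h1 T).trans ?_
  have hU : MeasurableSet (⋃ i ∈ T, A i) := T.measurableSet_biUnion fun j _ => hA j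
  have hUB : (⋃ i ∈ T, A i) ⊆ B := iUnion₂_subset fun i _ => hAB i
  have := hadd _ _ hU (hB.diff hU) (hBb.subset hUB) (hBb.subset sdiff_subset) disjoint_sdiff_right
  rw [union_sdiff_cancel hUB] at this
  exact le_self_add.trans this

/-- A cube of side `n ρ` contains `n ^ d` disjoint translates of a cube of side `R < ρ`. -/
lemma pow_mul_le_of_superadditive {v : Set (EuclideanSpace ℝ (Fin d)) → ℝ≥0∞}
    (hadd : ∀ A B, MeasurableSet A → MeasurableSet B → Bornology.IsBounded A →
      Bornology.IsBounded B → Disjoint A B → v A + v B ≤ v (A ∪ B))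
    (htr : ∀ R x, v (cube d R) ≤ v ((fun p => p + x) ⁻¹' cube d R))
    {R ρ R' : ℝ} (hR : 0 < R) (hρ : R < ρ) (n : ℕ) (hR' : n * ρ ≤ R') :
    (n : ℝ≥0∞) ^ d * v (cube d R) ≤ v (cube d R') := by
  set c : (Fin d → Fin n) → EuclideanSpace ℝ (Fin d) :=
    fun k => WithLp.toLp 2 fun i => -(ρ * ((k i : ℕ) - ((n : ℝ) - 1) / 2)) with hc
  set A : (Fin d → Fin n) → Set (EuclideanSpace ℝ (Fin d)) :=
    fun k => (fun p => p + c k) ⁻¹' cube d R with hA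
  have hAm : ∀ k, MeasurableSet (A k) := fun k =>
    (measurable_id.add_const (c k)) (measurableSet_cube d R)
  have hAB : ∀ k, A k ⊆ cube d R' := by
    intro k p hp i
    have h1 := abs_le.1 (hp i)
    simp only [hc, PiLp.add_apply] at h1
    have h2 : ((k i : ℕ) : ℝ) + 1 ≤ n := by exact_mod_cast (k i).2
    have h3 : (0 : ℝ) ≤ ((k i : ℕ) : ℝ) := Nat.cast_nonneg _
    rw [abs_le]
    constructor <;> nlinarith
  have hd : Pairwise (Function.onFun Disjoint A) := by
    intro k l hkl
    obtain ⟨i, hi⟩ := Function.ne_iff.1 hkl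
    refine Set.disjoint_left.2 fun p hpk hpl => ?_
    have h1 := abs_le.1 (hpk i)
    have h2 := abs_le.1 (hpl i)
    simp only [hc, PiLp.add_apply] at h1 h2
    rcases lt_or_gt_of_ne (fun h => hi (Fin.ext h) : (k i : ℕ) ≠ l i) with h | h
    · have h3 : ((k i : ℕ) : ℝ) + 1 ≤ (l i : ℕ) := by exact_mod_cast h
      nlinarith
    · have h3 : ((l i : ℕ) : ℝ) + 1 ≤ (k i : ℕ) := by exact_mod_cast h
      nlinarith
  have := sum_le_of_superadditive hadd Finset.univ hAm
    (fun k => (isBounded_cube d R').subset (hAB k)) hd (measurableSet_cube d R')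
    (isBounded_cube d R') hAB
  refine le_trans ?_ this
  calc (n : ℝ≥0∞) ^ d * v (cube d R) = ∑ _k : Fin d → Fin n, v (cube d R) := by simp
    _ ≤ ∑ k, v (A k) := Finset.sum_le_sum fun k _ => htr R (c k)

/-- For a translation invariant superadditive set function, the lower limit of the mean value per
unit volume is bounded below by each of its terms, so that it is their supremum. -/
lemma div_le_liminf_of_superadditive {v : Set (EuclideanSpace ℝ (Fin d)) → ℝ≥0∞}
    (hadd : ∀ A B, MeasurableSet A → MeasurableSet B → Bornology.IsBounded A →
      Bornology.IsBounded B → Disjoint A B → v A + v B ≤ v (A ∪ B))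
    (htr : ∀ R x, v (cube d R) ≤ v ((fun p => p + x) ⁻¹' cube d R)) {R : ℝ} (hR : 0 < R) :
    v (cube d R) / ENNReal.ofReal (R ^ d) ≤
      liminf (fun R : ℝ => v (cube d R) / ENNReal.ofReal (R ^ d)) atTop := by
  have hlim : Tendsto (fun ρ : ℝ => ENNReal.ofReal (ρ⁻¹ ^ d) * v (cube d R)) (𝓝[>] R)
      (𝓝 (ENNReal.ofReal (R⁻¹ ^ d) * v (cube d R))) := by
    refine ENNReal.Tendsto.mul_const ?_ (Or.inl (by simp; positivity))
    refine (ENNReal.continuous_ofReal.tendsto _).comp ?_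
    exact (((continuousAt_inv₀ hR.ne').pow d).tendsto).mono_left nhdsWithin_le_nhds
  have hdiv : v (cube d R) / ENNReal.ofReal (R ^ d) = ENNReal.ofReal (R⁻¹ ^ d) * v (cube d R) := by
    rw [ENNReal.div_eq_inv_mul, inv_pow, ENNReal.ofReal_inv_of_pos (by positivity)]
  rw [hdiv]
  refine le_of_tendsto hlim ?_
  filter_upwards [self_mem_nhdsWithin] with ρ hρ
  have hρ' : R < ρ := hρ
  have hρ0 : 0 < ρ := hR.trans hρ'
  have hlim2 : Tendsto (fun R' : ℝ => ENNReal.ofReal ((ρ⁻¹ - R'⁻¹) ^ d) * v (cube d R)) atTop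
      (𝓝 (ENNReal.ofReal (ρ⁻¹ ^ d) * v (cube d R))) := by
    refine ENNReal.Tendsto.mul_const ?_ (Or.inl (by simp; positivity))
    refine (ENNReal.continuous_ofReal.tendsto _).comp ?_
    have := (tendsto_inv_atTop_zero (𝕜 := ℝ)).const_sub ρ⁻¹
    rw [sub_zero] at this
    exact this.pow d
  rw [← hlim2.liminf_eq]
  refine liminf_le_liminf ?_
  filter_upwards [eventually_ge_atTop ρ] with R' hR'
  have hR'0 : 0 < R' := hρ0.trans_le hR'
  have hn := pow_mul_le_of_superadditive hadd htr hR hρ' ⌊R' / ρ⌋₊ (R' := R') (by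
    have := Nat.floor_le (show 0 ≤ R' / ρ by positivity)
    rwa [le_div_iff₀ hρ0] at this)
  have hfl : R' / ρ - 1 ≤ (⌊R' / ρ⌋₊ : ℝ) := (Nat.sub_one_lt_floor _).le
  have hinv : R'⁻¹ ≤ ρ⁻¹ := inv_anti₀ hρ0 hR'
  rw [ENNReal.le_div_iff_mul_le (Or.inl (by simp; positivity)) (Or.inl ENNReal.ofReal_ne_top)]
  refine le_trans ?_ hn
  rw [mul_right_comm, ← ENNReal.ofReal_mul (pow_nonneg (sub_nonneg.2 hinv) _), ← mul_pow]
  gcongr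
  rw [← ENNReal.ofReal_natCast, ← ENNReal.ofReal_pow (Nat.cast_nonneg _)]
  refine ENNReal.ofReal_le_ofReal (pow_le_pow_left₀
    (mul_nonneg (sub_nonneg.2 hinv) hR'0.le) ?_ _)
  refine le_trans (le_of_eq ?_) hfl
  field_simp

end Superadditive

/-! ### Energy and entropy of stationary laws -/

section Stationary

variable {d : ℕ}

/-- Translation of measures, as a measurable equivalence. -/
noncomputable def translateMeasureEquiv (x : EuclideanSpace ℝ (Fin d)) :
    Measure (EuclideanSpace ℝ (Fin d)) ≃ᵐ Measure (EuclideanSpace ℝ (Fin d)) where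
  toFun C := C.map fun p => p - x
  invFun C := C.map fun p => p + x
  left_inv C := by
    dsimp only
    rw [Measure.map_map (by fun_prop) (by fun_prop)]
    simp [Function.comp_def]
  right_inv C := by
    dsimp only
    rw [Measure.map_map (by fun_prop) (by fun_prop)]
    simp [Function.comp_def]
  measurable_toFun := Measure.measurable_map _ (by fun_prop)
  measurable_invFun := Measure.measurable_map _ (by fun_prop)

/-- By superadditivity, the lower limit in the definition of the Riesz energy is an upper bound of
the mean energies in all cubes; hence it is a limit, and it is convex in the law. -/
lemma lintegral_rieszInteraction_div_le_rieszEnergy (s : ℝ) {m : ℝ≥0∞}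
    {P : Measure (Measure (EuclideanSpace ℝ (Fin d)))} (hP : P ∈ stationaryLaws d m) {R : ℝ}
    (hR : 0 < R) :
    (∫⁻ C, rieszInteraction s (cube d R) C ∂P) / ENNReal.ofReal (R ^ d) ≤ rieszEnergy s P := by
  refine div_le_liminf_of_superadditive
    (v := fun A => ∫⁻ C, rieszInteraction s A C ∂P) ?_ ?_ hR
  · intro A B _ hB _ _ hAB
    exact (le_lintegral_add _ _).trans
      (lintegral_mono fun C => rieszInteraction_add_le s hB hAB C)
  · intro R x
    obtain ⟨-, hconf, hstat, -⟩ := hP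
    refine le_of_eq ?_
    calc ∫⁻ C, rieszInteraction s (cube d R) C ∂P
        = ∫⁻ C, rieszInteraction s ((fun p => p + x) ⁻¹' cube d R)
            (translateMeasureEquiv x C) ∂P := by
          refine lintegral_congr_ae ?_
          filter_upwards [hconf] with C hC
          exact (rieszInteraction_map_sub s (measurableSet_cube d R) (isBounded_cube d R) hC x).symm
      _ = ∫⁻ C, rieszInteraction s ((fun p => p + x) ⁻¹' cube d R) C
            ∂(P.map (translateMeasureEquiv x)) := (lintegral_map_equiv _ _).symm
      _ = ∫⁻ C, rieszInteraction s ((fun p => p + x) ⁻¹' cube d R) C ∂P := by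
          congr 1; exact hstat x

/-- The counterpart of `lintegral_rieszInteraction_div_le_rieszEnergy` for the entropy. -/
lemma windowEntropy_div_le_specificEntropy {m : ℝ≥0∞}
    {P : Measure (Measure (EuclideanSpace ℝ (Fin d)))} (hP : P ∈ stationaryLaws d m) {R : ℝ}
    (hR : 0 < R) :
    windowEntropy P (cube d R) / ENNReal.ofReal (R ^ d) ≤ specificEntropy P := by
  have := hP.1
  refine div_le_liminf_of_superadditive (v := windowEntropy P) ?_ ?_ hR
  · intro A B hA hB hAb hBb hAB
    exact windowEntropy_add_le P hA hB hAB hAb.measure_lt_top.ne hBb.measure_lt_top.ne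
  · intro R x
    have hm : MeasurableSet ((fun p => p + x) ⁻¹' cube d R) :=
      (measurable_id.add_const x) (measurableSet_cube d R)
    have hv : volume ((fun p => p + x) ⁻¹' cube d R) ≠ ∞ := by
      rw [measure_preimage_add_right]; exact volume_cube_ne_top d R
    have h := windowEntropy_map_sub_le P hm hv (-x)
    rw [hP.2.2.1 (-x), ← preimage_comp] at h
    simpa [Function.comp_def] using h

/-- The free energy of a stationary law. -/
noncomputable def freeEnergy {d : ℕ} (s β : ℝ)
    (P : Measure (Measure (EuclideanSpace ℝ (Fin d)))) : ℝ≥0∞ :=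
  ENNReal.ofReal β * rieszEnergy s P + specificEntropy P

lemma convexComb_mem_stationaryLaws {m₁ m₂ : ℝ≥0}
    {P₁ P₂ : Measure (Measure (EuclideanSpace ℝ (Fin d)))} (h₁ : P₁ ∈ stationaryLaws d m₁)
    (h₂ : P₂ ∈ stationaryLaws d m₂) {a b : ℝ≥0} (hab : a + b = 1) :
    a • P₁ + b • P₂ ∈ stationaryLaws d (a * m₁ + b * m₂ : ℝ≥0) := by
  obtain ⟨hp1, hc1, hs1, hi1⟩ := h₁
  obtain ⟨hp2, hc2, hs2, hi2⟩ := h₂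
  refine ⟨⟨?_⟩, ?_, fun x => ?_, ?_⟩
  · simp only [Measure.coe_add, Measure.coe_nnreal_smul_apply, Pi.add_apply, measure_univ, mul_one]
    exact_mod_cast hab
  · rw [ae_add_measure_iff]
    exact ⟨Measure.ae_smul_measure hc1 a, Measure.ae_smul_measure hc2 b⟩
  · have hm : Measurable fun C : Measure (EuclideanSpace ℝ (Fin d)) => C.map fun p => p - x :=
      Measure.measurable_map _ (by fun_prop)
    rw [Measure.map_add _ _ hm, Measure.map_smul, Measure.map_smul, hs1, hs2]
  · rw [lintegral_add_measure, lintegral_smul_measure, lintegral_smul_measure, hi1, hi2]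
    simp [ENNReal.smul_def]

lemma rieszEnergy_convexComb_le (s : ℝ) {m₁ m₂ : ℝ≥0∞}
    {P₁ P₂ : Measure (Measure (EuclideanSpace ℝ (Fin d)))} (h₁ : P₁ ∈ stationaryLaws d m₁)
    (h₂ : P₂ ∈ stationaryLaws d m₂) (a b : ℝ≥0) :
    rieszEnergy s (a • P₁ + b • P₂) ≤ a * rieszEnergy s P₁ + b * rieszEnergy s P₂ := by
  conv_lhs => rw [rieszEnergy]
  rw [← liminf_const (f := (atTop : Filter ℝ)) (a * rieszEnergy s P₁ + b * rieszEnergy s P₂)]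
  refine liminf_le_liminf ?_
  filter_upwards [eventually_gt_atTop 0] with R hR
  rw [lintegral_add_measure, lintegral_smul_measure, lintegral_smul_measure, ENNReal.add_div]
  simp only [ENNReal.smul_def, smul_eq_mul, mul_div_assoc]
  gcongr
  · exact lintegral_rieszInteraction_div_le_rieszEnergy s h₁ hR
  · exact lintegral_rieszInteraction_div_le_rieszEnergy s h₂ hR

lemma specificEntropy_convexComb_le {m₁ m₂ : ℝ≥0∞}
    {P₁ P₂ : Measure (Measure (EuclideanSpace ℝ (Fin d)))} (h₁ : P₁ ∈ stationaryLaws d m₁)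
    (h₂ : P₂ ∈ stationaryLaws d m₂) {a b : ℝ≥0} (hab : a + b = 1) :
    specificEntropy (a • P₁ + b • P₂) ≤ a * specificEntropy P₁ + b * specificEntropy P₂ := by
  have := h₁.1
  have := h₂.1
  conv_lhs => rw [specificEntropy]
  rw [← liminf_const (f := (atTop : Filter ℝ)) (a * specificEntropy P₁ + b * specificEntropy P₂)]
  refine liminf_le_liminf ?_
  filter_upwards [eventually_gt_atTop 0] with R hR
  have hm := measurable_measure_restrict (measurableSet_cube d R)
  have := isProbabilityMeasure_poissonLaw (volume_cube_ne_top d R)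
  have := Measure.isProbabilityMeasure_map (μ := P₁) hm.aemeasurable
  have := Measure.isProbabilityMeasure_map (μ := P₂) hm.aemeasurable
  rw [Measure.map_add _ _ hm, Measure.map_smul, Measure.map_smul]
  refine (ENNReal.div_le_div_right (klDiv_convexComb_le hab) _).trans ?_
  rw [ENNReal.add_div, mul_div_assoc, mul_div_assoc]
  gcongr
  · exact windowEntropy_div_le_specificEntropy h₁ hR
  · exact windowEntropy_div_le_specificEntropy h₂ hR

/-- A stationary law of intensity `m` has at least the specific entropy allowed by the test
function `t · (number of points)`; optimizing over `t` gives `m log m - m + 1`. -/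
lemma le_specificEntropy {m : ℝ≥0} {P : Measure (Measure (EuclideanSpace ℝ (Fin d)))}
    (hP : P ∈ stationaryLaws d m) (t : ℝ) :
    ENNReal.ofReal (t * m - Real.exp t + 1) ≤ specificEntropy P := by
  have := hP.1
  have h1 := windowEntropy_div_le_specificEntropy hP one_pos
  rw [one_pow, ENNReal.ofReal_one, div_one] at h1
  refine le_trans ?_ h1
  have hmean := lintegral_apply_eq_of_mem_stationaryLaws hP (measurableSet_cube d 1)
  have hv : volume (cube d 1) = 1 := by rw [volume_cube d zero_le_one]; simp
  rw [hv, mul_one] at hmean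
  have h2 := le_windowEntropy P (measurableSet_cube d 1) (volume_cube_ne_top d 1)
    (by rw [hmean]; exact ENNReal.coe_ne_top) t
  rw [hmean, hv] at h2
  refine le_trans (le_of_eq ?_) h2
  congr 1
  simp; ring

end Stationary

/-! ### Minimal energies in a cube -/

section MinimalEnergy

variable {d : ℕ}

/-- The minimal Riesz energy of `n` points in the unit cube. -/
noncomputable def minTupleEnergy (d : ℕ) (s : ℝ) (n : ℕ) : ℝ≥0∞ :=
  ⨅ x : Fin n → EuclideanSpace ℝ (Fin d), ⨅ _ : ∀ i, x i ∈ cube d 1, tupleEnergy s x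

lemma rieszConstant_eq (d : ℕ) (s : ℝ) : rieszConstant d s =
    liminf (fun N : ℕ => minTupleEnergy d s N / (N : ℝ≥0∞) ^ (1 + s / d)) atTop := rfl

lemma ENNReal.mul_rpow_of_pos_finite {c : ℝ≥0∞} (hc0 : c ≠ 0) (hc : c ≠ ∞) (x : ℝ≥0∞) (z : ℝ) :
    (c * x) ^ z = c ^ z * x ^ z := by
  rcases eq_or_ne x 0 with rfl | hx
  · rcases lt_trichotomy z 0 with hz | rfl | hz
    · simp [ENNReal.zero_rpow_of_neg hz, ENNReal.mul_top, hc0, hc]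
    · simp
    · simp [ENNReal.zero_rpow_of_pos hz]
  · exact ENNReal.mul_rpow_of_ne_zero hc0 hx z

lemma tupleEnergy_smul {s : ℝ} {n : ℕ} (x : Fin n → EuclideanSpace ℝ (Fin d)) {r : ℝ}
    (hr : 0 < r) : tupleEnergy s (fun i => r • x i) =
      ENNReal.ofReal r ^ (-s) * tupleEnergy s x := by
  simp only [tupleEnergy, Finset.mul_sum]
  refine Finset.sum_congr rfl fun i _ => Finset.sum_congr rfl fun j _ => ?_
  rw [← smul_sub, enorm_smul, Real.enorm_eq_ofReal hr.le,
    ENNReal.mul_rpow_of_pos_finite (by simpa using hr) ENNReal.ofReal_ne_top]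

lemma minTupleEnergy_le_rieszInteraction {s : ℝ} {R : ℝ} (hR : 0 < R)
    {C : Measure (EuclideanSpace ℝ (Fin d))} (hC : IsPointConfig C) :
    ∃ n : ℕ, C (cube d R) = n ∧
      minTupleEnergy d s n ≤ ENNReal.ofReal R ^ s * rieszInteraction s (cube d R) C := by
  obtain ⟨n, x, hn, hx, hxA⟩ :=
    hC.exists_restrict_eq_sum_dirac (measurableSet_cube d R) (isBounded_cube d R)
  refine ⟨n, hn, ?_⟩
  rw [rieszInteraction_eq_sum (measurableSet_cube d R) hx]
  have h1 : minTupleEnergy d s n ≤ tupleEnergy s fun i => R⁻¹ • x i := by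
    refine iInf₂_le (fun i => R⁻¹ • x i) fun i a => ?_
    have := hxA i a
    rw [PiLp.smul_apply, smul_eq_mul, abs_mul, abs_of_pos (by positivity : (0 : ℝ) < R⁻¹)]
    calc R⁻¹ * |x i a| ≤ R⁻¹ * (R / 2) := by gcongr
      _ = 1 / 2 := by field_simp
  refine h1.trans (le_of_eq ?_)
  rw [tupleEnergy_smul x (by positivity), ENNReal.ofReal_inv_of_pos hR, ENNReal.inv_rpow,
    ENNReal.rpow_neg, inv_inv, tupleEnergy]

/-- The Riesz energy of a stationary law is bounded below by the energy of optimal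
configurations with the same density. -/
lemma rieszConstant_mul_le_rieszEnergy {s : ℝ} (hd : 1 ≤ d) (hs : (d : ℝ) < s) {m : ℝ≥0}
    {P : Measure (Measure (EuclideanSpace ℝ (Fin d)))} (hP : P ∈ stationaryLaws d m) :
    rieszConstant d s * (m : ℝ≥0∞) ^ (1 + s / d) ≤ rieszEnergy s P := by
  have hP1 := hP.1
  have hd0 : (0 : ℝ) < d := by exact_mod_cast hd
  have hs0 : 0 < s := hd0.trans hs
  set p : ℝ := 1 + s / d with hp
  have hp1 : 1 < p := by rw [hp]; linarith [div_pos hs0 hd0]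
  refine ENNReal.mul_le_of_forall_lt fun c hc b hb => ?_
  refine (mul_le_mul_right hb.le c).trans ?_
  have hctop : c ≠ ∞ := hc.ne_top
  rw [rieszConstant_eq] at hc
  -- `c n ^ p` bounds the energy of `n` points only for `n ≥ n₀`; the error made for fewer points
  -- is bounded and disappears as `R → ∞`
  obtain ⟨n₀, hn₀⟩ := eventually_atTop.1 (eventually_lt_of_lt_liminf hc)
  have hn0top : c * (n₀ : ℝ≥0∞) ^ p ≠ ∞ :=
    ENNReal.mul_ne_top hctop (ENNReal.rpow_ne_top_of_nonneg (by linarith) (ENNReal.natCast_ne_top _))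
  have hmin : ∀ n : ℕ, c * (n : ℝ≥0∞) ^ p ≤ minTupleEnergy d s n + c * (n₀ : ℝ≥0∞) ^ p := by
    intro n
    rcases le_total n₀ n with h | h
    · refine le_add_right ?_
      rcases Nat.eq_zero_or_pos n with rfl | hn
      · simp [ENNReal.zero_rpow_of_pos (by linarith : 0 < p)]
      · have := (hn₀ n h).le
        rwa [ENNReal.le_div_iff_mul_le (Or.inl (by simp [hn.ne']))
          (Or.inl (ENNReal.rpow_ne_top_of_nonneg (by linarith) (ENNReal.natCast_ne_top _)))] at this
    · refine le_add_left ?_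
      gcongr
  -- the bound in a cube of side `R`
  have hR : ∀ R : ℝ, 0 < R → c * (m : ℝ≥0∞) ^ p ≤
      rieszEnergy s P + c * (n₀ : ℝ≥0∞) ^ p / ENNReal.ofReal R ^ (s + d) := by
    intro R hR
    have hRne : ENNReal.ofReal R ≠ 0 := by simpa using hR
    have hRtop : ENNReal.ofReal R ≠ ∞ := ENNReal.ofReal_ne_top
    have hN : Measurable fun C : Measure (EuclideanSpace ℝ (Fin d)) => C (cube d R) :=
      Measure.measurable_coe (measurableSet_cube d R)
    have h1 : ∀ᵐ C ∂P, c * C (cube d R) ^ p ≤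
        ENNReal.ofReal R ^ s * rieszInteraction s (cube d R) C + c * (n₀ : ℝ≥0∞) ^ p := by
      filter_upwards [hP.2.1] with C hC
      obtain ⟨n, hn, hle⟩ := minTupleEnergy_le_rieszInteraction (s := s) hR hC
      rw [hn]
      exact (hmin n).trans (by gcongr)
    have h2 := lintegral_mono_ae h1
    rw [lintegral_const_mul _ (hN.pow_const p), lintegral_add_right _ measurable_const,
      lintegral_const, measure_univ, mul_one,
      lintegral_const_mul' _ _ (ENNReal.rpow_ne_top_of_nonneg hs0.le hRtop)] at h2
    -- Jensen's inequality for the number of points in the cube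
    have hjen : (m * ENNReal.ofReal R ^ (d : ℝ)) ^ p ≤ ∫⁻ C, C (cube d R) ^ p ∂P := by
      have hconj := Real.HolderConjugate.conjExponent hp1
      have := ENNReal.lintegral_mul_le_Lp_mul_Lq P hconj hN.aemeasurable
        (measurable_const (a := (1 : ℝ≥0∞))).aemeasurable
      simp only [Pi.mul_apply, mul_one, ENNReal.one_rpow, lintegral_const, measure_univ] at this
      rw [lintegral_apply_eq_of_mem_stationaryLaws hP (measurableSet_cube d R),
        volume_cube d hR.le, ENNReal.ofReal_pow hR.le, ← ENNReal.rpow_natCast] at this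
      calc _ ≤ ((∫⁻ C, C (cube d R) ^ p ∂P) ^ (1 / p)) ^ p := by gcongr
        _ = _ := by rw [← ENNReal.rpow_mul, one_div, inv_mul_cancel₀ (by linarith), ENNReal.rpow_one]
    have hsplit : (m * ENNReal.ofReal R ^ (d : ℝ)) ^ p =
        (m : ℝ≥0∞) ^ p * ENNReal.ofReal R ^ (s + d) := by
      rw [ENNReal.mul_rpow_of_nonneg _ _ (by linarith), ← ENNReal.rpow_mul]
      congr 2
      rw [hp]; field_simp; ring
    have h3 : c * (m : ℝ≥0∞) ^ p * ENNReal.ofReal R ^ (s + d) ≤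
        ENNReal.ofReal R ^ s * (∫⁻ C, rieszInteraction s (cube d R) C ∂P) +
          c * (n₀ : ℝ≥0∞) ^ p := by
      refine le_trans ?_ h2
      rw [mul_assoc, ← hsplit]
      gcongr
    have h4 : ∫⁻ C, rieszInteraction s (cube d R) C ∂P ≤
        rieszEnergy s P * ENNReal.ofReal R ^ (d : ℝ) := by
      have := lintegral_rieszInteraction_div_le_rieszEnergy s hP hR
      rwa [ENNReal.div_le_iff_le_mul (Or.inl (by simp; positivity))
        (Or.inl ENNReal.ofReal_ne_top), ENNReal.ofReal_pow hR.le, ← ENNReal.rpow_natCast] at this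
    have hsd0 : ENNReal.ofReal R ^ (s + d) ≠ 0 := by
      simp [ENNReal.rpow_eq_zero_iff, hRtop]; intro h; linarith
    have hsdt : ENNReal.ofReal R ^ (s + d) ≠ ∞ :=
      ENNReal.rpow_ne_top_of_nonneg (by linarith) hRtop
    rw [← ENNReal.mul_le_mul_iff_left hsd0 hsdt, add_mul, ENNReal.div_mul_cancel hsd0 hsdt]
    refine h3.trans (add_le_add_left ?_ _)
    calc ENNReal.ofReal R ^ s * (∫⁻ C, rieszInteraction s (cube d R) C ∂P)
        ≤ ENNReal.ofReal R ^ s * (rieszEnergy s P * ENNReal.ofReal R ^ (d : ℝ)) := by gcongr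
      _ = rieszEnergy s P * ENNReal.ofReal R ^ (s + d) := by
        rw [ENNReal.rpow_add _ _ hRne hRtop]; ring
  have hlim : Tendsto (fun R : ℝ => rieszEnergy s P +
      c * (n₀ : ℝ≥0∞) ^ p / ENNReal.ofReal R ^ (s + d)) atTop (𝓝 (rieszEnergy s P + 0)) := by
    refine tendsto_const_nhds.add ?_
    have h1 : Tendsto (fun R : ℝ => ENNReal.ofReal R ^ (s + d)) atTop (𝓝 ∞) :=
      (ENNReal.tendsto_rpow_at_top (by linarith)).comp ENNReal.tendsto_ofReal_atTop
    have h2 := ENNReal.Tendsto.const_div h1 (Or.inr hn0top)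
    rwa [ENNReal.div_top] at h2
  rw [add_zero] at hlim
  refine ge_of_tendsto hlim ?_
  filter_upwards [eventually_gt_atTop 0] with R h using hR R h

/-- Lower bound on the energy of `n` points in the unit cube by the pigeonhole principle: in a
partition into few cells, most points share their cell with another point. -/
lemma le_tupleEnergy_of_mem_cube {s : ℝ} (hs : 0 < s) (hd : 1 ≤ d) {n k : ℕ} (hk : 0 < k)
    (hkn : 2 * (k + 1) ^ d ≤ n) {x : Fin n → EuclideanSpace ℝ (Fin d)}
    (hx : ∀ i, x i ∈ cube d 1) :
    ENNReal.ofReal (n / 2) * ENNReal.ofReal (k / d) ^ s ≤ tupleEnergy s x := by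
  classical
  have hd0 : (0 : ℝ) < d := by exact_mod_cast hd
  have hk0 : (0 : ℝ) < k := by exact_mod_cast hk
  have hcell : ∀ i a, ⌊(k : ℝ) * (x i a + 1 / 2)⌋₊ < k + 1 := by
    intro i a
    have h1 := abs_le.1 (hx i a)
    rw [Nat.lt_succ_iff]
    refine Nat.floor_le_of_le ?_
    nlinarith
  set cell : Fin n → Fin d → Fin (k + 1) := fun i a => ⟨_, hcell i a⟩ with hcelldef
  have hclose : ∀ i j, cell i = cell j → ‖x i - x j‖ ≤ d / k := by
    intro i j hij
    have hcoord : ∀ a, |x i a - x j a| ≤ 1 / k := by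
      intro a
      have h1 : ⌊(k : ℝ) * (x i a + 1 / 2)⌋₊ = ⌊(k : ℝ) * (x j a + 1 / 2)⌋₊ := by
        have := congrArg Fin.val (congrFun hij a)
        simpa [hcelldef] using this
      have hi0 : 0 ≤ (k : ℝ) * (x i a + 1 / 2) := by
        have := (abs_le.1 (hx i a)).1
        exact mul_nonneg hk0.le (by linarith)
      have hj0 : 0 ≤ (k : ℝ) * (x j a + 1 / 2) := by
        have := (abs_le.1 (hx j a)).1
        exact mul_nonneg hk0.le (by linarith)
      have f1 := Nat.floor_le hi0
      have f2 := Nat.floor_le hj0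
      have f3 := Nat.lt_floor_add_one ((k : ℝ) * (x i a + 1 / 2))
      have f4 := Nat.lt_floor_add_one ((k : ℝ) * (x j a + 1 / 2))
      rw [h1] at f1 f3
      rw [le_div_iff₀ hk0, ← abs_of_pos hk0, ← abs_mul, abs_le]
      constructor <;> nlinarith
    calc ‖x i - x j‖ = Real.sqrt (∑ a, ‖(x i - x j) a‖ ^ 2) := EuclideanSpace.norm_eq _
      _ ≤ ∑ a, ‖(x i - x j) a‖ := by
          refine Real.sqrt_le_iff.2 ⟨by positivity, ?_⟩
          exact Finset.sum_sq_le_sq_sum_of_nonneg fun a _ => norm_nonneg _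
      _ ≤ ∑ _a : Fin d, 1 / (k : ℝ) := by
          refine Finset.sum_le_sum fun a _ => ?_
          simpa using hcoord a
      _ = d / k := by simp; ring
  set alone : Finset (Fin n) := Finset.univ.filter fun i => ∀ j, j ≠ i → cell j ≠ cell i with halone
  have hcard : alone.card ≤ (k + 1) ^ d := by
    have : alone.card ≤ (Finset.univ : Finset (Fin d → Fin (k + 1))).card := by
      refine Finset.card_le_card_of_injOn cell (fun _ _ => Finset.mem_coe.2 (Finset.mem_univ _)) ?_
      intro i hi j hj hij
      by_contra hne
      have h1 : ∀ j, j ≠ i → cell j ≠ cell i := by simpa [halone] using hi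
      exact h1 j (Ne.symm hne) hij.symm
    simpa using this
  have hcompl : (n : ℝ) / 2 ≤ (aloneᶜ.card : ℝ) := by
    have h1 : aloneᶜ.card = n - alone.card := by simp [Finset.card_compl]
    have h2 : n ≤ 2 * aloneᶜ.card := by omega
    have h3 : (n : ℝ) ≤ 2 * aloneᶜ.card := by exact_mod_cast h2
    linarith
  have hterm : ∀ i ∈ aloneᶜ, ENNReal.ofReal (k / d) ^ s ≤
      ∑ j ∈ Finset.univ.erase i, ‖x i - x j‖ₑ ^ (-s) := by
    intro i hi
    obtain ⟨j, hji, hj⟩ : ∃ j, j ≠ i ∧ cell j = cell i := by simpa [halone] using hi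
    refine le_trans ?_ (Finset.single_le_sum (f := fun j => ‖x i - x j‖ₑ ^ (-s))
      (fun _ _ => zero_le) (Finset.mem_erase.2 ⟨hji, Finset.mem_univ j⟩))
    have h1 : ‖x i - x j‖ₑ ≤ (ENNReal.ofReal (k / d))⁻¹ := by
      rw [← ENNReal.ofReal_inv_of_pos (by positivity), inv_div, ← ofReal_norm]
      exact ENNReal.ofReal_le_ofReal (hclose i j hj.symm)
    calc ENNReal.ofReal (k / d) ^ s = (ENNReal.ofReal (k / d))⁻¹ ^ (-s) := by
          rw [ENNReal.rpow_neg, ENNReal.inv_rpow, inv_inv]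
      _ ≤ ‖x i - x j‖ₑ ^ (-s) := by
          rw [ENNReal.rpow_neg, ENNReal.rpow_neg]
          gcongr
  calc ENNReal.ofReal (n / 2) * ENNReal.ofReal (k / d) ^ s
      ≤ (aloneᶜ.card : ℝ≥0∞) * ENNReal.ofReal (k / d) ^ s := by
        gcongr
        rw [← ENNReal.ofReal_natCast]
        exact ENNReal.ofReal_le_ofReal hcompl
    _ = ∑ _i ∈ aloneᶜ, ENNReal.ofReal (k / d) ^ s := by simp
    _ ≤ ∑ i ∈ aloneᶜ, ∑ j ∈ Finset.univ.erase i, ‖x i - x j‖ₑ ^ (-s) := Finset.sum_le_sum hterm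
    _ ≤ tupleEnergy s x := Finset.sum_le_sum_of_subset (Finset.subset_univ _)

lemma rieszConstant_pos {s : ℝ} (hd : 1 ≤ d) (hs : (d : ℝ) < s) : 0 < rieszConstant d s := by
  have hd0 : (0 : ℝ) < d := by exact_mod_cast hd
  have hs0 : 0 < s := hd0.trans hs
  set p : ℝ := 1 + s / d with hp
  set c : ℝ := 2⁻¹ * ((2 * (d : ℝ))⁻¹ * 2⁻¹ ^ (1 / d : ℝ)) ^ s with hc
  have hc0 : 0 < c := by positivity
  refine lt_of_lt_of_le (ENNReal.ofReal_pos.2 hc0) ?_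
  rw [rieszConstant_eq]
  refine le_liminf_of_le (by isBoundedDefault) ?_
  have hev : ∀ᶠ n : ℕ in atTop, (4 : ℝ) ≤ ((n : ℝ) / 2) ^ (1 / d : ℝ) :=
    ((tendsto_rpow_atTop (by positivity)).comp
      (tendsto_natCast_atTop_atTop.atTop_div_const two_pos)).eventually_ge_atTop 4
  filter_upwards [hev, eventually_gt_atTop 0] with n hn hn0
  have hn0' : (0 : ℝ) < n := by exact_mod_cast hn0
  set y : ℝ := ((n : ℝ) / 2) ^ (1 / d : ℝ) with hy
  have hyd : y ^ d = (n : ℝ) / 2 := by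
    rw [hy, ← Real.rpow_natCast, ← Real.rpow_mul (by positivity), one_div,
      inv_mul_cancel₀ hd0.ne', Real.rpow_one]
  -- the number of cells per side, chosen so that there are twice as many points as cells
  obtain ⟨k, hk⟩ : ∃ k : ℕ, ⌊y⌋₊ = k + 1 :=
    ⟨⌊y⌋₊ - 1, by have : 4 ≤ ⌊y⌋₊ := Nat.le_floor (by exact_mod_cast hn); omega⟩
  have hfl : ((k : ℝ) + 1) ≤ y := by
    have := Nat.floor_le (show 0 ≤ y by linarith)
    rw [hk] at this; exact_mod_cast this
  have hfl2 : y < (k : ℝ) + 1 + 1 := by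
    have := Nat.lt_floor_add_one y
    rw [hk] at this; exact_mod_cast this
  have hk2 : y / 2 ≤ k := by linarith
  have hk0 : 0 < k := by
    have : (0 : ℝ) < k := by linarith
    exact_mod_cast this
  have hkn : 2 * (k + 1) ^ d ≤ n := by
    have h1 : ((k : ℝ) + 1) ^ d ≤ n / 2 := by rw [← hyd]; gcongr
    have h2 : 2 * ((k : ℝ) + 1) ^ d ≤ n := by linarith
    exact_mod_cast h2
  rw [ENNReal.le_div_iff_mul_le (Or.inl (by simp [hn0.ne']))
    (Or.inl (ENNReal.rpow_ne_top_of_nonneg (by positivity) (ENNReal.natCast_ne_top _)))]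
  refine le_iInf₂ fun x hx => ?_
  refine le_trans ?_ (le_tupleEnergy_of_mem_cube hs0 hd hk0 hkn hx)
  rw [← ENNReal.ofReal_natCast, ENNReal.ofReal_rpow_of_pos hn0',
    ENNReal.ofReal_rpow_of_pos (by positivity), ← ENNReal.ofReal_mul hc0.le,
    ← ENNReal.ofReal_mul (by positivity)]
  refine ENNReal.ofReal_le_ofReal ?_
  have e1 : (n : ℝ) ^ p = n * ((n : ℝ) ^ (1 / d : ℝ)) ^ s := by
    rw [← Real.rpow_mul hn0'.le, hp, Real.rpow_add hn0', Real.rpow_one]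
    congr 2; ring
  have e2 : y = 2⁻¹ ^ (1 / d : ℝ) * (n : ℝ) ^ (1 / d : ℝ) := by
    rw [hy, div_eq_inv_mul, Real.mul_rpow (by norm_num) hn0'.le]
  calc c * (n : ℝ) ^ p = n / 2 * ((2 * (d : ℝ))⁻¹ * y) ^ s := by
        rw [e1, hc, e2, ← mul_assoc ((2 * (d : ℝ))⁻¹),
          Real.mul_rpow (y := (n : ℝ) ^ (1 / d : ℝ)) (by positivity) (by positivity)]
        ring
    _ ≤ n / 2 * (k / d) ^ s := by
        gcongr
        rw [mul_inv, div_eq_mul_inv]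
        nlinarith [inv_pos.2 hd0]

end MinimalEnergy

/-! ### Lattice geometry -/

section Lattice

variable {d : ℕ}

/-- The sum of `‖z‖ ^ (-s)` over the nonzero points of `ℤ ^ d`. -/
noncomputable def latticeSum (d : ℕ) (s : ℝ) : ℝ≥0∞ :=
  ∑' z : Fin d → ℤ, if z = 0 then 0 else ENNReal.ofReal ‖z‖ ^ (-s)

lemma summable_norm_rpow_int {s : ℝ} (hs : (d : ℝ) < s) :
    Summable fun z : Fin d → ℤ => ‖z‖ ^ (-s) := by
  set b := Pi.basisFun ℝ (Fin d)
  have hmem : ∀ z : Fin d → ℤ, (fun i => (z i : ℝ)) ∈ Submodule.span ℤ (range b) := by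
    intro z
    rw [Submodule.mem_span_range_iff_exists_fun]
    refine ⟨z, ?_⟩
    ext i
    simp [b, Finset.sum_apply, Pi.single_apply]
  set f : (Fin d → ℤ) → Submodule.span ℤ (range b) := fun z => ⟨_, hmem z⟩ with hf
  have hinj : Function.Injective f := by
    intro z w h
    ext i
    have := congrFun (congrArg Subtype.val h) i
    simpa [hf] using this
  have hr : -s < -(Module.finrank ℤ (Submodule.span ℤ (range b)) : ℝ) := by
    have : Module.finrank ℤ (Submodule.span ℤ (range b)) = d := by
      rw [ZLattice.rank ℝ (Submodule.span ℤ (range b))]; simp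
    rw [this]; linarith
  have := (ZLattice.summable_norm_rpow (Submodule.span ℤ (range b)) (-s) hr).comp_injective hinj
  refine this.congr fun z => ?_
  simp only [Function.comp_apply, hf]
  congr 1

lemma latticeSum_ne_top {s : ℝ} (hs : (d : ℝ) < s) : latticeSum d s ≠ ∞ := by
  have h := (summable_norm_rpow_int hs).tsum_ofReal_ne_top
  refine ne_top_of_le_ne_top h (ENNReal.tsum_le_tsum fun z => ?_)
  split_ifs with hz
  · exact zero_le
  · rw [ENNReal.ofReal_rpow_of_pos (norm_pos_iff.2 hz)]

/-- The lattice point `L z`. -/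
noncomputable def latticeShift {d : ℕ} (L : ℝ) (z : Fin d → ℤ) : EuclideanSpace ℝ (Fin d) :=
  WithLp.toLp 2 fun a => L * z a

@[simp] lemma latticeShift_apply (L : ℝ) (z : Fin d → ℤ) (a : Fin d) :
    latticeShift L z a = L * z a := rfl

lemma latticeShift_add (L : ℝ) (z w : Fin d → ℤ) :
    latticeShift L (z + w) = latticeShift L z + latticeShift L w := by
  ext a; simp [mul_add]

/-- The half-open cell `[0, L) ^ d`. -/
def latticeCell (d : ℕ) (L : ℝ) : Set (EuclideanSpace ℝ (Fin d)) :=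
  {x | ∀ a, x a ∈ Ico 0 L}

lemma latticeCell_eq_preimage (d : ℕ) (L : ℝ) : latticeCell d L =
    (WithLp.ofLp : EuclideanSpace ℝ (Fin d) → Fin d → ℝ) ⁻¹' (univ.pi fun _ => Ico 0 L) := by
  ext x; simp [latticeCell]

lemma measurableSet_latticeCell (d : ℕ) (L : ℝ) : MeasurableSet (latticeCell d L) := by
  rw [latticeCell_eq_preimage]
  exact (PiLp.volume_preserving_ofLp (Fin d)).measurable
    (MeasurableSet.univ_pi fun _ => measurableSet_Ico)

lemma volume_latticeCell (d : ℕ) {L : ℝ} (hL : 0 ≤ L) :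
    volume (latticeCell d L) = ENNReal.ofReal (L ^ d) := by
  rw [latticeCell_eq_preimage, (PiLp.volume_preserving_ofLp (Fin d)).measure_preimage
    (MeasurableSet.univ_pi fun _ => measurableSet_Ico).nullMeasurableSet, volume_pi_pi]
  simp [ENNReal.ofReal_pow hL]

lemma volume_latticeCell_ne_top (d : ℕ) {L : ℝ} (hL : 0 ≤ L) : volume (latticeCell d L) ≠ ∞ := by
  rw [volume_latticeCell d hL]; exact ENNReal.ofReal_ne_top

lemma volume_latticeCell_ne_zero (d : ℕ) {L : ℝ} (hL : 0 < L) : volume (latticeCell d L) ≠ 0 := by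
  rw [volume_latticeCell d hL.le]; simp; positivity

lemma interior_latticeCell_nonempty (d : ℕ) {L : ℝ} (hL : 0 < L) :
    (interior (latticeCell d L)).Nonempty := by
  refine ⟨WithLp.toLp 2 fun _ => L / 2, mem_interior.2 ⟨Metric.ball _ (L / 2), fun x hx i => ?_,
    Metric.isOpen_ball, Metric.mem_ball_self (by positivity)⟩⟩
  rw [mem_ball_iff_norm] at hx
  have h1 := (PiLp.norm_apply_le _ i).trans_lt hx
  simp only [PiLp.sub_apply, Real.norm_eq_abs, abs_lt] at h1
  exact ⟨by linarith, by linarith⟩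

/-- The lattice basis `L e_a`. -/
noncomputable def latticeBasis (d : ℕ) {L : ℝ} (hL : 0 < L) :
    Module.Basis (Fin d) ℝ (EuclideanSpace ℝ (Fin d)) :=
  (EuclideanSpace.basisFun (Fin d) ℝ).toBasis.isUnitSMul fun _ => IsUnit.mk0 L hL.ne'

lemma fundamentalDomain_latticeBasis (d : ℕ) {L : ℝ} (hL : 0 < L) :
    ZSpan.fundamentalDomain (latticeBasis d hL) = latticeCell d L := by
  ext x
  simp only [ZSpan.mem_fundamentalDomain, latticeCell, latticeBasis,
    Module.Basis.repr_isUnitSMul, mem_ofPred_eq]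
  refine forall_congr' fun a => ?_
  have h1 : ((IsUnit.mk0 L hL.ne').unit⁻¹ : ℝˣ) •
      ((EuclideanSpace.basisFun (Fin d) ℝ).toBasis.repr x a) = L⁻¹ * x a := by
    simp [Units.smul_def]
  rw [h1, mem_Ico, mem_Ico]
  constructor
  · rintro ⟨h, h'⟩
    constructor
    · exact nonneg_of_mul_nonneg_right h (inv_pos.2 hL)
    · rwa [inv_mul_lt_iff₀ hL, mul_one] at h'
  · rintro ⟨h, h'⟩
    exact ⟨by positivity, by rwa [inv_mul_lt_iff₀ hL, mul_one]⟩

/-- Integrals over a cell of lattice-periodic functions are translation invariant. -/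
lemma setLIntegral_latticeCell_comp_sub {L : ℝ} (hL : 0 < L)
    {h : EuclideanSpace ℝ (Fin d) → ℝ≥0∞}
    (hper : ∀ z u, h (u + latticeShift L z) = h u) (x : EuclideanSpace ℝ (Fin d)) :
    ∫⁻ u in latticeCell d L, h (u - x) = ∫⁻ u in latticeCell d L, h u := by
  have hfd := ZSpan.isAddFundamentalDomain (latticeBasis d hL)
    (volume : Measure (EuclideanSpace ℝ (Fin d)))
  rw [fundamentalDomain_latticeBasis d hL] at hfd
  have hfd2 := hfd.vadd_of_comm (-x)
  have hinv : ∀ (g : Submodule.span ℤ (range (latticeBasis d hL))) (u), h (g +ᵥ u) = h u := by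
    rintro ⟨g, hg⟩ u
    obtain ⟨z, rfl⟩ := (Submodule.mem_span_range_iff_exists_fun ℤ).1 hg
    have h1 : ∑ i, z i • latticeBasis d hL i = latticeShift L z := by
      ext a
      simp [latticeBasis, Module.Basis.isUnitSMul_apply, Finset.sum_apply, Pi.single_apply,
        mul_comm]
    rw [Submodule.vadd_def, vadd_eq_add, add_comm]
    simp only [h1]
    exact hper z u
  have : VAddInvariantMeasure (Submodule.span ℤ (range (latticeBasis d hL)))
      (EuclideanSpace ℝ (Fin d)) volume :=
    inferInstanceAs <| VAddInvariantMeasure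
      (Submodule.span ℤ (range (latticeBasis d hL))).toAddSubgroup (EuclideanSpace ℝ (Fin d)) volume
  rw [hfd.setLIntegral_eq hfd2 h hinv]
  open scoped Pointwise in
  have hpre : (-x) +ᵥ latticeCell d L = (fun u => u + x) ⁻¹' latticeCell d L := by
    ext u
    rw [Set.mem_vadd_set_iff_neg_vadd_mem]
    simp [add_comm]
  rw [hpre]
  have := (measurePreserving_add_right (volume : Measure (EuclideanSpace ℝ (Fin d))) x)
    |>.setLIntegral_comp_preimage_emb (MeasurableEquiv.addRight x).measurableEmbedding
      (fun u => h (u - x)) (latticeCell d L)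
  rw [← this]
  simp

/-- Every point belongs to exactly one translate of the cell. -/
lemma exists_unique_add_latticeShift_mem {L : ℝ} (hL : 0 < L) (x : EuclideanSpace ℝ (Fin d)) :
    ∃ z₀ : Fin d → ℤ, ∀ z, x + latticeShift L z ∈ latticeCell d L ↔ z = z₀ := by
  refine ⟨fun a => -⌊x a / L⌋, fun z => ?_⟩
  simp only [latticeCell, mem_ofPred_eq, funext_iff, PiLp.add_apply, latticeShift_apply, mem_Ico]
  refine forall_congr' fun a => ?_
  have h1 : (z a = -⌊x a / L⌋) ↔ ⌊x a / L⌋ = -z a := by omega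
  rw [h1, Int.floor_eq_iff, le_div_iff₀ hL, div_lt_iff₀ hL]
  push_cast
  constructor <;> rintro ⟨h, h'⟩ <;> constructor <;> nlinarith

/-- Points of different cells which stay away from the boundaries are well separated. -/
lemma le_norm_sub_of_gap {L g : ℝ} (hg : 0 ≤ g) (hgL : 2 * g ≤ L)
    {y y' : EuclideanSpace ℝ (Fin d)} (hy : ∀ a, y a ∈ Icc g (L - g))
    (hy' : ∀ a, y' a ∈ Icc g (L - g)) {z z' : Fin d → ℤ} (hz : z ≠ z') :
    2 * g * ‖z - z'‖ ≤ ‖(y + latticeShift L z) - (y' + latticeShift L z')‖ := by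
  have hne : z - z' ≠ 0 := sub_ne_zero.2 hz
  have : Nonempty (Fin d) := by
    by_contra hemp
    rw [not_nonempty_iff] at hemp
    exact hz (Subsingleton.elim _ _)
  obtain ⟨a, ha⟩ : ∃ a, ‖z - z'‖ = ‖(z - z') a‖ := by
    obtain ⟨a, -, ha⟩ := Finset.exists_mem_eq_sup' (Finset.univ_nonempty (α := Fin d))
      (fun a => ‖(z - z') a‖₊)
    refine ⟨a, ?_⟩
    rw [Pi.norm_def, ← coe_nnnorm, ← ha, Finset.sup'_eq_sup]
  have hk1 : (1 : ℝ) ≤ ‖z - z'‖ := by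
    rw [ha]
    have h0 : (z - z') a ≠ 0 := by
      intro h0; rw [h0, norm_zero] at ha; exact hne (norm_eq_zero.1 ha)
    rw [Int.norm_eq_abs]
    exact_mod_cast Int.one_le_abs h0
  refine le_trans ?_ (PiLp.norm_apply_le _ a)
  have e1 := hy a
  have e2 := hy' a
  have h3 : ((y + latticeShift L z) - (y' + latticeShift L z')) a =
      (y a - y' a) + L * (((z - z') a : ℤ) : ℝ) := by
    simp; ring
  rw [h3, Real.norm_eq_abs]
  have h4 : |y a - y' a| ≤ L - 2 * g := by
    rw [abs_le]; constructor <;> linarith [e1.1, e1.2, e2.1, e2.2]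
  have hL : 0 ≤ L := by linarith
  have h5 : |L * (((z - z') a : ℤ) : ℝ)| = L * ‖z - z'‖ := by
    rw [abs_mul, abs_of_nonneg hL, ha, Int.norm_eq_abs]
  have h6 := abs_sub_abs_le_abs_sub (L * (((z - z') a : ℤ) : ℝ)) (-(y a - y' a))
  rw [abs_neg, h5, sub_neg_eq_add, add_comm] at h6
  nlinarith

end Lattice

/-! ### Lattice processes with independent cells -/

section LatticeProcess

variable {d N : ℕ}

/-- The content of a cell: a switch, and the positions of the `N` points which are present when the
switch is on. -/
abbrev CellData (d N : ℕ) : Type := Bool × (Fin N → EuclideanSpace ℝ (Fin d))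

/-- The point configuration described by the content of a cell. -/
noncomputable def cellConfig (x : CellData d N) : Measure (EuclideanSpace ℝ (Fin d)) :=
  if x.1 then ∑ i, Measure.dirac (x.2 i) else 0

/-- The configuration obtained by placing the cell contents `ω z` at the points of the shifted
lattice `L ℤ ^ d + u`. -/
noncomputable def latticeConfig (L : ℝ) (u : EuclideanSpace ℝ (Fin d))
    (ω : (Fin d → ℤ) → CellData d N) : Measure (EuclideanSpace ℝ (Fin d)) :=
  Measure.sum fun z => (cellConfig (ω z)).map fun p => p + (latticeShift L z + u)

/-- The law of `latticeConfig` when the cell contents are independent with law `Λ` and the shift is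
uniform in a cell. -/
noncomputable def latticeProcess (L : ℝ) (Λ : Measure (CellData d N)) :
    Measure (Measure (EuclideanSpace ℝ (Fin d))) :=
  ((volume[|latticeCell d L]).prod (Measure.infinitePi fun _ : Fin d → ℤ => Λ)).map
    fun w => latticeConfig L w.1 w.2

lemma cellConfig_map_add_apply (x : CellData d N) (v : EuclideanSpace ℝ (Fin d))
    {S : Set (EuclideanSpace ℝ (Fin d))} (hS : MeasurableSet S) :
    ((cellConfig x).map fun p => p + v) S =
      if x.1 then ∑ i, S.indicator 1 (x.2 i + v) else 0 := by
  have hm : Measurable fun p : EuclideanSpace ℝ (Fin d) => p + v := by fun_prop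
  rw [Measure.map_apply hm hS, cellConfig]
  split_ifs with h
  · rw [Measure.coe_finsetSum, Finset.sum_apply]
    refine Finset.sum_congr rfl fun i _ => ?_
    rw [Measure.dirac_apply' _ (hm hS)]
    rfl
  · rfl

lemma latticeConfig_apply (L : ℝ) (u : EuclideanSpace ℝ (Fin d))
    (ω : (Fin d → ℤ) → CellData d N) {S : Set (EuclideanSpace ℝ (Fin d))} (hS : MeasurableSet S) :
    latticeConfig L u ω S = ∑' z, if (ω z).1 then
      ∑ i, S.indicator 1 ((ω z).2 i + (latticeShift L z + u)) else 0 := by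
  rw [latticeConfig, Measure.sum_apply _ hS]
  simp only [cellConfig_map_add_apply _ _ hS]

lemma measurable_cellConfig_map_add :
    Measurable fun w : EuclideanSpace ℝ (Fin d) × CellData d N =>
      (cellConfig w.2).map fun p => p + w.1 := by
  refine Measure.measurable_of_measurable_coe _ fun S hS => ?_
  simp only [cellConfig_map_add_apply _ _ hS]
  refine Measurable.ite ?_ ?_ measurable_const
  · exact (measurable_fst.comp measurable_snd) (measurableSet_singleton true)
  · refine Finset.measurable_fun_sum _ fun i _ => ?_
    refine (measurable_const.indicator hS).comp ?_
    exact ((measurable_pi_apply i).comp (measurable_snd.comp measurable_snd)).add measurable_fst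

lemma measurable_latticeConfig (L : ℝ) :
    Measurable fun w : EuclideanSpace ℝ (Fin d) × ((Fin d → ℤ) → CellData d N) =>
      latticeConfig L w.1 w.2 := by
  refine Measure.measurable_of_measurable_coe _ fun S hS => ?_
  simp only [latticeConfig, Measure.sum_apply _ hS]
  refine Measurable.tsum fun z => ?_
  have h1 : Measurable fun w : EuclideanSpace ℝ (Fin d) × ((Fin d → ℤ) → CellData d N) =>
      (latticeShift L z + w.1, w.2 z) :=
    (measurable_fst.const_add _).prodMk ((measurable_pi_apply z).comp measurable_snd)
  exact (Measure.measurable_coe hS).comp (measurable_cellConfig_map_add.comp h1)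

lemma latticeConfig_map_sub (L : ℝ) (u x : EuclideanSpace ℝ (Fin d))
    (ω : (Fin d → ℤ) → CellData d N) :
    (latticeConfig L u ω).map (fun p => p - x) = latticeConfig L (u - x) ω := by
  rw [latticeConfig, Measure.map_sum (by fun_prop), latticeConfig]
  congr 1
  ext1 z
  rw [Measure.map_map (by fun_prop) (by fun_prop)]
  congr 1
  ext1 p
  simp only [Function.comp_apply]
  abel

lemma latticeConfig_add_latticeShift (L : ℝ) (u : EuclideanSpace ℝ (Fin d)) (z₀ : Fin d → ℤ)
    (ω : (Fin d → ℤ) → CellData d N) :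
    latticeConfig L (u + latticeShift L z₀) ω = latticeConfig L u fun z => ω (z - z₀) := by
  ext S hS
  rw [latticeConfig_apply L _ _ hS, latticeConfig_apply L _ _ hS]
  conv_rhs => rw [← Equiv.tsum_eq (Equiv.addRight z₀)]
  refine tsum_congr fun z => ?_
  have : latticeShift L (z + z₀) + u = latticeShift L z + (u + latticeShift L z₀) := by
    rw [latticeShift_add]; abel
  simp [this]

lemma isProbabilityMeasure_cond_latticeCell {L : ℝ} (hL : 0 < L) :
    IsProbabilityMeasure (volume[|latticeCell d L]) :=
  cond_isProbabilityMeasure_of_finite (volume_latticeCell_ne_zero d hL)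
    (volume_latticeCell_ne_top d hL.le)

lemma isProbabilityMeasure_latticeProcess {L : ℝ} (hL : 0 < L) (Λ : Measure (CellData d N))
    [IsProbabilityMeasure Λ] : IsProbabilityMeasure (latticeProcess L Λ) := by
  have := isProbabilityMeasure_cond_latticeCell (d := d) hL
  exact Measure.isProbabilityMeasure_map (measurable_latticeConfig L).aemeasurable

/-- The lattice process is stationary: a translation amounts to a change of the uniform shift and
a relabelling of the cells. -/
lemma latticeProcess_map_sub {L : ℝ} (hL : 0 < L) (Λ : Measure (CellData d N))
    [IsProbabilityMeasure Λ] (x : EuclideanSpace ℝ (Fin d)) :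
    (latticeProcess L Λ).map (fun C => C.map fun p => p - x) = latticeProcess L Λ := by
  have := isProbabilityMeasure_cond_latticeCell (d := d) hL
  set Q := Measure.infinitePi fun _ : Fin d → ℤ => Λ with hQ
  have hm := measurable_latticeConfig (d := d) (N := N) L
  have hmt : Measurable fun C : Measure (EuclideanSpace ℝ (Fin d)) => C.map fun p => p - x :=
    Measure.measurable_map _ (by fun_prop)
  ext S hS
  have hT : MeasurableSet ((fun w : EuclideanSpace ℝ (Fin d) × ((Fin d → ℤ) → CellData d N) =>
      latticeConfig L w.1 w.2) ⁻¹' S) := hm hS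
  set h : EuclideanSpace ℝ (Fin d) → ℝ≥0∞ := fun u => Q {ω | latticeConfig L u ω ∈ S} with hh
  have hper : ∀ z u, h (u + latticeShift L z) = h u := by
    intro z₀ u
    have hpres : Q.map (fun ω z => ω (z - z₀)) = Q := by
      have := Measure.infinitePi_map_piCongrLeft (μ := fun _ : Fin d → ℤ => Λ)
        (Equiv.addRight z₀)
      rw [hQ]
      refine Eq.trans ?_ this
      congr 1
      ext1 ω
      ext1 z
      obtain ⟨w, rfl⟩ := (Equiv.addRight z₀).surjective z
      rw [MeasurableEquiv.coe_piCongrLeft]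
      refine Eq.trans ?_ (Equiv.piCongrLeft_apply_apply (fun _ => CellData d N)
        (Equiv.addRight z₀) ω w).symm
      simp
    have hmp : Measurable fun (ω : (Fin d → ℤ) → CellData d N) (z : Fin d → ℤ) => ω (z - z₀) := by
      fun_prop
    have hset : MeasurableSet {ω : (Fin d → ℤ) → CellData d N | latticeConfig L u ω ∈ S} :=
      (hm.comp measurable_prodMk_left) hS
    simp only [hh, latticeConfig_add_latticeShift]
    conv_rhs => rw [← hpres]
    rw [Measure.map_apply hmp hset]
    rfl
  rw [latticeProcess, Measure.map_map hmt hm, Measure.map_apply (hmt.comp hm) hS,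
    Measure.map_apply hm hS, Measure.prod_apply (hmt.comp hm hS), Measure.prod_apply hT]
  have h1 : ∀ u, Q (Prod.mk u ⁻¹' (((fun C : Measure (EuclideanSpace ℝ (Fin d)) =>
      C.map fun p => p - x) ∘ fun w : EuclideanSpace ℝ (Fin d) × ((Fin d → ℤ) → CellData d N) =>
        latticeConfig L w.1 w.2) ⁻¹' S)) = h (u - x) := by
    intro u
    simp only [hh, ← latticeConfig_map_sub]
    rfl
  rw [lintegral_congr h1]
  rw [ProbabilityTheory.cond, lintegral_smul_measure, lintegral_smul_measure,
    setLIntegral_latticeCell_comp_sub hL hper x]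
  rfl

/-- The position of the point `i` of the cell `z`. -/
noncomputable def latticePoint (L : ℝ) (u : EuclideanSpace ℝ (Fin d))
    (ω : (Fin d → ℤ) → CellData d N) (t : (Fin d → ℤ) × Fin N) : EuclideanSpace ℝ (Fin d) :=
  (ω t.1).2 t.2 + (latticeShift L t.1 + u)

/-- The cells of the shifted lattice which may meet the cube of side `2 n L`. -/
noncomputable def latticeWindow (d n : ℕ) : Finset (Fin d → ℤ) :=
  Fintype.piFinset fun _ => Finset.Icc (-(n + 2) : ℤ) n

lemma card_latticeWindow (d n : ℕ) : (latticeWindow d n).card = (2 * n + 3) ^ d := by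
  have h : ((n : ℤ) + 1 - -(n + 2)).toNat = 2 * n + 3 := by omega
  simp only [latticeWindow, Fintype.card_piFinset, Int.card_Icc, h, Finset.prod_const,
    Finset.card_univ, Fintype.card_fin]

lemma mem_latticeWindow {L : ℝ} (hL : 0 < L) {n : ℕ} {y u : EuclideanSpace ℝ (Fin d)}
    (hy : ∀ a, y a ∈ Icc 0 L) (hu : u ∈ latticeCell d L) {z : Fin d → ℤ}
    (h : y + (latticeShift L z + u) ∈ cube d (2 * n * L)) : z ∈ latticeWindow d n := by
  rw [latticeWindow, Fintype.mem_piFinset]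
  intro a
  have h1 := abs_le.1 (h a)
  simp only [PiLp.add_apply, latticeShift_apply] at h1
  have h2 := hy a
  have h3 := hu a
  rw [Finset.mem_Icc]
  constructor
  · have : -((n : ℝ) + 2) * L ≤ z a * L := by nlinarith [h2.2, h3.2, h1.1]
    have := le_of_mul_le_mul_right this hL
    exact_mod_cast this
  · have : (z a : ℝ) * L ≤ n * L := by nlinarith [h2.1, h3.1, h1.2]
    have := le_of_mul_le_mul_right this hL
    exact_mod_cast this

/-- The points of a lattice configuration in a bounded window, as a finite sum of Dirac masses. -/
lemma exists_latticeConfig_restrict_eq {L : ℝ} (hL : 0 < L) {n : ℕ}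
    {u : EuclideanSpace ℝ (Fin d)} (hu : u ∈ latticeCell d L)
    {ω : (Fin d → ℤ) → CellData d N} (hω : ∀ z i a, (ω z).2 i a ∈ Icc 0 L)
    {A : Set (EuclideanSpace ℝ (Fin d))} (hA : MeasurableSet A) (hAn : A ⊆ cube d (2 * n * L)) :
    ∃ T : Finset ((Fin d → ℤ) × Fin N), T ⊆ latticeWindow d n ×ˢ Finset.univ ∧
      (latticeConfig L u ω).restrict A = ∑ t : T, Measure.dirac (latticePoint L u ω t) := by
  classical
  refine ⟨(latticeWindow d n ×ˢ Finset.univ).filter fun t =>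
    (ω t.1).1 = true ∧ latticePoint L u ω t ∈ A, Finset.filter_subset _ _, ?_⟩
  ext S hS
  rw [Measure.restrict_apply hS, latticeConfig_apply L u ω (hS.inter hA), Measure.coe_finsetSum,
    Finset.sum_apply, Finset.sum_coe_sort _ fun t => Measure.dirac (latticePoint L u ω t) S,
    Finset.sum_filter, Finset.sum_product, tsum_eq_sum (s := latticeWindow d n)]
  · refine Finset.sum_congr rfl fun z _ => ?_
    by_cases hz : (ω z).1 = true
    · simp only [hz, if_true, true_and]
      refine Finset.sum_congr rfl fun i _ => ?_
      rw [Measure.dirac_apply' _ hS]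
      change (S ∩ A).indicator 1 (latticePoint L u ω (z, i)) = _
      by_cases hm : latticePoint L u ω (z, i) ∈ A
      · simp [hm, indicator]
      · simp [hm]
    · simp [hz]
  · intro z hz
    split_ifs with h
    · refine Finset.sum_eq_zero fun i _ => ?_
      refine indicator_of_notMem (fun hmem => hz ?_) _
      exact mem_latticeWindow hL (hω z i) hu (hAn hmem.2)
    · rfl

lemma isPointConfig_latticeConfig {L : ℝ} (hL : 0 < L) {u : EuclideanSpace ℝ (Fin d)}
    (hu : u ∈ latticeCell d L) {ω : (Fin d → ℤ) → CellData d N}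
    (hω : ∀ z i a, (ω z).2 i a ∈ Icc 0 L) : IsPointConfig (latticeConfig L u ω) := by
  intro B hB hBb
  obtain ⟨r, hr⟩ := hBb.subset_closedBall 0
  obtain ⟨n, hn⟩ := exists_nat_ge (r / L)
  rw [div_le_iff₀ hL] at hn
  have hBn : B ⊆ cube d (2 * n * L) := by
    intro x hx i
    have h1 := hr hx
    rw [mem_closedBall_zero_iff] at h1
    have h2 := (PiLp.norm_apply_le x i).trans h1
    rw [Real.norm_eq_abs] at h2
    linarith
  obtain ⟨T, -, hT⟩ := exists_latticeConfig_restrict_eq hL hu hω hB hBn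
  refine ⟨T.card, ?_⟩
  rw [← Measure.restrict_apply_univ, hT]
  simp

/-- A deterministic bound for the energy of a lattice configuration: the energy inside the cells,
plus the interaction between different cells, which is controlled by a lattice sum. -/
lemma rieszInteraction_latticeConfig_le {s L g : ℝ} (hs : 0 < s) (hg : 0 < g) (hgL : 2 * g ≤ L)
    (n : ℕ) {u : EuclideanSpace ℝ (Fin d)} (hu : u ∈ latticeCell d L)
    {ω : (Fin d → ℤ) → CellData d N} (hω : ∀ z i a, (ω z).2 i a ∈ Icc g (L - g)) {e : ℝ≥0∞}
    (he : ∀ z, tupleEnergy s (ω z).2 ≤ e) :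
    rieszInteraction s (cube d (2 * n * L)) (latticeConfig L u ω) ≤
      (2 * n + 3 : ℝ≥0∞) ^ d * (e + N * (N * (ENNReal.ofReal (2 * g) ^ (-s) * latticeSum d s))) := by
  classical
  have hL : 0 < L := by linarith
  have hω0 : ∀ z i a, (ω z).2 i a ∈ Icc 0 L := fun z i a =>
    ⟨hg.le.trans (hω z i a).1, (hω z i a).2.trans (by linarith)⟩
  obtain ⟨T, hT, hres⟩ := exists_latticeConfig_restrict_eq hL hu hω0
    (measurableSet_cube d (2 * n * L)) Subset.rfl
  rw [rieszInteraction_eq_sum (measurableSet_cube d _) hres]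
  set X := latticePoint L u ω with hX
  set I := ENNReal.ofReal (2 * g) ^ (-s) * latticeSum d s with hI
  -- the interaction of a point with all the others
  have hpoint : ∀ t : (Fin d → ℤ) × Fin N,
      ∑' t', (if t' = t then 0 else ‖X t - X t'‖ₑ ^ (-s)) ≤
        ∑ j ∈ Finset.univ.erase t.2, ‖(ω t.1).2 t.2 - (ω t.1).2 j‖ₑ ^ (-s) + N * I := by
    rintro ⟨z, i⟩
    rw [ENNReal.tsum_prod', ENNReal.tsum_eq_add_tsum_ite z]
    refine add_le_add ?_ ?_
    · rw [tsum_fintype, ← Finset.sum_erase_add _ _ (Finset.mem_univ i)]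
      simp only [if_true, add_zero]
      refine Finset.sum_le_sum fun j hj => ?_
      have hne : (z, j) ≠ (z, i) := fun h => Finset.ne_of_mem_erase hj (Prod.ext_iff.1 h).2
      rw [if_neg hne]
      simp [hX, latticePoint]
    · calc _ ≤ ∑' z', N * (ENNReal.ofReal (2 * g) ^ (-s) *
              (if z' - z = 0 then 0 else ENNReal.ofReal ‖z' - z‖ ^ (-s))) := by
            refine ENNReal.tsum_le_tsum fun z' => ?_
            split_ifs with h1 h2 h2
            · simp
            · exact absurd (sub_eq_zero.2 h1) h2
            · exact absurd (sub_eq_zero.1 h2) h1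
            · rw [tsum_fintype]
              calc ∑ j, (if (z', j) = (z, i) then 0 else ‖X (z, i) - X (z', j)‖ₑ ^ (-s))
                  ≤ ∑ _j : Fin N, ENNReal.ofReal (2 * g) ^ (-s) *
                      ENNReal.ofReal ‖z' - z‖ ^ (-s) := by
                    refine Finset.sum_le_sum fun j _ => ?_
                    have hne : (z', j) ≠ (z, i) := fun h => h1 (Prod.ext_iff.1 h).1
                    rw [if_neg hne, ← ENNReal.mul_rpow_of_pos_finite (by simpa using hg)
                      ENNReal.ofReal_ne_top, ← ENNReal.ofReal_mul (by positivity),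
                      ENNReal.rpow_neg, ENNReal.rpow_neg, norm_sub_rev, ← ofReal_norm]
                    gcongr
                    have := le_norm_sub_of_gap hg.le hgL (hω z i) (hω z' j) (Ne.symm h1)
                    refine this.trans (le_of_eq ?_)
                    congr 1
                    simp only [hX, latticePoint]
                    abel
                _ = _ := by simp
        _ = N * I := by
            rw [ENNReal.tsum_mul_left, ENNReal.tsum_mul_left, hI, latticeSum]
            congr 2
            exact Equiv.tsum_eq (Equiv.subRight z)
              (fun w : Fin d → ℤ => if w = 0 then 0 else ENNReal.ofReal ‖w‖ ^ (-s))
  -- extend the sum over the points in the cube to all points of the cells which meet the cube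
  calc ∑ t : T, ∑ t' ∈ Finset.univ.erase t, ‖X t - X t'‖ₑ ^ (-s)
      ≤ ∑ t : T, (∑ j ∈ Finset.univ.erase t.1.2,
          ‖(ω t.1.1).2 t.1.2 - (ω t.1.1).2 j‖ₑ ^ (-s) + N * I) := by
        refine Finset.sum_le_sum fun t _ => ?_
        refine le_trans ?_ (hpoint t)
        calc ∑ t' ∈ Finset.univ.erase t, ‖X t - X t'‖ₑ ^ (-s)
            = ∑ t' ∈ (Finset.univ.erase t).map (Function.Embedding.subtype _),
                (if t' = t.1 then 0 else ‖X t - X t'‖ₑ ^ (-s)) := by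
              rw [Finset.sum_map]
              refine Finset.sum_congr rfl fun t' ht' => ?_
              have : t'.1 ≠ t.1 := fun h => Finset.ne_of_mem_erase ht' (Subtype.ext h)
              simp [this]
          _ ≤ _ := ENNReal.sum_le_tsum _
    _ = ∑ t ∈ T, (∑ j ∈ Finset.univ.erase t.2,
          ‖(ω t.1).2 t.2 - (ω t.1).2 j‖ₑ ^ (-s) + N * I) :=
        Finset.sum_coe_sort T fun t => (∑ j ∈ Finset.univ.erase t.2,
          ‖(ω t.1).2 t.2 - (ω t.1).2 j‖ₑ ^ (-s) + N * I)
    _ ≤ ∑ t ∈ latticeWindow d n ×ˢ Finset.univ, (∑ j ∈ Finset.univ.erase t.2,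
          ‖(ω t.1).2 t.2 - (ω t.1).2 j‖ₑ ^ (-s) + N * I) := Finset.sum_le_sum_of_subset hT
    _ = ∑ z ∈ latticeWindow d n, (tupleEnergy s (ω z).2 + N * (N * I)) := by
        rw [Finset.sum_product]
        refine Finset.sum_congr rfl fun z _ => ?_
        rw [Finset.sum_add_distrib]
        simp [tupleEnergy]
    _ ≤ ∑ _z ∈ latticeWindow d n, (e + N * (N * I)) :=
        Finset.sum_le_sum fun z _ => add_le_add_left (he z) _
    _ = _ := by
        rw [Finset.sum_const, card_latticeWindow, nsmul_eq_mul]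
        push_cast
        rfl

end LatticeProcess

/-! ### Intensity, energy and entropy of lattice processes -/

section LatticeAverages

variable {d N : ℕ}

lemma ae_prod_latticeCell {L : ℝ} (hL : 0 < L) {Λ : Measure (CellData d N)}
    [IsProbabilityMeasure Λ] {G : CellData d N → Prop} (hG : ∀ᵐ x ∂Λ, G x) :
    ∀ᵐ w ∂((volume[|latticeCell d L]).prod (Measure.infinitePi fun _ : Fin d → ℤ => Λ)),
      w.1 ∈ latticeCell d L ∧ ∀ z, G (w.2 z) := by
  have := isProbabilityMeasure_cond_latticeCell (d := d) hL
  refine Filter.Eventually.and ?_ ?_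
  · exact Measure.quasiMeasurePreserving_fst.ae (ae_cond_mem (measurableSet_latticeCell d L))
  · have h : ∀ᵐ ω ∂(Measure.infinitePi fun _ : Fin d → ℤ => Λ), ∀ z, G (ω z) :=
      ae_all_iff.2 fun z => (measurePreserving_eval_infinitePi (fun _ : Fin d → ℤ => Λ)
        z).quasiMeasurePreserving.ae hG
    exact Measure.quasiMeasurePreserving_snd.ae h

/-- The mean number of points of the lattice process in a cell. -/
lemma lintegral_latticeProcess_latticeCell {L : ℝ} (hL : 0 < L) (Λ : Measure (CellData d N))
    [IsProbabilityMeasure Λ] :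
    ∫⁻ C, C (latticeCell d L) ∂(latticeProcess L Λ) = N * Λ {x | x.1 = true} := by
  have := isProbabilityMeasure_cond_latticeCell (d := d) hL
  have hS := measurableSet_latticeCell d L
  have hm := measurable_latticeConfig (d := d) (N := N) L
  have hmC := Measure.measurable_coe (α := EuclideanSpace ℝ (Fin d)) hS
  set A := latticeCell d L with hA
  have hcell : ∀ v : EuclideanSpace ℝ (Fin d), Measurable fun x : CellData d N =>
      if x.1 then ∑ i, A.indicator (1 : EuclideanSpace ℝ (Fin d) → ℝ≥0∞) (x.2 i + v) else 0 := by
    intro v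
    simp only [← cellConfig_map_add_apply _ _ hS]
    exact hmC.comp (measurable_cellConfig_map_add.comp measurable_prodMk_left)
  have hfix : ∀ u, ∫⁻ ω, latticeConfig L u ω A ∂(Measure.infinitePi fun _ : Fin d → ℤ => Λ) =
      N * Λ {x | x.1 = true} := by
    intro u
    simp only [latticeConfig_apply L _ _ hS]
    have h0 : ∀ z, Measurable fun ω : (Fin d → ℤ) → CellData d N => if (ω z).1 then ∑ i,
        A.indicator (1 : EuclideanSpace ℝ (Fin d) → ℝ≥0∞) ((ω z).2 i + (latticeShift L z + u))
        else 0 := fun z => (hcell _).comp (measurable_pi_apply z)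
    rw [lintegral_tsum fun z => (h0 z).aemeasurable]
    have h1 : ∀ z, ∫⁻ ω : (Fin d → ℤ) → CellData d N, (if (ω z).1 then ∑ i, A.indicator
          (1 : EuclideanSpace ℝ (Fin d) → ℝ≥0∞) ((ω z).2 i + (latticeShift L z + u)) else 0)
          ∂(Measure.infinitePi fun _ : Fin d → ℤ => Λ) =
        ∫⁻ x : CellData d N, (if x.1 then ∑ i, A.indicator
          (1 : EuclideanSpace ℝ (Fin d) → ℝ≥0∞) (x.2 i + (latticeShift L z + u)) else 0) ∂Λ :=
      fun z => (measurePreserving_eval_infinitePi (fun _ : Fin d → ℤ => Λ) z).lintegral_comp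
        (hcell (latticeShift L z + u))
    rw [tsum_congr h1, ← lintegral_tsum fun z => (hcell _).aemeasurable]
    have h2 : ∀ x : CellData d N, (∑' z, if x.1 then ∑ i, A.indicator
          (1 : EuclideanSpace ℝ (Fin d) → ℝ≥0∞) (x.2 i + (latticeShift L z + u)) else 0) =
        {x : CellData d N | x.1 = true}.indicator (fun _ => (N : ℝ≥0∞)) x := by
      intro x
      by_cases hx : x.1 = true
      · simp only [hx, if_true]
        rw [Summable.tsum_finsetSum fun i _ => ENNReal.summable,
          indicator_of_mem (by exact hx)]
        have h3 : ∀ i, ∑' z, A.indicator (1 : EuclideanSpace ℝ (Fin d) → ℝ≥0∞)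
            (x.2 i + (latticeShift L z + u)) = 1 := by
          intro i
          obtain ⟨z₀, hz₀⟩ := exists_unique_add_latticeShift_mem hL (x.2 i + u)
          have h4 : ∀ z, x.2 i + (latticeShift L z + u) = x.2 i + u + latticeShift L z :=
            fun z => by abel
          rw [tsum_eq_single z₀]
          · rw [h4, indicator_of_mem ((hz₀ z₀).2 rfl)]; rfl
          · intro z hz
            rw [h4, indicator_of_notMem fun h => hz ((hz₀ z).1 h)]
        simp [h3]
      · have : x ∉ {x : CellData d N | x.1 = true} := hx
        simp [hx]
    have hms : MeasurableSet {x : CellData d N | x.1 = true} :=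
      measurable_fst (measurableSet_singleton true)
    rw [lintegral_congr h2, lintegral_indicator_const hms]
  rw [latticeProcess, lintegral_map hmC hm]
  refine (lintegral_prod _ (hmC.comp hm).aemeasurable).trans ?_
  simp only [Function.comp_apply]
  rw [lintegral_congr hfix]
  simp

/-- The lattice process is a stationary point process of intensity (mean number of points in a
cell) / (volume of a cell). -/
lemma latticeProcess_mem_stationaryLaws {L : ℝ} (hL : 0 < L) (Λ : Measure (CellData d N))
    [IsProbabilityMeasure Λ] (hΛ : ∀ᵐ x ∂Λ, ∀ i a, x.2 i a ∈ Icc 0 L) {m : ℝ≥0}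
    (hm : (m : ℝ≥0∞) * ENNReal.ofReal (L ^ d) = N * Λ {x | x.1 = true}) :
    latticeProcess L Λ ∈ stationaryLaws d m := by
  have hstat := latticeProcess_map_sub hL Λ
  refine ⟨isProbabilityMeasure_latticeProcess hL Λ, ?_, hstat, ?_⟩
  · rw [latticeProcess, ae_map_iff (measurable_latticeConfig L).aemeasurable
      measurableSet_isPointConfig]
    filter_upwards [ae_prod_latticeCell hL hΛ] with w hw
    exact isPointConfig_latticeConfig hL hw.1 hw.2
  · have hcell := lintegral_latticeProcess_latticeCell hL Λ
    obtain ⟨r, hr⟩ := exists_lintegral_apply_eq_mul_volume hstat (measurableSet_latticeCell d L)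
      (interior_latticeCell_nonempty d hL)
      (by rw [hcell, ← hm]; exact ENNReal.mul_ne_top ENNReal.coe_ne_top ENNReal.ofReal_ne_top)
    have h1 := hr _ (measurableSet_latticeCell d L)
    rw [hcell, ← hm, volume_latticeCell d hL.le,
      ENNReal.mul_left_inj (by simp; positivity) ENNReal.ofReal_ne_top] at h1
    rw [hr _ (measurableSet_cube d 1), volume_cube d zero_le_one, h1]
    simp

/-- An upper bound along the cubes of side `2 n L` is enough to bound a thermodynamic lower
limit. -/
lemma liminf_div_le_of_forall_nat {f : ℝ → ℝ≥0∞} {L : ℝ} (hL : 0 < L) {K : ℝ≥0∞}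
    (h : ∀ n : ℕ, f (2 * n * L) ≤ (2 * n + 3 : ℝ≥0∞) ^ d * K) :
    liminf (fun R : ℝ => f R / ENNReal.ofReal (R ^ d)) atTop ≤ K / ENNReal.ofReal (L ^ d) := by
  have htend : Tendsto (fun n : ℕ => 2 * (n : ℝ) * L) atTop atTop :=
    (tendsto_natCast_atTop_atTop.const_mul_atTop two_pos).atTop_mul_const hL
  have hlim : Tendsto (fun n : ℕ => ENNReal.ofReal ((1 + (3 / 2) / (n : ℝ)) ^ d) *
      (K / ENNReal.ofReal (L ^ d))) atTop (𝓝 (K / ENNReal.ofReal (L ^ d))) := by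
    have h1 : Tendsto (fun n : ℕ => (1 + (3 / 2) / (n : ℝ)) ^ d) atTop (𝓝 1) := by
      simpa using ((tendsto_const_div_atTop_nhds_zero_nat (3 / 2 : ℝ)).const_add 1).pow d
    have h2 := ENNReal.Tendsto.mul_const (b := K / ENNReal.ofReal (L ^ d))
      (ENNReal.tendsto_ofReal h1) (Or.inl (by simp))
    simpa using h2
  calc liminf (fun R : ℝ => f R / ENNReal.ofReal (R ^ d)) atTop
      ≤ liminf (fun R : ℝ => f R / ENNReal.ofReal (R ^ d))
          (map (fun n : ℕ => 2 * (n : ℝ) * L) atTop) := liminf_le_liminf_of_le htend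
    _ = liminf (fun n : ℕ => f (2 * n * L) / ENNReal.ofReal ((2 * n * L) ^ d)) atTop := by
        simp only [liminf, limsInf, map_map]; rfl
    _ ≤ liminf (fun n : ℕ => ENNReal.ofReal ((1 + (3 / 2) / (n : ℝ)) ^ d) *
          (K / ENNReal.ofReal (L ^ d))) atTop := by
        refine liminf_le_liminf ?_
        filter_upwards [eventually_gt_atTop 0] with n hn
        have hn' : (0 : ℝ) < n := by exact_mod_cast hn
        have h3 : (2 * n + 3 : ℝ≥0∞) = ENNReal.ofReal (2 * n) * ENNReal.ofReal
            (1 + (3 / 2) / (n : ℝ)) := by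
          rw [← ENNReal.ofReal_mul (by positivity)]
          have : 2 * (n : ℝ) * (1 + (3 / 2) / (n : ℝ)) = ((2 * n + 3 : ℕ) : ℝ) := by
            push_cast; field_simp
          rw [this, ENNReal.ofReal_natCast]
          push_cast; rfl
        calc f (2 * n * L) / ENNReal.ofReal ((2 * n * L) ^ d)
            ≤ ((2 * n + 3 : ℝ≥0∞) ^ d * K) / ENNReal.ofReal ((2 * n * L) ^ d) := by
              gcongr; exact h n
          _ = _ := by
              rw [h3, mul_pow (ENNReal.ofReal _), mul_pow (2 * (n : ℝ)),
                ENNReal.ofReal_mul (p := (2 * (n : ℝ)) ^ d) (by positivity),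
                ← ENNReal.ofReal_pow (by positivity), ← ENNReal.ofReal_pow (by positivity),
                mul_assoc]
              exact (ENNReal.mul_div_mul_left _ _
                (ENNReal.ofReal_pos.2 (by positivity)).ne'
                ENNReal.ofReal_ne_top).trans (mul_div_assoc _ _ _)
    _ = _ := hlim.liminf_eq

lemma rieszEnergy_latticeProcess_le {s L g : ℝ} (hs : 0 < s) (hg : 0 < g) (hgL : 2 * g ≤ L)
    (Λ : Measure (CellData d N)) [IsProbabilityMeasure Λ] {e : ℝ≥0∞}
    (hΛ : ∀ᵐ x ∂Λ, (∀ i a, x.2 i a ∈ Icc g (L - g)) ∧ tupleEnergy s x.2 ≤ e) :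
    rieszEnergy s (latticeProcess L Λ) ≤
      (e + N * (N * (ENNReal.ofReal (2 * g) ^ (-s) * latticeSum d s))) /
        ENNReal.ofReal (L ^ d) := by
  have hL : 0 < L := by linarith
  have := isProbabilityMeasure_cond_latticeCell (d := d) hL
  refine liminf_div_le_of_forall_nat hL fun n => ?_
  refine (lintegral_map_le _ _).trans ?_
  refine (lintegral_mono_ae (g := fun _ => (2 * n + 3 : ℝ≥0∞) ^ d *
    (e + N * (N * (ENNReal.ofReal (2 * g) ^ (-s) * latticeSum d s)))) ?_).trans (by simp)
  filter_upwards [ae_prod_latticeCell hL hΛ] with w hw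
  exact rieszInteraction_latticeConfig_le hs hg hgL n hw.1 (fun z => (hw.2 z).1)
    fun z => (hw.2 z).2

/-- The translate of the half-open cell which is attached to the lattice point `z`. -/
def shiftedCell (L : ℝ) (u : EuclideanSpace ℝ (Fin d)) (z : Fin d → ℤ) :
    Set (EuclideanSpace ℝ (Fin d)) :=
  (fun y => y - (latticeShift L z + u)) ⁻¹' latticeCell d L

lemma measurableSet_shiftedCell (L : ℝ) (u : EuclideanSpace ℝ (Fin d)) (z : Fin d → ℤ) :
    MeasurableSet (shiftedCell L u z) :=
  (measurableSet_latticeCell d L).preimage (by fun_prop)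

lemma mem_shiftedCell_iff {L : ℝ} (hL : 0 < L) {u y : EuclideanSpace ℝ (Fin d)}
    (hy : y ∈ latticeCell d L) {z z' : Fin d → ℤ} :
    y + (latticeShift L z + u) ∈ shiftedCell L u z' ↔ z = z' := by
  obtain ⟨z₀, hz₀⟩ := exists_unique_add_latticeShift_mem hL y
  have h0 : (0 : Fin d → ℤ) = z₀ := (hz₀ 0).1 (by
    have : latticeShift (d := d) L 0 = 0 := by ext a; simp
    rwa [this, add_zero])
  have h1 : y + (latticeShift L z + u) - (latticeShift L z' + u) = y + latticeShift L (z - z') := by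
    ext a
    simp
    ring
  rw [shiftedCell, mem_preimage, h1, hz₀, ← h0, sub_eq_zero]

lemma restrict_shiftedCell (L : ℝ) (u : EuclideanSpace ℝ (Fin d)) (z : Fin d → ℤ) :
    (volume.restrict (latticeCell d L)).map (fun p => p + (latticeShift L z + u)) =
      volume.restrict (shiftedCell L u z) := by
  have h := (measurePreserving_add_right (volume : Measure (EuclideanSpace ℝ (Fin d)))
    (latticeShift L z + u)).restrict_preimage (measurableSet_shiftedCell L u z)
  have hpre : (fun p => p + (latticeShift L z + u)) ⁻¹' shiftedCell L u z = latticeCell d L := by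
    ext p; simp [shiftedCell]
  rw [hpre] at h
  exact h.map_eq

lemma pairwiseDisjoint_shiftedCell {L : ℝ} (hL : 0 < L) (u : EuclideanSpace ℝ (Fin d)) :
    Pairwise (Function.onFun Disjoint (shiftedCell L u)) := by
  intro z z' hz
  refine Set.disjoint_left.2 fun y h1 h2 => hz ?_
  have h3 : y = (y - (latticeShift L z + u)) + (latticeShift L z + u) := by abel
  rw [h3] at h2
  exact (mem_shiftedCell_iff hL h1).1 h2

lemma cube_subset_biUnion_shiftedCell {L : ℝ} (hL : 0 < L) (n : ℕ)
    {u : EuclideanSpace ℝ (Fin d)} (hu : u ∈ latticeCell d L) :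
    cube d (2 * n * L) ⊆ ⋃ z ∈ latticeWindow d n, shiftedCell L u z := by
  intro y hy
  obtain ⟨z₀, hz₀⟩ := exists_unique_add_latticeShift_mem hL (y - u)
  have h1 := (hz₀ z₀).2 rfl
  have h2 : y - (latticeShift L (-z₀) + u) = y - u + latticeShift L z₀ := by
    ext a; simp; ring
  have h3 : y - u + latticeShift L z₀ + (latticeShift L (-z₀) + u) = y := by
    rw [← h2]; abel
  refine mem_iUnion₂.2 ⟨-z₀, mem_latticeWindow hL (fun a => Ico_subset_Icc_self (h1 a)) hu ?_, ?_⟩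
  · rw [h3]; exact hy
  · rw [shiftedCell, mem_preimage, h2]; exact h1

/-- The contents of a finite family of cells. -/
lemma latticeConfig_restrict_biUnion {L : ℝ} (hL : 0 < L) (u : EuclideanSpace ℝ (Fin d))
    {ω : (Fin d → ℤ) → CellData d N} (hω : ∀ z i, (ω z).2 i ∈ latticeCell d L)
    (W : Finset (Fin d → ℤ)) :
    (latticeConfig L u ω).restrict (⋃ z ∈ W, shiftedCell L u z) =
      ∑ z ∈ W, (cellConfig (ω z)).map fun p => p + (latticeShift L z + u) := by
  have hA : MeasurableSet (⋃ z ∈ W, shiftedCell L u z) :=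
    W.measurableSet_biUnion fun z _ => measurableSet_shiftedCell L u z
  have hmem : ∀ z i, (ω z).2 i + (latticeShift L z + u) ∈ ⋃ z ∈ W, shiftedCell L u z ↔ z ∈ W := by
    intro z i
    simp only [mem_iUnion₂, mem_shiftedCell_iff hL (hω z i), exists_prop, exists_eq_right']
  ext S hS
  rw [Measure.restrict_apply hS, latticeConfig_apply L u ω (hS.inter hA), Measure.coe_finsetSum,
    Finset.sum_apply, tsum_eq_sum (s := W)]
  · refine Finset.sum_congr rfl fun z hz => ?_
    rw [cellConfig_map_add_apply _ _ hS]
    split_ifs with h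
    · refine Finset.sum_congr rfl fun i _ => ?_
      by_cases h1 : (ω z).2 i + (latticeShift L z + u) ∈ S
      · rw [indicator_of_mem h1, indicator_of_mem (mem_inter h1 ((hmem z i).2 hz))]
      · rw [indicator_of_notMem h1, indicator_of_notMem fun h2 => h1 h2.1]
    · rfl
  · intro z hz
    split_ifs with h
    · exact Finset.sum_eq_zero fun i _ =>
        indicator_of_notMem (fun h2 => hz ((hmem z i).1 h2.2)) _
    · rfl

lemma poissonPart_zero {X : Type*} [MeasurableSpace X] (m : Measure X) :
    poissonPart m 0 = Measure.dirac 0 := by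
  simp [poissonPart, sumDiracLaw]

lemma poissonOf_zero {X : Type*} [MeasurableSpace X] :
    poissonOf (0 : Measure X) = Measure.dirac 0 := by
  have h0 : poissonPart (0 : Measure X) 0 = Measure.dirac 0 := poissonPart_zero _
  have h1 : ∀ n, n ≠ 0 → poissonPart (0 : Measure X) n = 0 := by
    intro n hn
    have h2 : sumDiracLaw (0 : Measure X) n = 0 := by
      rw [← Measure.measure_univ_eq_zero, sumDiracLaw_univ]
      simp [hn]
    rw [poissonPart, h2, smul_zero]
  rw [poissonOf]
  ext S hS
  rw [Measure.smul_apply, Measure.sum_apply _ hS, tsum_eq_single 0 fun n hn => by rw [h1 n hn]; rfl,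
    h0]
  simp

/-- The entropy of independent cells is additive. -/
lemma klDiv_sum_cells_le {L : ℝ} (hL : 0 < L) (u : EuclideanSpace ℝ (Fin d))
    (Λ : Measure (CellData d N)) [IsProbabilityMeasure Λ] (W : Finset (Fin d → ℤ)) :
    InformationTheory.klDiv ((Measure.infinitePi fun _ : Fin d → ℤ => Λ).map
        (∑ z ∈ W, fun ω : (Fin d → ℤ) → CellData d N =>
          (cellConfig (ω z)).map fun p => p + (latticeShift L z + u)))
        (poissonOf (volume.restrict (⋃ z ∈ W, shiftedCell L u z))) ≤
      W.card * InformationTheory.klDiv (Λ.map cellConfig)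
        (poissonOf (volume.restrict (latticeCell d L))) := by
  classical
  set Q := Measure.infinitePi fun _ : Fin d → ℤ => Λ with hQ
  have hfin0 : IsFiniteMeasure ((volume : Measure (EuclideanSpace ℝ (Fin d))).restrict
      (latticeCell d L)) := ⟨by simpa using (volume_latticeCell_ne_top d hL.le).lt_top⟩
  have hfin : ∀ z, IsFiniteMeasure ((volume : Measure (EuclideanSpace ℝ (Fin d))).restrict
      (shiftedCell L u z)) := fun z => by
    rw [← restrict_shiftedCell]; infer_instance
  have hcm : ∀ v : EuclideanSpace ℝ (Fin d), Measurable fun x : CellData d N =>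
      (cellConfig x).map fun p => p + v := fun v =>
    measurable_cellConfig_map_add.comp measurable_prodMk_left
  have hc0 : Measurable (cellConfig (d := d) (N := N)) := by
    have := hcm 0
    simpa using this
  have hY : ∀ z, Measurable fun ω : (Fin d → ℤ) → CellData d N =>
      (cellConfig (ω z)).map fun p => p + (latticeShift L z + u) := fun z =>
    (hcm _).comp (measurable_pi_apply z)
  have hind : iIndepFun (fun z (ω : (Fin d → ℤ) → CellData d N) =>
      (cellConfig (ω z)).map fun p => p + (latticeShift L z + u)) Q :=
    iIndepFun_infinitePi (P := fun _ : Fin d → ℤ => Λ)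
      (X := fun z x => (cellConfig x).map fun p => p + (latticeShift L z + u)) fun z => hcm _
  have hone : ∀ z, InformationTheory.klDiv (Q.map fun ω : (Fin d → ℤ) → CellData d N =>
      (cellConfig (ω z)).map fun p => p + (latticeShift L z + u))
        (poissonOf (volume.restrict (shiftedCell L u z))) ≤
      InformationTheory.klDiv (Λ.map cellConfig)
        (poissonOf (volume.restrict (latticeCell d L))) := by
    intro z
    have hmt : Measurable fun C : Measure (EuclideanSpace ℝ (Fin d)) =>
        C.map fun p => p + (latticeShift L z + u) := Measure.measurable_map _ (by fun_prop)
    have h1 : (Q.map fun ω : (Fin d → ℤ) → CellData d N =>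
        (cellConfig (ω z)).map fun p => p + (latticeShift L z + u)) =
        (Λ.map cellConfig).map fun C => C.map fun p => p + (latticeShift L z + u) := by
      rw [Measure.map_map hmt hc0,
        ← (measurePreserving_eval_infinitePi (fun _ : Fin d → ℤ => Λ) z).map_eq,
        Measure.map_map (hmt.comp hc0) (measurable_pi_apply z)]
      rfl
    rw [h1, ← restrict_shiftedCell, ← poissonOf_map _ (by fun_prop)]
    have : IsProbabilityMeasure (Λ.map cellConfig) :=
      Measure.isProbabilityMeasure_map hc0.aemeasurable
    exact InformationTheory.klDiv_map_le _ _ hmt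
  induction W using Finset.induction_on with
  | empty =>
    have : (fun _ : (Fin d → ℤ) → CellData d N => (0 : Measure (EuclideanSpace ℝ (Fin d)))) = 0 :=
      rfl
    have h0 : poissonOf (0 : Measure (EuclideanSpace ℝ (Fin d))) = Measure.dirac 0 :=
      poissonOf_zero
    simp only [Finset.sum_empty, ← this, Measure.map_const]
    simp [h0]
  | insert a W ha ih =>
    rw [Finset.sum_insert ha, Finset.set_biUnion_insert, Finset.card_insert_of_notMem ha]
    have hdis : Disjoint (shiftedCell L u a) (⋃ z ∈ W, shiftedCell L u z) := by
      refine Set.disjoint_iUnion₂_right.2 fun z hz => pairwiseDisjoint_shiftedCell hL u ?_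
      rintro rfl
      exact ha hz
    have hmW : Measurable (∑ z ∈ W, fun ω : (Fin d → ℤ) → CellData d N =>
        (cellConfig (ω z)).map fun p => p + (latticeShift L z + u)) :=
      Finset.sum_induction _ Measurable (fun _ _ => Measurable.add) measurable_const
        fun z _ => hY z
    have hfW : IsFiniteMeasure ((volume : Measure (EuclideanSpace ℝ (Fin d))).restrict
        (⋃ z ∈ W, shiftedCell L u z)) := by
      refine ⟨?_⟩
      rw [Measure.restrict_apply_univ]
      refine measure_biUnion_lt_top W.finite_toSet fun z _ => ?_
      have := (hfin z).measure_univ_lt_top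
      rwa [Measure.restrict_apply_univ] at this
    rw [Measure.restrict_union hdis (W.measurableSet_biUnion fun z _ =>
        measurableSet_shiftedCell L u z), poissonOf_add,
      IndepFun.map_add_eq_map_conv_map (hY a) hmW
        (hind.indepFun_finsetSum_of_notMem hY ha).symm]
    have i1 := Measure.isProbabilityMeasure_map (μ := Q) (hY a).aemeasurable
    have i2 := Measure.isProbabilityMeasure_map (μ := Q) hmW.aemeasurable
    refine klDiv_conv_le.trans ((add_le_add (hone a) ih).trans (le_of_eq ?_))
    push_cast
    ring

lemma measurable_latticeConfig_right (L : ℝ) (u : EuclideanSpace ℝ (Fin d)) :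
    Measurable (latticeConfig (N := N) L u) :=
  (measurable_latticeConfig (d := d) (N := N) L).of_uncurry_left

/-- For a fixed shift of the lattice: enlarge the cube to a union of cells, and add up the entropies
of the cells. -/
lemma windowEntropy_latticeConfig_le {L : ℝ} (hL : 0 < L) (n : ℕ)
    {u : EuclideanSpace ℝ (Fin d)} (hu : u ∈ latticeCell d L) (Λ : Measure (CellData d N))
    [IsProbabilityMeasure Λ] (hΛ : ∀ᵐ x ∂Λ, ∀ i, x.2 i ∈ latticeCell d L) :
    InformationTheory.klDiv ((Measure.infinitePi fun _ : Fin d → ℤ => Λ).map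
        fun ω => (latticeConfig L u ω).restrict (cube d (2 * n * L)))
        (poissonLaw (cube d (2 * n * L))) ≤
      (2 * n + 3 : ℝ≥0∞) ^ d * InformationTheory.klDiv (Λ.map cellConfig)
        (poissonOf (volume.restrict (latticeCell d L))) := by
  have hBm : MeasurableSet (cube d (2 * n * L)) := measurableSet_cube d _
  have hmu : Measurable fun ω : (Fin d → ℤ) → CellData d N => latticeConfig L u ω :=
    measurable_latticeConfig_right L u
  have ip := Measure.isProbabilityMeasure_map
    (μ := Measure.infinitePi fun _ : Fin d → ℤ => Λ) hmu.aemeasurable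
  have hAm : MeasurableSet (⋃ z ∈ latticeWindow d n, shiftedCell L u z) :=
    (latticeWindow d n).measurableSet_biUnion fun z _ => measurableSet_shiftedCell L u z
  have hAv : volume (⋃ z ∈ latticeWindow d n, shiftedCell L u z) ≠ ∞ := by
    refine (measure_biUnion_lt_top (latticeWindow d n).finite_toSet fun z _ => ?_).ne
    rw [← Measure.restrict_apply_univ, ← restrict_shiftedCell,
      Measure.map_apply (by fun_prop) MeasurableSet.univ, preimage_univ,
      Measure.restrict_apply_univ]
    exact (volume_latticeCell_ne_top d hL.le).lt_top
  have h1 := windowEntropy_mono ((Measure.infinitePi fun _ : Fin d → ℤ => Λ).map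
    fun ω => latticeConfig L u ω) hBm hAm (cube_subset_biUnion_shiftedCell hL n hu) hAv
  rw [windowEntropy, Measure.map_map (measurable_measure_restrict hBm) hmu] at h1
  refine h1.trans ?_
  rw [windowEntropy, Measure.map_map (measurable_measure_restrict hAm) hmu,
    poissonLaw_eq_poissonOf]
  have h3 : ∀ᵐ ω ∂(Measure.infinitePi fun _ : Fin d → ℤ => Λ), ∀ z i,
      (ω z).2 i ∈ latticeCell d L := ae_all_iff.2 fun z =>
    (measurePreserving_eval_infinitePi (fun _ : Fin d → ℤ => Λ) z).quasiMeasurePreserving.ae hΛ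
  have h4 := Measure.map_congr (mβ := Measure.instMeasurableSpace) (h3.mono fun ω hω => show
    ((fun C : Measure (EuclideanSpace ℝ (Fin d)) =>
        C.restrict (⋃ z ∈ latticeWindow d n, shiftedCell L u z)) ∘
          fun ω => latticeConfig L u ω) ω =
      (∑ z ∈ latticeWindow d n, fun ω : (Fin d → ℤ) → CellData d N =>
          (cellConfig (ω z)).map fun p => p + (latticeShift L z + u)) ω by
    rw [Finset.sum_apply]
    exact latticeConfig_restrict_biUnion hL u hω _)
  rw [h4]
  refine (klDiv_sum_cells_le hL u Λ (latticeWindow d n)).trans (le_of_eq ?_)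
  rw [card_latticeWindow]
  push_cast
  rfl

lemma specificEntropy_latticeProcess_le {L : ℝ} (hL : 0 < L) (Λ : Measure (CellData d N))
    [IsProbabilityMeasure Λ] (hΛ : ∀ᵐ x ∂Λ, ∀ i, x.2 i ∈ latticeCell d L)
    (hfin : InformationTheory.klDiv (Λ.map cellConfig)
        (poissonOf (volume.restrict (latticeCell d L))) ≠ ∞) :
    specificEntropy (latticeProcess L Λ) ≤ InformationTheory.klDiv (Λ.map cellConfig)
        (poissonOf (volume.restrict (latticeCell d L))) / ENNReal.ofReal (L ^ d) := by
  have := isProbabilityMeasure_cond_latticeCell (d := d) hL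
  refine liminf_div_le_of_forall_nat hL fun n => ?_
  have hr := measurable_measure_restrict (measurableSet_cube d (2 * n * L))
  have hm := measurable_latticeConfig (d := d) (N := N) L
  have := isProbabilityMeasure_poissonLaw (volume_cube_ne_top d (2 * n * L))
  rw [latticeProcess, Measure.map_map hr hm]
  refine klDiv_map_prod_le (hr.comp hm)
    (ENNReal.mul_ne_top (ENNReal.pow_ne_top (by finiteness)) hfin) ?_
  filter_upwards [ae_cond_mem (measurableSet_latticeCell d L)] with u hu
  exact windowEntropy_latticeConfig_le hL n hu Λ hΛ

end LatticeAverages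

/-! ### Cells with finitely many independent points -/

section CellLaw

variable {d N : ℕ}

/-- The law of the content of a cell: with probability `p` there are independent points uniform in
the sets `B i`, with probability `q` the cell is empty. -/
noncomputable def cellLaw (q p : ℝ≥0) (B : Fin N → Set (EuclideanSpace ℝ (Fin d))) :
    Measure (CellData d N) :=
  (q • Measure.dirac false + p • Measure.dirac true).prod
    (Measure.pi fun i => volume[|B i])

lemma isProbabilityMeasure_switch {q p : ℝ≥0} (hqp : q + p = 1) :
    IsProbabilityMeasure (q • Measure.dirac false + p • Measure.dirac true : Measure Bool) := by
  refine ⟨?_⟩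
  simp only [Measure.coe_add, Pi.add_apply, Measure.smul_apply, measure_univ, smul_eq_mul,
    ENNReal.smul_def, mul_one]
  exact_mod_cast hqp

lemma cellLaw_map_cellConfig {q p : ℝ≥0} {B : Fin N → Set (EuclideanSpace ℝ (Fin d))}
    (hB0 : ∀ i, volume (B i) ≠ 0) (hBt : ∀ i, volume (B i) ≠ ∞) :
    (cellLaw q p B).map cellConfig = q • Measure.dirac 0 +
      p • (Measure.pi fun i => volume[|B i]).map fun x => ∑ i, Measure.dirac (x i) := by
  have hi : ∀ i, IsProbabilityMeasure (volume[|B i]) := fun i =>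
    cond_isProbabilityMeasure_of_finite (hB0 i) (hBt i)
  have hc0 : Measurable (cellConfig (d := d) (N := N)) := by
    have : Measurable fun x : CellData d N =>
        (cellConfig x).map fun p : EuclideanSpace ℝ (Fin d) => p + 0 :=
      measurable_cellConfig_map_add.comp measurable_prodMk_left
    simpa using this
  rw [cellLaw, Measure.add_prod, Measure.map_add _ _ hc0]
  simp only [ENNReal.smul_def]
  rw [Measure.prod_smul_left, Measure.prod_smul_left, Measure.map_smul, Measure.map_smul,
    Measure.dirac_prod, Measure.dirac_prod, Measure.map_map hc0 measurable_prodMk_left,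
    Measure.map_map hc0 measurable_prodMk_left]
  congr 2
  have : (cellConfig ∘ Prod.mk false : (Fin N → EuclideanSpace ℝ (Fin d)) → _) = fun _ => 0 := by
    ext1 x; simp [cellConfig]
  rw [this, Measure.map_const]
  simp

lemma ae_cellLaw {q p : ℝ≥0} (hqp : q + p = 1) {B : Fin N → Set (EuclideanSpace ℝ (Fin d))}
    (hB : ∀ i, MeasurableSet (B i)) (hB0 : ∀ i, volume (B i) ≠ 0) (hBt : ∀ i, volume (B i) ≠ ∞) :
    ∀ᵐ x ∂(cellLaw q p B), ∀ i, x.2 i ∈ B i := by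
  have hi : ∀ i, IsProbabilityMeasure (volume[|B i]) := fun i =>
    cond_isProbabilityMeasure_of_finite (hB0 i) (hBt i)
  have := isProbabilityMeasure_switch hqp
  have h : ∀ᵐ x ∂(Measure.pi fun i => volume[|B i]), ∀ i, x i ∈ B i :=
    ae_all_iff.2 fun i => (Measure.quasiMeasurePreserving_eval
      (μ := fun i => volume[|B i]) i).ae (ae_cond_mem (hB i))
  exact Measure.quasiMeasurePreserving_snd.ae h

lemma pi_cond_eq {B : Fin N → Set (EuclideanSpace ℝ (Fin d))} (hB : ∀ i, MeasurableSet (B i))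
    (hB0 : ∀ i, volume (B i) ≠ 0) (hBt : ∀ i, volume (B i) ≠ ∞) :
    (∏ i, volume (B i)) • Measure.pi (fun i => volume[|B i]) =
      (Measure.pi fun _ : Fin N => (volume : Measure (EuclideanSpace ℝ (Fin d)))).restrict
        (univ.pi B) := by
  have hi : ∀ i, IsProbabilityMeasure (volume[|B i]) := fun i =>
    cond_isProbabilityMeasure_of_finite (hB0 i) (hBt i)
  rw [Measure.restrict_pi_pi]
  refine (Measure.pi_eq fun S hS => ?_).symm
  rw [Measure.smul_apply, Measure.pi_pi, smul_eq_mul, ← Finset.prod_mul_distrib]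
  refine Finset.prod_congr rfl fun i _ => ?_
  rw [cond_apply (hB i), ← mul_assoc, ENNReal.mul_inv_cancel (hB0 i) (hBt i), one_mul,
    Measure.restrict_apply (hS i), inter_comm]

/-- The relative entropy of the content of a cell: it suffices to compare with the restriction of
the Poisson law to configurations with `0` or `N` points. -/
lemma klDiv_cellLaw_le {L : ℝ} (hL : 0 < L) (hN : N ≠ 0) {q p : ℝ≥0} (hqp : q + p = 1)
    {B : Fin N → Set (EuclideanSpace ℝ (Fin d))} (hB : ∀ i, MeasurableSet (B i))
    (hB0 : ∀ i, volume (B i) ≠ 0) (hBL : ∀ i, B i ⊆ latticeCell d L) {a₁ a₂ : ℝ≥0} (h1 : 0 < a₁)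
    (h2 : 0 < a₂) (ha₁ : (a₁ : ℝ≥0∞) ≤ ENNReal.ofReal (Real.exp (-L ^ d)))
    (ha₂ : (a₂ : ℝ≥0∞) ≤ ENNReal.ofReal (Real.exp (-L ^ d)) * ((N.factorial : ℝ≥0∞)⁻¹ *
      ∏ i, volume (B i))) :
    InformationTheory.klDiv ((cellLaw q p B).map cellConfig)
        (poissonOf (volume.restrict (latticeCell d L))) ≤
      ENNReal.ofReal (q * Real.log (q / a₁) + p * Real.log (p / a₂)) := by
  have hBt : ∀ i, volume (B i) ≠ ∞ := fun i =>
    ne_top_of_le_ne_top (volume_latticeCell_ne_top d hL.le) (measure_mono (hBL i))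
  have hi : ∀ i, IsProbabilityMeasure (volume[|B i]) := fun i =>
    cond_isProbabilityMeasure_of_finite (hB0 i) (hBt i)
  have hfin0 : IsFiniteMeasure ((volume : Measure (EuclideanSpace ℝ (Fin d))).restrict
      (latticeCell d L)) := ⟨by simpa using (volume_latticeCell_ne_top d hL.le).lt_top⟩
  rw [cellLaw_map_cellConfig hB0 hBt]
  have := Measure.isProbabilityMeasure_map (μ := Measure.pi fun i => volume[|B i])
    (measurable_sum_dirac (X := EuclideanSpace ℝ (Fin d)) (n := N)).aemeasurable
  refine klDiv_mixture_le hqp h1 h2 ?_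
  set m := (volume : Measure (EuclideanSpace ℝ (Fin d))).restrict (latticeCell d L) with hm
  have hexp : ENNReal.ofReal (Real.exp (-(m univ).toReal)) =
      ENNReal.ofReal (Real.exp (-L ^ d)) := by
    rw [hm, Measure.restrict_apply_univ, volume_latticeCell d hL.le,
      ENNReal.toReal_ofReal (by positivity)]
  have hpart : ((N.factorial : ℝ≥0∞)⁻¹ * ∏ i, volume (B i)) •
      (Measure.pi fun i => volume[|B i]).map (fun x => ∑ i, Measure.dirac (x i)) ≤
        poissonPart m N := by
    rw [poissonPart, sumDiracLaw, mul_smul, ← Measure.map_smul, pi_cond_eq hB hB0 hBt, hm,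
      ← Measure.restrict_pi_pi]
    refine Measure.le_iff.2 fun S hS => ?_
    rw [Measure.smul_apply, Measure.smul_apply]
    have h := Measure.map_mono (f := fun x : Fin N → EuclideanSpace ℝ (Fin d) =>
      ∑ i, Measure.dirac (x i)) (Measure.restrict_mono (μ := Measure.pi fun _ : Fin N =>
        (volume : Measure (EuclideanSpace ℝ (Fin d)))) (Set.pi_mono (s := univ) fun i _ => hBL i) le_rfl)
        measurable_sum_dirac S
    simp only [smul_eq_mul]
    gcongr
  have htwo : poissonPart m 0 + poissonPart m N ≤ Measure.sum fun n => poissonPart m n := by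
    refine Measure.le_iff.2 fun S hS => ?_
    rw [Measure.sum_apply _ hS, Measure.add_apply]
    refine le_trans (le_of_eq ?_) (ENNReal.sum_le_tsum {0, N})
    rw [Finset.sum_pair hN.symm]
  calc a₁ • Measure.dirac 0 +
        a₂ • (Measure.pi fun i => volume[|B i]).map (fun x => ∑ i, Measure.dirac (x i))
      ≤ ENNReal.ofReal (Real.exp (-L ^ d)) • poissonPart m 0 +
          ENNReal.ofReal (Real.exp (-L ^ d)) • poissonPart m N := by
        refine add_le_add ?_ ?_
        · rw [poissonPart_zero]
          refine Measure.le_iff.2 fun S _ => ?_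
          rw [Measure.smul_apply, Measure.smul_apply, ENNReal.smul_def]
          gcongr
        · refine Measure.le_iff.2 fun S _ => ?_
          have h := hpart S
          rw [Measure.smul_apply, smul_eq_mul] at h
          rw [Measure.smul_apply, Measure.smul_apply, ENNReal.smul_def, smul_eq_mul, smul_eq_mul]
          refine (mul_le_mul_left ha₂ _).trans ?_
          rw [mul_assoc]
          gcongr
    _ ≤ poissonOf m := by
        rw [poissonOf, hexp, ← smul_add]
        gcongr

/-- A stationary process with controlled energy and entropy. In each cell of a randomly shifted
lattice there are, independently and with probability `p`, `N` points which are uniform in the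
given sets `B i`. -/
theorem exists_mem_stationaryLaws_of_cells {s L g : ℝ} (hs : 0 < s) (hg : 0 < g) (hgL : 2 * g ≤ L)
    (hN : N ≠ 0) {q p : ℝ≥0} (hqp : q + p = 1) {B : Fin N → Set (EuclideanSpace ℝ (Fin d))}
    (hB : ∀ i, MeasurableSet (B i)) (hB0 : ∀ i, volume (B i) ≠ 0)
    (hBg : ∀ i, ∀ x ∈ B i, ∀ a, x a ∈ Icc g (L - g)) {e : ℝ≥0∞}
    (he : ∀ x : Fin N → EuclideanSpace ℝ (Fin d), (∀ i, x i ∈ B i) → tupleEnergy s x ≤ e)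
    {a₁ a₂ : ℝ≥0} (h1 : 0 < a₁) (h2 : 0 < a₂)
    (ha₁ : (a₁ : ℝ≥0∞) ≤ ENNReal.ofReal (Real.exp (-L ^ d)))
    (ha₂ : (a₂ : ℝ≥0∞) ≤ ENNReal.ofReal (Real.exp (-L ^ d)) * ((N.factorial : ℝ≥0∞)⁻¹ *
      ∏ i, volume (B i))) {m : ℝ≥0} (hm : (m : ℝ) * L ^ d = N * p) :
    ∃ P ∈ stationaryLaws d m,
      rieszEnergy s P ≤ (e + N * (N * (ENNReal.ofReal (2 * g) ^ (-s) * latticeSum d s))) /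
        ENNReal.ofReal (L ^ d) ∧
      specificEntropy P ≤ ENNReal.ofReal (q * Real.log (q / a₁) + p * Real.log (p / a₂)) /
        ENNReal.ofReal (L ^ d) := by
  have hL : 0 < L := by linarith
  have hBL : ∀ i, B i ⊆ latticeCell d L := fun i x hx a =>
    ⟨hg.le.trans (hBg i x hx a).1, (hBg i x hx a).2.trans_lt (by linarith)⟩
  have hBt : ∀ i, volume (B i) ≠ ∞ := fun i =>
    ne_top_of_le_ne_top (volume_latticeCell_ne_top d hL.le) (measure_mono (hBL i))
  have hi : ∀ i, IsProbabilityMeasure (volume[|B i]) := fun i =>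
    cond_isProbabilityMeasure_of_finite (hB0 i) (hBt i)
  have hsw := isProbabilityMeasure_switch hqp
  have : IsProbabilityMeasure (cellLaw q p B) := by unfold cellLaw; infer_instance
  have hae := ae_cellLaw hqp hB hB0 hBt
  have hkl := klDiv_cellLaw_le hL hN hqp hB hB0 hBL h1 h2 ha₁ ha₂
  refine ⟨latticeProcess L (cellLaw q p B), ?_, ?_, ?_⟩
  · refine latticeProcess_mem_stationaryLaws hL _ ?_ ?_
    · filter_upwards [hae] with x hx i a
      exact Ico_subset_Icc_self (hBL i (hx i) a)
    · have h3 : {x : CellData d N | x.1 = true} = {true} ×ˢ univ := by ext x; simp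
      rw [h3, cellLaw, Measure.prod_prod, measure_univ, mul_one]
      have h4 : (q • Measure.dirac false + p • Measure.dirac true : Measure Bool) {true} = p := by
        rw [Measure.add_apply, Measure.smul_apply, Measure.smul_apply,
          Measure.dirac_apply' _ (measurableSet_singleton _),
          Measure.dirac_apply' _ (measurableSet_singleton _)]
        simp [ENNReal.smul_def]
      have h5 : (m : ℝ≥0∞) = ENNReal.ofReal m := by simp
      rw [h4, h5, ← ENNReal.ofReal_mul (by positivity), hm, ENNReal.ofReal_mul (by positivity)]
      simp
  · refine rieszEnergy_latticeProcess_le hs hg hgL _ ?_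
    filter_upwards [hae] with x hx
    exact ⟨fun i a => hBg i _ (hx i) a, he _ hx⟩
  · refine (specificEntropy_latticeProcess_le hL _ ?_ ?_).trans ?_
    · filter_upwards [hae] with x hx i
      exact hBL i (hx i)
    · exact ne_top_of_le_ne_top ENNReal.ofReal_ne_top hkl
    · gcongr

end CellLaw

/-! ### Processes of small entropy or small energy -/

section Processes

variable {d : ℕ} {s : ℝ}

lemma tupleEnergy_one (x : Fin 1 → EuclideanSpace ℝ (Fin d)) : tupleEnergy s x = 0 := by
  simp [tupleEnergy]

lemma volume_Icc_cell {a b : ℝ} (hab : a ≤ b) :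
    volume {x : EuclideanSpace ℝ (Fin d) | ∀ i, x i ∈ Icc a b} = ENNReal.ofReal ((b - a) ^ d) := by
  have h : {x : EuclideanSpace ℝ (Fin d) | ∀ i, x i ∈ Icc a b} =
      (WithLp.ofLp : EuclideanSpace ℝ (Fin d) → Fin d → ℝ) ⁻¹' (univ.pi fun _ => Icc a b) := by
    ext x; simp only [mem_preimage, mem_univ_pi, mem_ofPred_eq]
  rw [h, (PiLp.volume_preserving_ofLp (Fin d)).measure_preimage
    (MeasurableSet.univ_pi fun _ => measurableSet_Icc).nullMeasurableSet, volume_pi_pi]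
  simp [ENNReal.ofReal_pow (sub_nonneg.2 hab)]

lemma measurableSet_Icc_cell (a b : ℝ) :
    MeasurableSet {x : EuclideanSpace ℝ (Fin d) | ∀ i, x i ∈ Icc a b} := by
  have h : {x : EuclideanSpace ℝ (Fin d) | ∀ i, x i ∈ Icc a b} =
      (WithLp.ofLp : EuclideanSpace ℝ (Fin d) → Fin d → ℝ) ⁻¹' (univ.pi fun _ => Icc a b) := by
    ext x; simp only [mem_preimage, mem_univ_pi, mem_ofPred_eq]
  rw [h]
  exact (PiLp.volume_preserving_ofLp (Fin d)).measurable
    (MeasurableSet.univ_pi fun _ => measurableSet_Icc)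

/-- There are processes of finite energy whose entropy is almost as small as the one of a Poisson
process of the same intensity: keep one point with small probability in each cell of a fine
lattice. -/
lemma exists_specificEntropy_le (hd : 1 ≤ d) (hs : (d : ℝ) < s) (m : ℝ≥0) {ε : ℝ} (hε : 0 < ε) :
    ∃ P ∈ stationaryLaws d (m : ℝ≥0∞), rieszEnergy s P ≠ ∞ ∧
      specificEntropy P ≤ ENNReal.ofReal (m * Real.log m - m + 1 + ε) := by
  have hs0 : 0 < s := (Nat.cast_nonneg d).trans_lt hs
  have hd0 : d ≠ 0 := by omega
  -- `θ` is the proportion of the volume of a cell which is occupied by the set `B`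
  obtain ⟨η, hη0, hη1, hη⟩ : ∃ η : ℝ, 0 < η ∧ η < 1 ∧ -(m * Real.log (η ^ d)) ≤ ε / 2 := by
    have h1 : Tendsto (fun η : ℝ => -((m : ℝ) * Real.log (η ^ d))) (𝓝[<] 1) (𝓝 0) := by
      have : ContinuousAt (fun η : ℝ => -((m : ℝ) * Real.log (η ^ d))) 1 :=
        (ContinuousAt.mul continuousAt_const
          (ContinuousAt.log (by fun_prop) (by simp))).neg
      have h2 := this.tendsto
      simp only [one_pow, Real.log_one, mul_zero, neg_zero] at h2
      exact h2.mono_left nhdsWithin_le_nhds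
    have h3 := h1.eventually (ge_mem_nhds (show (0 : ℝ) < ε / 2 by positivity))
    have h4 : ∀ᶠ η : ℝ in 𝓝[<] 1, η ∈ Ioo (0 : ℝ) 1 := Ioo_mem_nhdsLT one_pos
    obtain ⟨η, h5, h6⟩ := (h3.and h4).exists
    exact ⟨η, h6.1, h6.2, h5⟩
  set θ := η ^ d with hθ
  have hθ0 : 0 < θ := by positivity
  -- the side of the cells: a cell contains a point with probability `m L ^ d`
  obtain ⟨L, hL0, hL1, hL2⟩ : ∃ L : ℝ, 0 < L ∧ m * L ^ d < 1 ∧ m * (m * L ^ d) ≤ ε / 2 := by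
    have h1 : Tendsto (fun L : ℝ => (m : ℝ) * L ^ d) (𝓝[>] 0) (𝓝 0) := by
      have : ContinuousAt (fun L : ℝ => (m : ℝ) * L ^ d) 0 := by fun_prop
      have h2 := this.tendsto
      simp only [zero_pow hd0, mul_zero] at h2
      exact h2.mono_left nhdsWithin_le_nhds
    have h2 := h1.const_mul (m : ℝ)
    rw [mul_zero] at h2
    have h3 := h2.eventually (ge_mem_nhds (show (0 : ℝ) < ε / 2 by positivity))
    have h4 := h1.eventually (gt_mem_nhds (show (0 : ℝ) < 1 by positivity))
    obtain ⟨L, ⟨h5, h6⟩, h7⟩ := ((h3.and h4).and self_mem_nhdsWithin).exists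
    exact ⟨L, h7, h6, h5⟩
  have hLd : 0 < L ^ d := by positivity
  set g := (1 - η) * L / 2 with hg
  have hg0 : 0 < g := by have : 0 < 1 - η := by linarith
                         positivity
  have hgL : L - g - g = η * L := by rw [hg]; ring
  have hηL : 0 < η * L := by positivity
  have hgL2 : 2 * g ≤ L := by linarith
  set p : ℝ≥0 := m * (L ^ d).toNNReal with hp
  have hpr : (p : ℝ) = m * L ^ d := by rw [hp]; simp [hLd.le]
  have hp1 : p < 1 := by rw [← NNReal.coe_lt_coe, hpr]; exact_mod_cast hL1
  set q : ℝ≥0 := 1 - p with hq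
  have hqp : q + p = 1 := tsub_add_cancel_of_le hp1.le
  have hqr : (q : ℝ) = 1 - p := by rw [hq, NNReal.coe_sub hp1.le]; simp
  have hq0 : (0 : ℝ) < q := by rw [hqr]; have : (p : ℝ) < 1 := by exact_mod_cast hp1
                               linarith
  set B : Fin 1 → Set (EuclideanSpace ℝ (Fin d)) := fun _ => {x | ∀ a, x a ∈ Icc g (L - g)} with hB
  have hvol : ∀ i, volume (B i) = ENNReal.ofReal (θ * L ^ d) := by
    intro i
    rw [hB, volume_Icc_cell (by linarith), hgL, mul_pow]
  have hexp := Real.exp_pos (-L ^ d)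
  obtain ⟨P, hP, hW, hent⟩ := exists_mem_stationaryLaws_of_cells (d := d) (s := s) (L := L)
    (g := g) (N := 1) hs0 hg0 hgL2 one_ne_zero hqp (B := B)
    (fun i => measurableSet_Icc_cell _ _) (fun i => by rw [hvol i]; simp; positivity)
    (fun i x hx => hx) (e := 0) (fun x _ => (tupleEnergy_one x).le)
    (a₁ := (Real.exp (-L ^ d)).toNNReal) (a₂ := (Real.exp (-L ^ d) * (θ * L ^ d)).toNNReal)
    (by simpa using hexp) (by rw [Real.toNNReal_pos]; positivity) le_rfl
    (by
      simp only [hvol]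
      simp only [Nat.factorial_one, Nat.cast_one, inv_one, one_mul, Finset.univ_unique,
        Finset.prod_singleton]
      rw [← ENNReal.ofReal_mul hexp.le]; rfl) (m := m) (by rw [hpr]; simp)
  refine ⟨P, hP, ?_, hent.trans ?_⟩
  · refine ne_top_of_le_ne_top (ENNReal.div_ne_top ?_ (by simpa using hLd)) hW
    have h1 : ENNReal.ofReal (2 * g) ^ (-s) ≠ ∞ :=
      ENNReal.rpow_ne_top_of_ne_zero (by simpa using hg0) ENNReal.ofReal_ne_top
    have h2 := latticeSum_ne_top hs
    finiteness
  · rw [← ENNReal.ofReal_div_of_pos hLd]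
    refine ENNReal.ofReal_le_ofReal ?_
    rw [div_le_iff₀ hLd, Real.coe_toNNReal _ hexp.le, Real.coe_toNNReal _ (by positivity)]
    have h1 : (q : ℝ) * Real.log (q / Real.exp (-L ^ d)) ≤ q * (-p + L ^ d) := by
      rw [Real.log_div hq0.ne' hexp.ne', Real.log_exp, sub_neg_eq_add]
      have := Real.log_le_sub_one_of_pos hq0
      refine mul_le_mul_of_nonneg_left ?_ hq0.le
      linarith
    have h2 : (p : ℝ) * Real.log (p / (Real.exp (-L ^ d) * (θ * L ^ d))) =
        p * (Real.log m - Real.log θ + L ^ d) := by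
      rcases eq_or_ne m 0 with hm0 | hm0
      · simp [hp, hm0]
      have hm1 : (0 : ℝ) < m := by positivity
      rw [hpr, Real.log_div (by positivity) (by positivity), Real.log_mul hm1.ne' hLd.ne',
        Real.log_mul hexp.ne' (by positivity), Real.log_mul hθ0.ne' hLd.ne', Real.log_exp]
      ring
    have h3 : (q : ℝ) * (-p + L ^ d) + p * (Real.log m - Real.log θ + L ^ d) =
        (m * Real.log m - m + 1 + m * (m * L ^ d) + -(m * Real.log θ)) * L ^ d := by
      rw [hqr, hpr]; ring
    calc _ ≤ (q : ℝ) * (-p + L ^ d) + p * (Real.log m - Real.log θ + L ^ d) := by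
          rw [h2]; linarith
      _ = _ := h3
      _ ≤ _ := by
          refine mul_le_mul_of_nonneg_right ?_ hLd.le
          linarith

lemma rieszConstant_ne_top (hd : 1 ≤ d) (hs : (d : ℝ) < s) : rieszConstant d s ≠ ∞ := by
  obtain ⟨P, hP, hW, -⟩ := exists_specificEntropy_le hd hs 1 one_pos
  have := rieszConstant_mul_le_rieszEnergy hd hs hP
  simp only [ENNReal.coe_one, ENNReal.one_rpow, mul_one] at this
  exact ne_top_of_le_ne_top hW this

lemma rieszEnergy_eq_zero_of_mem_stationaryLaws_zero
    {P : Measure (Measure (EuclideanSpace ℝ (Fin d)))} (hP : P ∈ stationaryLaws d 0) :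
    rieszEnergy s P = 0 := by
  have h : ∀ R : ℝ, ∫⁻ C, rieszInteraction s (cube d R) C ∂P = 0 := by
    intro R
    have h1 := lintegral_apply_eq_of_mem_stationaryLaws (m := 0) (by simpa using hP)
      (measurableSet_cube d R)
    rw [ENNReal.coe_zero, zero_mul,
      lintegral_eq_zero_iff (Measure.measurable_coe (measurableSet_cube d R))] at h1
    have h2 : (fun C => rieszInteraction s (cube d R) C) =ᵐ[P] fun _ => 0 := by
      filter_upwards [h1] with C hC
      rw [rieszInteraction, Measure.restrict_eq_zero.2 hC]
      simp
    rw [lintegral_congr_ae h2, lintegral_zero]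
  simp [rieszEnergy, h]

lemma continuous_tupleEnergy {N : ℕ} :
    Continuous fun x : Fin N → EuclideanSpace ℝ (Fin d) => tupleEnergy s x := by
  unfold tupleEnergy
  refine continuous_finsetSum _ fun i _ => continuous_finsetSum _ fun j _ => ?_
  refine ENNReal.continuous_rpow_const.comp ?_
  fun_prop

/-- There are processes of finite entropy whose energy is almost as small as the ground state
energy: repeat periodically an almost optimal configuration of many points, slightly contracted
away from the boundary of the cell and slightly perturbed at random. -/
lemma exists_rieszEnergy_le (hd : 1 ≤ d) (hs : (d : ℝ) < s) {m : ℝ≥0} (hm : 0 < m) {ε : ℝ}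
    (hε : 0 < ε) :
    ∃ P ∈ stationaryLaws d (m : ℝ≥0∞), specificEntropy P ≠ ∞ ∧
      rieszEnergy s P ≤
        ENNReal.ofReal ((rieszConstant d s).toReal * (m : ℝ) ^ (1 + s / d) + ε) := by
  have hs0 : 0 < s := (Nat.cast_nonneg d).trans_lt hs
  have hd0 : (0 : ℝ) < d := by exact_mod_cast hd
  have hdn : d ≠ 0 := by omega
  have hm0 : (0 : ℝ) < m := hm
  set c := (rieszConstant d s).toReal with hc
  have hcC : rieszConstant d s = ENNReal.ofReal c :=
    (ENNReal.ofReal_toReal (rieszConstant_ne_top hd hs)).symm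
  have hc0 : 0 ≤ c := ENNReal.toReal_nonneg
  set S := (latticeSum d s).toReal with hS
  have hSC : latticeSum d s = ENNReal.ofReal S :=
    (ENNReal.ofReal_toReal (latticeSum_ne_top hs)).symm
  have hS0 : 0 ≤ S := ENNReal.toReal_nonneg
  set M := (m : ℝ) ^ (1 + s / d) with hM
  have hMsplit : M = m * (m : ℝ) ^ (s / d) := by rw [hM, Real.rpow_add hm0, Real.rpow_one]
  obtain ⟨δ, hδ0, hδ⟩ : ∃ δ : ℝ, 0 < δ ∧ (1 + δ) ^ s * (c + δ) * M ≤ c * M + ε / 2 := by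
    have h1 : ContinuousAt (fun δ : ℝ => (1 + δ) ^ s * (c + δ) * M) 0 := by
      refine ((ContinuousAt.rpow_const (by fun_prop) (Or.inr hs0.le)).mul (by fun_prop)).mul
        continuousAt_const
    have h2 : Tendsto (fun δ : ℝ => (1 + δ) ^ s * (c + δ) * M) (𝓝[>] 0) (𝓝 (c * M)) := by
      have := h1.tendsto
      simp only [add_zero, Real.one_rpow, one_mul] at this
      exact this.mono_left nhdsWithin_le_nhds
    have h3 := h2.eventually (ge_mem_nhds (show c * M < c * M + ε / 2 by linarith))
    obtain ⟨δ, h5, h6⟩ := (h3.and self_mem_nhdsWithin).exists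
    exact ⟨δ, h6, h5⟩
  set K := (δ / (2 * (1 + δ))) ^ (-s) * S * M with hK
  -- the number of points per cell: the optimal energy is close to its limit, and the interaction
  -- of different cells, whose order is `N ^ (1 - s / d)`, is small because `d < s`
  obtain ⟨N, x, hN0, hxc, hxE, hNK⟩ : ∃ (N : ℕ) (x : Fin N → EuclideanSpace ℝ (Fin d)),
      0 < N ∧ (∀ i, x i ∈ cube d 1) ∧
      tupleEnergy s x < ENNReal.ofReal ((c + δ) * (N : ℝ) ^ (1 + s / d)) ∧
      (N : ℝ) ^ (-(s / d - 1)) * K ≤ ε / 2 := by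
    have h1 : ∃ᶠ N : ℕ in atTop, minTupleEnergy d s N / (N : ℝ≥0∞) ^ (1 + s / d) <
        ENNReal.ofReal (c + δ) := by
      refine frequently_lt_of_liminf_lt (by isBoundedDefault) ?_
      rw [← rieszConstant_eq, hcC]
      exact (ENNReal.ofReal_lt_ofReal_iff (by positivity)).2 (by linarith)
    have h2 : ∀ᶠ N : ℕ in atTop, (N : ℝ) ^ (-(s / d - 1)) * K ≤ ε / 2 := by
      have h3 : Tendsto (fun N : ℕ => (N : ℝ) ^ (-(s / d - 1)) * K) atTop (𝓝 0) := by
        have h4 : 0 < s / d - 1 := by rw [sub_pos, one_lt_div hd0]; exact hs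
        simpa using ((tendsto_rpow_neg_atTop h4).comp tendsto_natCast_atTop_atTop).mul_const K
      exact h3.eventually (ge_mem_nhds (by positivity))
    obtain ⟨N, h5, h6, h7⟩ := (h1.and_eventually (h2.and (eventually_gt_atTop 0))).exists
    have hNr : (0 : ℝ) < N := by exact_mod_cast h7
    have hNp : (N : ℝ≥0∞) ^ (1 + s / d) = ENNReal.ofReal ((N : ℝ) ^ (1 + s / d)) := by
      rw [← ENNReal.ofReal_rpow_of_pos hNr, ENNReal.ofReal_natCast]
    rw [ENNReal.div_lt_iff (Or.inl (by rw [hNp]; simp; positivity))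
      (Or.inl (by rw [hNp]; exact ENNReal.ofReal_ne_top)), hNp,
      ← ENNReal.ofReal_mul (by positivity), minTupleEnergy] at h5
    simp only [iInf_lt_iff] at h5
    obtain ⟨x, hx, hxE⟩ := h5
    exact ⟨N, x, h7, hx, hxE, h6⟩
  have hNr : (0 : ℝ) < N := by exact_mod_cast hN0
  -- the side `L` of the cell, the side `l` of the contracted configuration, and the gap
  set L : ℝ := (N / m) ^ (1 / (d : ℝ)) with hL
  have hL0 : 0 < L := by positivity
  have hLd : L ^ d = N / m := by
    rw [hL, ← Real.rpow_natCast, ← Real.rpow_mul (by positivity), one_div,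
      inv_mul_cancel₀ hd0.ne', Real.rpow_one]
  have hLs : L ^ (-s) = (m : ℝ) ^ (s / d) * ((N : ℝ) ^ (s / d))⁻¹ := by
    rw [hL, ← Real.rpow_mul (by positivity), show 1 / (d : ℝ) * -s = -(s / d) by ring,
      Real.rpow_neg (by positivity), Real.div_rpow hNr.le hm0.le, inv_div, div_eq_mul_inv]
  set l : ℝ := L / (1 + δ) with hl
  have hl0 : 0 < l := by positivity
  set g : ℝ := L * (δ / (2 * (1 + δ))) / 2 with hg
  have hg0 : 0 < g := by positivity
  have hgl : 4 * g = L - l := by rw [hg, hl]; field_simp; ring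
  set v : EuclideanSpace ℝ (Fin d) := WithLp.toLp 2 fun _ => L / 2 with hv
  set y : Fin N → EuclideanSpace ℝ (Fin d) := fun i => l • x i + v with hy
  set e : ℝ := l ^ (-s) * ((c + δ) * (N : ℝ) ^ (1 + s / d)) with he
  have hyE : tupleEnergy s y < ENNReal.ofReal e := by
    have h1 : tupleEnergy s y = tupleEnergy s (fun i => l • x i) := by
      simp [tupleEnergy, hy]
    rw [h1, tupleEnergy_smul x hl0, he, ENNReal.ofReal_mul (by positivity),
      ENNReal.ofReal_rpow_of_pos hl0]
    refine ENNReal.mul_lt_mul_right (by simp; positivity) ENNReal.ofReal_ne_top hxE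
  have hycoord : ∀ i a, y i a ∈ Icc (2 * g) (L - 2 * g) := by
    intro i a
    have h1 := abs_le.1 (hxc i a)
    have h2 : y i a = l * x i a + L / 2 := by simp [hy, hv]
    rw [h2]
    constructor <;> nlinarith
  -- the size of the perturbation; the points have to be spread out over small balls, since a
  -- configuration with deterministic cells has infinite entropy
  obtain ⟨r, hr0, hrg, hr⟩ : ∃ r : ℝ, 0 < r ∧ r ≤ g ∧
      ∀ z : Fin N → EuclideanSpace ℝ (Fin d), (∀ i, z i ∈ Metric.closedBall (y i) r) →
        tupleEnergy s z < ENNReal.ofReal e := by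
    have h1 : {z : Fin N → EuclideanSpace ℝ (Fin d) | tupleEnergy s z < ENNReal.ofReal e} ∈ 𝓝 y :=
      (isOpen_Iio.preimage continuous_tupleEnergy).mem_nhds hyE
    obtain ⟨r, hr0, hr⟩ := Metric.nhds_basis_closedBall.mem_iff.1 h1
    refine ⟨min r g, lt_min hr0 hg0, min_le_right _ _, fun z hz => hr ?_⟩
    rw [Metric.mem_closedBall, dist_pi_le_iff hr0.le]
    exact fun i => (Metric.mem_closedBall.1 (hz i)).trans (min_le_left _ _)
  set B : Fin N → Set (EuclideanSpace ℝ (Fin d)) := fun i => Metric.closedBall (y i) r with hB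
  have hB0 : ∀ i, volume (B i) ≠ 0 := fun i => (Metric.measure_closedBall_pos volume _ hr0).ne'
  have hBt : ∀ i, volume (B i) ≠ ∞ := fun i => measure_closedBall_lt_top.ne
  have hexp := Real.exp_pos (-L ^ d)
  obtain ⟨P, hP, hW, hent⟩ := exists_mem_stationaryLaws_of_cells (d := d) (s := s) (L := L)
    (g := g) (N := N) hs0 hg0 (by linarith) hN0.ne' (q := 0) (p := 1) (zero_add 1) (B := B)
    (fun i => Metric.isClosed_closedBall.measurableSet) hB0 (fun i z hz a => by
      have h1 := (PiLp.norm_apply_le (z - y i) a).trans (mem_closedBall_iff_norm.1 hz)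
      rw [Real.norm_eq_abs, PiLp.sub_apply, abs_le] at h1
      have h2 := hycoord i a
      constructor <;> linarith [h2.1, h2.2, h1.1, h1.2])
    (e := ENNReal.ofReal e) (fun z hz => (hr z hz).le)
    (a₁ := (Real.exp (-L ^ d)).toNNReal)
    (a₂ := (ENNReal.ofReal (Real.exp (-L ^ d)) * ((N.factorial : ℝ≥0∞)⁻¹ *
      ∏ i, volume (B i))).toNNReal) (by simpa using hexp)
    (by
      rw [pos_iff_ne_zero, Ne, ENNReal.toNNReal_eq_zero_iff, not_or]
      refine ⟨mul_ne_zero (by simpa using hexp) (mul_ne_zero (by simp)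
        (Finset.prod_ne_zero_iff.2 fun i _ => hB0 i)), ?_⟩
      refine ENNReal.mul_ne_top ENNReal.ofReal_ne_top (ENNReal.mul_ne_top
        (by simp [Nat.factorial_ne_zero]) (ENNReal.prod_ne_top fun i _ => hBt i))) le_rfl
    ENNReal.coe_toNNReal_le_self (m := m) (by rw [hLd]; field_simp; simp)
  refine ⟨P, hP, ?_, hW.trans ?_⟩
  · exact ne_top_of_le_ne_top (ENNReal.div_ne_top ENNReal.ofReal_ne_top
      (by simp; positivity)) hent
  · have h2g : 2 * g = L * (δ / (2 * (1 + δ))) := by rw [hg]; ring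
    have hLdpos : 0 < L ^ d := by positivity
    rw [h2g, hSC, ENNReal.ofReal_rpow_of_pos (by positivity), ← ENNReal.ofReal_natCast N,
      ← ENNReal.ofReal_mul (by positivity), ← ENNReal.ofReal_mul (by positivity),
      ← ENNReal.ofReal_mul (by positivity), ← ENNReal.ofReal_add (by positivity) (by positivity),
      ← ENNReal.ofReal_div_of_pos hLdpos]
    refine ENNReal.ofReal_le_ofReal ?_
    have h3 : e / L ^ d = (1 + δ) ^ s * (c + δ) * M := by
      have h4 : l ^ (-s) = L ^ (-s) * (1 + δ) ^ s := by
        rw [hl, Real.div_rpow hL0.le (by positivity), Real.rpow_neg (by positivity : 0 ≤ 1 + δ),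
          div_inv_eq_mul]
      rw [he, h4, hLs, hLd, hMsplit, Real.rpow_add hNr, Real.rpow_one]
      field_simp
    have h5 : (N : ℝ) * (N * ((L * (δ / (2 * (1 + δ)))) ^ (-s) * S)) / L ^ d =
        (N : ℝ) ^ (-(s / d - 1)) * K := by
      rw [Real.mul_rpow hL0.le (by positivity), hLs, hLd, hK, hMsplit, neg_sub,
        Real.rpow_sub hNr, Real.rpow_one]
      field_simp
    rw [add_div, h3, h5]
    linarith

end Processes

/-! ### The free energy per unit volume as a function of the intensity -/

section BulkFreeEnergy

variable {d : ℕ} {s β : ℝ}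

/-- The infimum of `β W_s(P) + ent[P | Π] - 1` over the stationary processes of intensity `m`, as a
real function of `m ≥ 0` (the value at negative `m` is the value at `0`). -/
noncomputable def bulkFreeEnergy (d : ℕ) (s β m : ℝ) : ℝ :=
  (⨅ P ∈ stationaryLaws d (m.toNNReal : ℝ≥0∞), freeEnergy s β P).toReal - 1

lemma iInf_freeEnergy_ne_top (hd : 1 ≤ d) (hs : (d : ℝ) < s) (β : ℝ) (m : ℝ≥0) :
    ⨅ P ∈ stationaryLaws d (m : ℝ≥0∞), freeEnergy s β P ≠ ∞ := by
  obtain ⟨P, hP, hW, hent⟩ := exists_specificEntropy_le hd hs m one_pos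
  refine ne_top_of_le_ne_top ?_ (iInf₂_le P hP)
  have := ne_top_of_le_ne_top ENNReal.ofReal_ne_top hent
  rw [freeEnergy]
  finiteness

lemma bulkFreeEnergy_coe (d : ℕ) (s β : ℝ) (m : ℝ≥0) : bulkFreeEnergy d s β m =
    (⨅ P ∈ stationaryLaws d (m : ℝ≥0∞), freeEnergy s β P).toReal - 1 := by
  rw [bulkFreeEnergy, Real.toNNReal_coe]

lemma microFreeEnergy_eq (hd : 1 ≤ d) (hs : (d : ℝ) < s) (β : ℝ) (m : ℝ≥0) :
    microFreeEnergy d s β m = (bulkFreeEnergy d s β m : EReal) := by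
  rw [bulkFreeEnergy_coe, EReal.coe_sub, EReal.coe_ennreal_toReal
    (iInf_freeEnergy_ne_top hd hs β m)]
  rfl

lemma bulkFreeEnergy_le {m : ℝ≥0} {P : Measure (Measure (EuclideanSpace ℝ (Fin d)))}
    (hP : P ∈ stationaryLaws d (m : ℝ≥0∞)) {K : ℝ} (hK : 0 ≤ K)
    (h : freeEnergy s β P ≤ ENNReal.ofReal K) : bulkFreeEnergy d s β m ≤ K - 1 := by
  rw [bulkFreeEnergy_coe]
  have := ENNReal.toReal_le_of_le_ofReal hK ((iInf₂_le (f := fun P (_ : P ∈ stationaryLaws d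
    (m : ℝ≥0∞)) => freeEnergy s β P) P hP).trans h)
  linarith

/-- The energy and the entropy are bounded below separately. The bound `t m - exp t` for every slope
`t` amounts to the entropy `m log m - m` of the Poisson process of intensity `m`. -/
lemma le_bulkFreeEnergy (hd : 1 ≤ d) (hs : (d : ℝ) < s) (hβ : 0 ≤ β) (t : ℝ) (m : ℝ≥0) :
    β * ((rieszConstant d s).toReal * (m : ℝ) ^ (1 + s / d)) + (t * m - Real.exp t) ≤
      bulkFreeEnergy d s β m := by
  rw [bulkFreeEnergy_coe, le_sub_iff_add_le]
  refine (ENNReal.ofReal_le_iff_le_toReal (iInf_freeEnergy_ne_top hd hs β m)).1 ?_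
  refine le_iInf₂ fun P hP => ?_
  have hs0 : 0 < s := (Nat.cast_nonneg d).trans_lt hs
  have h1 := rieszConstant_mul_le_rieszEnergy hd hs hP
  have h2 : rieszConstant d s * (m : ℝ≥0∞) ^ (1 + s / d) =
      ENNReal.ofReal ((rieszConstant d s).toReal * (m : ℝ) ^ (1 + s / d)) := by
    rw [ENNReal.ofReal_mul ENNReal.toReal_nonneg,
      ENNReal.ofReal_toReal (rieszConstant_ne_top hd hs),
      ← ENNReal.ofReal_rpow_of_nonneg m.coe_nonneg (by positivity), ENNReal.ofReal_coe_nnreal]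
  rw [freeEnergy, add_assoc]
  refine ENNReal.ofReal_add_le.trans (add_le_add ?_ (le_specificEntropy hP t))
  rw [ENNReal.ofReal_mul hβ, ← h2]
  gcongr

lemma linear_le_bulkFreeEnergy (hd : 1 ≤ d) (hs : (d : ℝ) < s) (hβ : 0 ≤ β) (t : ℝ) (m : ℝ≥0) :
    t * m - Real.exp t ≤ bulkFreeEnergy d s β m := by
  refine le_trans ?_ (le_bulkFreeEnergy hd hs hβ t m)
  have : 0 ≤ β * ((rieszConstant d s).toReal * (m : ℝ) ^ (1 + s / d)) := by positivity
  linarith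

/-- At high temperature the free energy is close to the one of the Poisson process. -/
lemma exists_bulkFreeEnergy_le_entropy (hd : 1 ≤ d) (hs : (d : ℝ) < s) (m : ℝ≥0) {ε : ℝ}
    (hε : 0 < ε) : ∃ K, 0 ≤ K ∧ ∀ β, 0 ≤ β →
      bulkFreeEnergy d s β m ≤ β * K + (m * Real.log m - m + ε) := by
  obtain ⟨P, hP, hW, hent⟩ := exists_specificEntropy_le hd hs m hε
  refine ⟨(rieszEnergy s P).toReal, ENNReal.toReal_nonneg, fun β hβ => ?_⟩
  -- nonnegativity of `m log m - m + 1`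
  have h0 : 0 ≤ m * Real.log m - m + 1 + ε := by
    rcases eq_or_ne m 0 with hm | hm
    · simp [hm]; linarith
    · have hm0 : (0 : ℝ) < m := by positivity
      have h1 := Real.log_le_sub_one_of_pos (inv_pos.2 hm0)
      rw [Real.log_inv] at h1
      have h2 : (m : ℝ) * -Real.log m ≤ m * ((m : ℝ)⁻¹ - 1) := by gcongr
      rw [mul_sub, mul_inv_cancel₀ hm0.ne'] at h2
      linarith
  have := bulkFreeEnergy_le (s := s) (β := β) hP
    (K := β * (rieszEnergy s P).toReal + (m * Real.log m - m + 1 + ε)) (by positivity) (by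
      rw [freeEnergy, ENNReal.ofReal_add (by positivity) h0, ENNReal.ofReal_mul hβ,
        ENNReal.ofReal_toReal hW]
      gcongr)
  linarith

/-- At low temperature the free energy is close to the ground state energy. -/
lemma exists_bulkFreeEnergy_le_rpow (hd : 1 ≤ d) (hs : (d : ℝ) < s) {m : ℝ≥0} (hm : 0 < m) {ε : ℝ}
    (hε : 0 < ε) : ∃ K, ∀ β, 0 ≤ β → bulkFreeEnergy d s β m ≤
      β * ((rieszConstant d s).toReal * (m : ℝ) ^ (1 + s / d) + ε) + K := by
  obtain ⟨P, hP, hent, hW⟩ := exists_rieszEnergy_le hd hs hm hε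
  refine ⟨(specificEntropy P).toReal - 1, fun β hβ => ?_⟩
  have := bulkFreeEnergy_le (s := s) (β := β) hP
    (K := β * ((rieszConstant d s).toReal * (m : ℝ) ^ (1 + s / d) + ε) +
      (specificEntropy P).toReal) (by positivity) (by
      rw [freeEnergy, ENNReal.ofReal_add (by positivity) (by positivity), ENNReal.ofReal_mul hβ,
        ENNReal.ofReal_toReal hent]
      gcongr)
  linarith

lemma bulkFreeEnergy_zero (hd : 1 ≤ d) (hs : (d : ℝ) < s) (hβ : 0 ≤ β) :
    bulkFreeEnergy d s β 0 = 0 := by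
  refine le_antisymm (le_of_forall_pos_le_add fun ε hε => ?_) ?_
  · obtain ⟨P, hP, -, hent⟩ := exists_specificEntropy_le hd hs 0 hε
    have := bulkFreeEnergy_le (s := s) (β := β) hP (K := 1 + ε) (by positivity) (by
      rw [freeEnergy, rieszEnergy_eq_zero_of_mem_stationaryLaws_zero hP]
      simpa using hent)
    simp only [NNReal.coe_zero] at this
    linarith
  · have h : Tendsto (fun t : ℝ => -Real.exp t) atBot (𝓝 0) := by
      simpa using Real.tendsto_exp_atBot.neg
    refine le_of_tendsto' h fun t => ?_
    have := linear_le_bulkFreeEnergy hd hs hβ t 0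
    simpa using this

lemma convexOn_bulkFreeEnergy (hd : 1 ≤ d) (hs : (d : ℝ) < s) (β : ℝ) :
    ConvexOn ℝ (Ici 0) (bulkFreeEnergy d s β) := by
  refine ⟨convex_Ici 0, fun x hx y hy a b ha hb hab => ?_⟩
  lift x to ℝ≥0 using hx
  lift y to ℝ≥0 using hy
  lift a to ℝ≥0 using ha
  lift b to ℝ≥0 using hb
  have hab' : a + b = 1 := by exact_mod_cast hab
  have hz : (a : ℝ) • (x : ℝ) + (b : ℝ) • (y : ℝ) = ((a * x + b * y : ℝ≥0) : ℝ) := by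
    push_cast; rfl
  rw [hz]
  refine le_of_forall_pos_le_add fun ε hε => ?_
  have hnear : ∀ m : ℝ≥0, ∃ P ∈ stationaryLaws d (m : ℝ≥0∞), freeEnergy s β P <
      ENNReal.ofReal (bulkFreeEnergy d s β m + 1 + ε) := by
    intro m
    have h1 : ⨅ P ∈ stationaryLaws d (m : ℝ≥0∞), freeEnergy s β P <
        ENNReal.ofReal (bulkFreeEnergy d s β m + 1 + ε) := by
      rw [ENNReal.lt_ofReal_iff_toReal_lt (iInf_freeEnergy_ne_top hd hs β m), bulkFreeEnergy_coe]
      linarith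
    simpa only [iInf_lt_iff, exists_prop] using h1
  have hpos : ∀ m : ℝ≥0, 0 ≤ bulkFreeEnergy d s β m + 1 := by
    intro m
    rw [bulkFreeEnergy_coe, sub_add_cancel]
    exact ENNReal.toReal_nonneg
  obtain ⟨P₁, hP₁, h₁⟩ := hnear x
  obtain ⟨P₂, hP₂, h₂⟩ := hnear y
  have hP := convexComb_mem_stationaryLaws hP₁ hP₂ hab'
  have := bulkFreeEnergy_le (s := s) (β := β) hP
    (K := a * (bulkFreeEnergy d s β x + 1 + ε) + b * (bulkFreeEnergy d s β y + 1 + ε))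
    (by have := hpos x; have := hpos y; positivity) (by
      have hx := hpos x
      have hy := hpos y
      calc freeEnergy s β (a • P₁ + b • P₂)
          ≤ ENNReal.ofReal β * (a * rieszEnergy s P₁ + b * rieszEnergy s P₂) +
              (a * specificEntropy P₁ + b * specificEntropy P₂) :=
            add_le_add (by gcongr; exact rieszEnergy_convexComb_le s hP₁ hP₂ a b)
              (specificEntropy_convexComb_le hP₁ hP₂ hab')
        _ = a * freeEnergy s β P₁ + b * freeEnergy s β P₂ := by
            rw [freeEnergy, freeEnergy]; ring
        _ ≤ a * ENNReal.ofReal (bulkFreeEnergy d s β x + 1 + ε) +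
              b * ENNReal.ofReal (bulkFreeEnergy d s β y + 1 + ε) := by gcongr
        _ = _ := by
            rw [ENNReal.ofReal_add (p := a * _) (by positivity) (by positivity),
              ENNReal.ofReal_mul a.coe_nonneg, ENNReal.ofReal_mul b.coe_nonneg,
              ENNReal.ofReal_coe_nnreal, ENNReal.ofReal_coe_nnreal])
  simp only [smul_eq_mul]
  calc _ ≤ _ := this
    _ = a * bulkFreeEnergy d s β x + b * bulkFreeEnergy d s β y + (a + b) * (1 + ε) - 1 := by ring
    _ = _ := by rw [hab]; ring

lemma continuousOn_bulkFreeEnergy (hd : 1 ≤ d) (hs : (d : ℝ) < s) (hβ : 0 ≤ β) :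
    ContinuousOn (bulkFreeEnergy d s β) (Ici 0) := by
  have hconv := convexOn_bulkFreeEnergy hd hs β
  intro x hx
  rcases eq_or_lt_of_le (show 0 ≤ x from hx) with rfl | hx0
  · rw [ContinuousWithinAt, bulkFreeEnergy_zero hd hs hβ]
    rw [Metric.tendsto_nhdsWithin_nhds]
    intro ε hε
    -- near `0` the lower bound is `t m - exp t` with `t` very negative, the upper bound is a chord
    obtain ⟨t, ht⟩ : ∃ t : ℝ, Real.exp t < ε / 2 :=
      (Real.tendsto_exp_atBot.eventually (gt_mem_nhds (half_pos hε))).exists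
    refine ⟨min 1 (ε / 2 / (|t| + |bulkFreeEnergy d s β 1| + 1)), by positivity, fun {m} hm h => ?_⟩
    have hm0 : 0 ≤ m := hm
    rw [dist_zero_right, Real.norm_eq_abs, abs_of_nonneg hm0, lt_min_iff,
      lt_div_iff₀ (by positivity)] at h
    have h1 := linear_le_bulkFreeEnergy hd hs hβ t ⟨m, hm0⟩
    have h2 := hconv.2 (mem_Ici.2 le_rfl) (mem_Ici.2 zero_le_one) (sub_nonneg.2 h.1.le) hm0
      (by ring)
    simp only [smul_eq_mul, mul_zero, mul_one, zero_add, bulkFreeEnergy_zero hd hs hβ] at h2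
    change t * m - Real.exp t ≤ bulkFreeEnergy d s β m at h1
    rw [dist_zero_right, Real.norm_eq_abs, abs_lt]
    have h3 := neg_abs_le t
    have h4 := le_abs_self (bulkFreeEnergy d s β 1)
    have h5 := abs_nonneg t
    have h6 := abs_nonneg (bulkFreeEnergy d s β 1)
    constructor <;> nlinarith
  · have h1 : ContinuousOn (bulkFreeEnergy d s β) (Ioi 0) :=
      (hconv.subset Ioi_subset_Ici_self (convex_Ioi 0)).continuousOn isOpen_Ioi
    exact (h1.continuousAt (Ioi_mem_nhds hx0)).continuousWithinAt

lemma continuous_bulkFreeEnergy_coe (hd : 1 ≤ d) (hs : (d : ℝ) < s) (hβ : 0 ≤ β) :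
    Continuous fun m : ℝ≥0 => bulkFreeEnergy d s β m :=
  (continuousOn_bulkFreeEnergy hd hs hβ).comp_continuous NNReal.continuous_coe fun m => m.2

lemma bulkFreeEnergy_le_mul (hd : 1 ≤ d) (hs : (d : ℝ) < s) (hβ : 1 ≤ β) (m : ℝ≥0) :
    bulkFreeEnergy d s β m ≤ β * (bulkFreeEnergy d s 1 m + 1) := by
  have hβ0 : 0 < β := by linarith
  have h1 : ⨅ P ∈ stationaryLaws d (m : ℝ≥0∞), freeEnergy s β P ≤
      ENNReal.ofReal β * ⨅ P ∈ stationaryLaws d (m : ℝ≥0∞), freeEnergy s 1 P := by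
    rw [ENNReal.mul_iInf_of_ne (by simpa using hβ0) ENNReal.ofReal_ne_top]
    refine le_iInf fun P => ?_
    rw [ENNReal.mul_iInf_of_ne (by simpa using hβ0) ENNReal.ofReal_ne_top]
    refine le_iInf fun hP => (iInf₂_le P hP).trans ?_
    rw [freeEnergy, freeEnergy, mul_add, ENNReal.ofReal_one, one_mul]
    gcongr
    exact le_mul_of_one_le_left zero_le (by simpa using hβ)
  have h2 := ENNReal.toReal_mono (ENNReal.mul_ne_top ENNReal.ofReal_ne_top
    (iInf_freeEnergy_ne_top hd hs 1 m)) h1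
  rw [ENNReal.toReal_mul, ENNReal.toReal_ofReal hβ0.le] at h2
  rw [bulkFreeEnergy_coe, bulkFreeEnergy_coe, sub_add_cancel]
  linarith

end BulkFreeEnergy

/-! ### Lagrange multipliers for integral functionals of densities -/

section Multiplier

variable {α : Type*} [MeasurableSpace α] {μ : Measure α} {f : ℝ → ℝ}

/-- The number `m` minimizes `f m - u m` among the nonnegative numbers. -/
def IsArgmin (f : ℝ → ℝ) (u m : ℝ) : Prop :=
  0 ≤ m ∧ ∀ m', 0 ≤ m' → f m - u * m ≤ f m' - u * m'

lemma IsArgmin.le_of_lt {u u' m m' : ℝ} (h : IsArgmin f u m) (h' : IsArgmin f u' m')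
    (hu : u < u') : m ≤ m' := by
  have h1 := h.2 m' h'.1
  have h2 := h'.2 m h.1
  nlinarith

lemma IsArgmin.of_tendsto (hf : ContinuousOn f (Ici 0)) {u m : ℕ → ℝ} {u₀ m₀ : ℝ}
    (h : ∀ n, IsArgmin f (u n) (m n)) (hu : Tendsto u atTop (𝓝 u₀))
    (hm : Tendsto m atTop (𝓝 m₀)) : IsArgmin f u₀ m₀ := by
  have h0 : 0 ≤ m₀ := ge_of_tendsto' hm fun n => (h n).1
  have hfm : Tendsto (fun n => f (m n)) atTop (𝓝 (f m₀)) :=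
    (hf m₀ h0).tendsto.comp (tendsto_nhdsWithin_iff.2 ⟨hm, Eventually.of_forall fun n => (h n).1⟩)
  exact ⟨h0, fun m' hm' => le_of_tendsto_of_tendsto' (hfm.sub (hu.mul hm))
    (tendsto_const_nhds.sub (hu.mul_const m')) fun n => (h n).2 m' hm'⟩

lemma exists_isArgmin (hf : ContinuousOn f (Ici 0)) {u b : ℝ}
    (hb : ∀ m, 0 ≤ m → f m - u * m ≤ f 0 → m ≤ b) : ∃ m, IsArgmin f u m := by
  have hb0 : 0 ≤ b := hb 0 le_rfl (by simp)
  obtain ⟨m, hm, hmin⟩ := isCompact_Icc.exists_isMinOn (nonempty_Icc.2 hb0)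
    (f := fun m => f m - u * m)
    ((hf.mono Icc_subset_Ici_self).sub (by fun_prop))
  refine ⟨m, hm.1, fun m' hm' => ?_⟩
  by_cases h : m' ≤ b
  · exact hmin ⟨hm', h⟩
  · have h1 : f 0 < f m' - u * m' := lt_of_not_ge fun h2 => h (hb m' hm' h2)
    have h2 : f m - u * m ≤ f 0 - u * 0 := hmin ⟨le_rfl, hb0⟩
    linarith

lemma IsArgmin.convexComb (hf : ConvexOn ℝ (Ici 0) f) {u m m' a b : ℝ} (h : IsArgmin f u m)
    (h' : IsArgmin f u m') (ha : 0 ≤ a) (hb : 0 ≤ b) (hab : a + b = 1) :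
    IsArgmin f u (a * m + b * m') := by
  refine ⟨by have := h.1; have := h'.1; positivity, fun x hx => ?_⟩
  have h1 := hf.2 h.1 h'.1 ha hb hab
  simp only [smul_eq_mul] at h1
  have h2 := mul_le_mul_of_nonneg_left (h.2 x hx) ha
  have h3 := mul_le_mul_of_nonneg_left (h'.2 x hx) hb
  have h4 : f x - u * x = a * (f x - u * x) + b * (f x - u * x) := by rw [← add_mul, hab, one_mul]
  rw [h4]
  linarith

/-- Existence of a density which satisfies the first order conditions with a Lagrange multiplier.
The total mass of a selection of the pointwise minimizers is monotone in the multiplier. At the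
critical multiplier, the left limit of the selection has mass at most `1` and the right limit has
mass at least `1`, and a convex combination has mass `1`. -/
theorem exists_density_isArgmin (hf : ContinuousOn f (Ici 0)) (hconv : ConvexOn ℝ (Ici 0) f)
    {b : ℝ → ℝ} (hb : ∀ u m, 0 ≤ m → f m - u * m ≤ f 0 → m ≤ b u) {W : α → ℝ}
    (hW : Measurable W) (hfin : ∀ c, ∫⁻ x, ENNReal.ofReal (b (c - W x)) ∂μ ≠ ∞)
    (hsmall : ∃ c, ∫⁻ x, ENNReal.ofReal (b (c - W x)) ∂μ ≤ 1) (hμ : μ ≠ 0) :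
    ∃ (ρ : α → ℝ≥0) (c : ℝ), Measurable ρ ∧ ∫⁻ x, ρ x ∂μ = 1 ∧
      ∀ x, IsArgmin f (c - W x) (ρ x) := by
  choose h hh using fun u => exists_isArgmin hf (hb u)
  have hmono : Monotone h := fun u u' huu' => by
    rcases huu'.lt_or_eq with h1 | rfl
    · exact (hh u).le_of_lt (hh u') h1
    · exact le_rfl
  have hmeas : ∀ c, Measurable fun x => h (c - W x) := fun c =>
    hmono.measurable.comp (hW.const_sub c)
  have hhb : ∀ u, h u ≤ b u := fun u =>
    hb u (h u) (hh u).1 (by simpa using (hh u).2 0 le_rfl)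
  set Φ : ℝ → ℝ≥0∞ := fun c => ∫⁻ x, ENNReal.ofReal (h (c - W x)) ∂μ with hΦ
  have hΦb : ∀ c, Φ c ≤ ∫⁻ x, ENNReal.ofReal (b (c - W x)) ∂μ := fun c =>
    lintegral_mono fun x => ENNReal.ofReal_le_ofReal (hhb _)
  have hΦfin : ∀ c, Φ c ≠ ∞ := fun c => ne_top_of_le_ne_top (hfin c) (hΦb c)
  have hΦmono : Monotone Φ := fun c c' hc =>
    lintegral_mono fun x => ENNReal.ofReal_le_ofReal (hmono (by linarith))
  -- the mass exceeds `1` for large multipliers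
  obtain ⟨c₁, hc₁⟩ : ∃ c, 1 < Φ c := by
    obtain ⟨n, hn⟩ : ∃ n : ℕ, μ {x | W x ≤ n} ≠ 0 := by
      by_contra! hcon
      refine hμ (Measure.measure_univ_eq_zero.1 (measure_mono_null (fun x _ => ?_)
        (measure_iUnion_null hcon)))
      exact mem_iUnion.2 (exists_nat_ge (W x))
    obtain ⟨A, hA⟩ := ENNReal.exists_nat_mul_gt hn ENNReal.one_ne_top
    set u₀ := max 0 (f (A + 1) - f (h 0) + 1) with hu₀
    have hA0 : ∀ u, u₀ ≤ u → (A : ℝ) ≤ h u := by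
      intro u hu
      by_contra! hlt
      have h1 := (hh u).2 (A + 1) (by positivity)
      have h2 := (hh 0).2 (h u) (hh u).1
      have h3 : 0 ≤ u := (le_max_left _ _).trans hu
      have h4 : f (A + 1) - f (h 0) + 1 ≤ u := (le_max_right _ _).trans hu
      nlinarith
    refine ⟨u₀ + n, hA.trans_le ?_⟩
    have hms : MeasurableSet {x | W x ≤ n} := measurableSet_le hW measurable_const
    calc (A : ℝ≥0∞) * μ {x | W x ≤ n} = ∫⁻ _ in {x | W x ≤ n}, (A : ℝ≥0∞) ∂μ := by simp
      _ ≤ ∫⁻ x in {x | W x ≤ n}, ENNReal.ofReal (h (u₀ + n - W x)) ∂μ := by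
          refine setLIntegral_mono' hms fun x hx => ?_
          rw [← ENNReal.ofReal_natCast]
          have hx' : W x ≤ n := hx
          exact ENNReal.ofReal_le_ofReal (hA0 _ (by linarith))
      _ ≤ _ := setLIntegral_le_lintegral _ _
  -- the critical multiplier, and sequences which converge to it from both sides
  set S := {c | Φ c ≤ 1} with hS
  have hSne : S.Nonempty := hsmall.imp fun c hc => (hΦb c).trans hc
  have hSb : BddAbove S := ⟨c₁, fun c (hc : Φ c ≤ 1) =>
    le_of_not_ge fun hle => (hc₁.trans_le (hΦmono hle)).not_ge hc⟩
  set c := sSup S with hc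
  have hinv : Tendsto (fun n : ℕ => 1 / ((n : ℝ) + 1)) atTop (𝓝 0) :=
    tendsto_one_div_add_atTop_nhds_zero_nat
  have hanti : Antitone fun n : ℕ => 1 / ((n : ℝ) + 1) := antitone_nat_of_succ_le fun n => by
    have : (n : ℝ) + 1 ≤ ((n + 1 : ℕ) : ℝ) + 1 := by push_cast; linarith
    exact one_div_le_one_div_of_le (by positivity) this
  have hpos : ∀ n : ℕ, 0 < 1 / ((n : ℝ) + 1) := fun n => by positivity
  set l : ℕ → ℝ := fun n => c - 1 / ((n : ℝ) + 1) with hl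
  set r : ℕ → ℝ := fun n => c + 1 / ((n : ℝ) + 1) with hr
  have hlt : Tendsto l atTop (𝓝 c) := by simpa [hl] using hinv.const_sub c
  have hrt : Tendsto r atTop (𝓝 c) := by simpa [hr] using hinv.const_add c
  have hΦl : ∀ n, Φ (l n) ≤ 1 := fun n => by
    obtain ⟨c', hc', hlc⟩ := exists_lt_of_lt_csSup hSne (show l n < c by
      have := hpos n; simp only [hl]; linarith)
    exact (hΦmono hlc.le).trans hc'
  have hΦr : ∀ n, 1 ≤ Φ (r n) := fun n => by
    by_contra! hlt
    have h1 := le_csSup hSb (show r n ∈ S from hlt.le)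
    have := hpos n
    simp only [hr] at h1
    linarith
  set ρ₁ : α → ℝ := fun x => ⨆ n, h (l n - W x) with hρ₁
  set ρ₂ : α → ℝ := fun x => ⨅ n, h (r n - W x) with hρ₂
  have hlm : ∀ x, Monotone fun n => h (l n - W x) := fun x n k hnk =>
    hmono (by have := hanti hnk; simp only [hl]; linarith)
  have hrm : ∀ x, Antitone fun n => h (r n - W x) := fun x n k hnk =>
    hmono (by have := hanti hnk; simp only [hr]; linarith)
  have ht₁ : ∀ x, Tendsto (fun n => h (l n - W x)) atTop (𝓝 (ρ₁ x)) := fun x =>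
    tendsto_atTop_ciSup (hlm x) ⟨h (c - W x), by
      rintro _ ⟨n, rfl⟩
      exact hmono (by have := hpos n; simp only [hl]; linarith)⟩
  have ht₂ : ∀ x, Tendsto (fun n => h (r n - W x)) atTop (𝓝 (ρ₂ x)) := fun x =>
    tendsto_atTop_ciInf (hrm x) ⟨h (c - W x), by
      rintro _ ⟨n, rfl⟩
      exact hmono (by have := hpos n; simp only [hr]; linarith)⟩
  have ha₁ : ∀ x, IsArgmin f (c - W x) (ρ₁ x) := fun x =>
    IsArgmin.of_tendsto hf (fun n => hh _) (hlt.sub_const (W x)) (ht₁ x)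
  have ha₂ : ∀ x, IsArgmin f (c - W x) (ρ₂ x) := fun x =>
    IsArgmin.of_tendsto hf (fun n => hh _) (hrt.sub_const (W x)) (ht₂ x)
  have hm₁ : Measurable ρ₁ := measurable_of_tendsto_metrizable (fun n => hmeas (l n))
    (tendsto_pi_nhds.2 ht₁)
  have hm₂ : Measurable ρ₂ := measurable_of_tendsto_metrizable (fun n => hmeas (r n))
    (tendsto_pi_nhds.2 ht₂)
  have hM₁ : ∫⁻ x, ENNReal.ofReal (ρ₁ x) ∂μ ≤ 1 :=
    le_of_tendsto' (lintegral_tendsto_of_tendsto_of_monotone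
      (fun n => (hmeas (l n)).ennreal_ofReal.aemeasurable)
      (Eventually.of_forall fun x n k hnk => ENNReal.ofReal_le_ofReal (hlm x hnk))
      (Eventually.of_forall fun x => ENNReal.tendsto_ofReal (ht₁ x))) hΦl
  have hM₂ : 1 ≤ ∫⁻ x, ENNReal.ofReal (ρ₂ x) ∂μ :=
    ge_of_tendsto' (lintegral_tendsto_of_tendsto_of_antitone
      (fun n => (hmeas (r n)).ennreal_ofReal.aemeasurable)
      (Eventually.of_forall fun x n k hnk => ENNReal.ofReal_le_ofReal (hrm x hnk)) (hΦfin (r 0))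
      (Eventually.of_forall fun x => ENNReal.tendsto_ofReal (ht₂ x))) hΦr
  have hM₂' : ∫⁻ x, ENNReal.ofReal (ρ₂ x) ∂μ ≠ ∞ :=
    ne_top_of_le_ne_top (hΦfin (r 0)) (lintegral_mono fun x => ENNReal.ofReal_le_ofReal
      ((hrm x).le_of_tendsto (ht₂ x) 0))
  have hM₁' : ∫⁻ x, ENNReal.ofReal (ρ₁ x) ∂μ ≠ ∞ := ne_top_of_le_ne_top ENNReal.one_ne_top hM₁
  obtain ⟨a, a', h0, h0', haa, hmass⟩ : (1 : ℝ) ∈ segment ℝ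
      (∫⁻ x, ENNReal.ofReal (ρ₁ x) ∂μ).toReal (∫⁻ x, ENNReal.ofReal (ρ₂ x) ∂μ).toReal := by
    have h1 : (∫⁻ x, ENNReal.ofReal (ρ₁ x) ∂μ).toReal ≤ 1 :=
      ENNReal.toReal_le_of_le_ofReal zero_le_one (by simpa using hM₁)
    have h2 : 1 ≤ (∫⁻ x, ENNReal.ofReal (ρ₂ x) ∂μ).toReal :=
      (ENNReal.ofReal_le_iff_le_toReal hM₂').1 (by simpa using hM₂)
    rw [segment_eq_Icc (h1.trans h2)]
    exact ⟨h1, h2⟩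
  have hρ0 : ∀ x, 0 ≤ a * ρ₁ x + a' * ρ₂ x := fun x => by
    have := (ha₁ x).1
    have := (ha₂ x).1
    positivity
  refine ⟨fun x => (a * ρ₁ x + a' * ρ₂ x).toNNReal, c,
    ((hm₁.const_mul a).add (hm₂.const_mul a')).real_toNNReal, ?_, fun x => ?_⟩
  · have h1 : ∀ x, ((a * ρ₁ x + a' * ρ₂ x).toNNReal : ℝ≥0∞) =
        ENNReal.ofReal a * ENNReal.ofReal (ρ₁ x) + ENNReal.ofReal a' * ENNReal.ofReal (ρ₂ x) := by
      intro x
      rw [← ENNReal.ofReal_mul h0, ← ENNReal.ofReal_mul h0',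
        ← ENNReal.ofReal_add (mul_nonneg h0 (ha₁ x).1) (mul_nonneg h0' (ha₂ x).1)]
      rfl
    rw [lintegral_congr h1, lintegral_add_left (by fun_prop), lintegral_const_mul _ (by fun_prop),
      lintegral_const_mul _ (by fun_prop), ← ENNReal.ofReal_toReal hM₁',
      ← ENNReal.ofReal_toReal hM₂', ← ENNReal.ofReal_mul h0, ← ENNReal.ofReal_mul h0',
      ← ENNReal.ofReal_add (by positivity) (by positivity)]
    simp only [smul_eq_mul] at hmass
    rw [hmass, ENNReal.ofReal_one]
  · rw [Real.coe_toNNReal _ (hρ0 x)]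
    exact (ha₁ x).convexComb hconv (ha₂ x) h0 h0' haa

end Multiplier

/-! ### The rate function as an integral, and its minimizers -/

section RateFunction

variable {d : ℕ} {s β M : ℝ} {Ω : Set (EuclideanSpace ℝ (Fin d))}
  {V : EuclideanSpace ℝ (Fin d) → ℝ} {ρ ρ' : EuclideanSpace ℝ (Fin d) → ℝ≥0}

lemma IsProbDensity.integrable (hρ : IsProbDensity Ω ρ) :
    IntegrableOn (fun x => (ρ x : ℝ)) Ω := by
  refine ⟨hρ.1.coe_nnreal_real.aestronglyMeasurable, ?_⟩
  rw [hasFiniteIntegral_iff_enorm]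
  simp only [Real.enorm_eq_ofReal (NNReal.coe_nonneg _), ENNReal.ofReal_coe_nnreal, hρ.2]
  exact ENNReal.one_lt_top

lemma IsProbDensity.integral_eq_one (hρ : IsProbDensity Ω ρ) :
    ∫ x in Ω, (ρ x : ℝ) = 1 := by
  rw [integral_eq_lintegral_of_nonneg_ae (Eventually.of_forall fun x => (ρ x).coe_nonneg)
    hρ.1.coe_nnreal_real.aestronglyMeasurable]
  simp only [ENNReal.ofReal_coe_nnreal, hρ.2, ENNReal.toReal_one]

lemma potentialEnergy_eq (Ω : Set (EuclideanSpace ℝ (Fin d)))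
    (V : EuclideanSpace ℝ (Fin d) → ℝ) (ρ : EuclideanSpace ℝ (Fin d) → ℝ≥0) :
    potentialEnergy Ω V ρ = ∫⁻ x in Ω, ENNReal.ofReal (ρ x * V x) := by
  refine lintegral_congr fun x => ?_
  rw [ENNReal.ofReal_mul (ρ x).coe_nonneg, ENNReal.ofReal_coe_nnreal]

lemma integrable_mul_of_potentialEnergy_ne_top (hV : AEMeasurable V (volume.restrict Ω))
    (hV0 : ∀ᵐ x ∂(volume.restrict Ω), 0 ≤ V x) (hρ : Measurable ρ)
    (h : potentialEnergy Ω V ρ ≠ ∞) : IntegrableOn (fun x => ρ x * V x) Ω := by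
  refine ⟨(hρ.coe_nnreal_real.aemeasurable.mul hV).aestronglyMeasurable, ?_⟩
  rw [hasFiniteIntegral_iff_ofReal]
  · rw [← potentialEnergy_eq]
    exact h.lt_top
  · filter_upwards [hV0] with x hx
    exact mul_nonneg (ρ x).coe_nonneg hx

lemma potentialEnergy_eq_ofReal (hV0 : ∀ᵐ x ∂(volume.restrict Ω), 0 ≤ V x)
    (h : IntegrableOn (fun x => ρ x * V x) Ω) :
    potentialEnergy Ω V ρ = ENNReal.ofReal (∫ x in Ω, ρ x * V x) := by
  rw [potentialEnergy_eq, ofReal_integral_eq_lintegral_ofReal h]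
  filter_upwards [hV0] with x hx
  exact mul_nonneg (ρ x).coe_nonneg hx

lemma measurable_bulkFreeEnergy_comp (hd : 1 ≤ d) (hs : (d : ℝ) < s) (hβ : 0 ≤ β)
    (hρ : Measurable ρ) : Measurable fun x => bulkFreeEnergy d s β (ρ x) :=
  (continuous_bulkFreeEnergy_coe hd hs hβ).measurable.comp hρ

lemma rateFunction_eq_of_potentialEnergy_ne_top (hd : 1 ≤ d) (hs : (d : ℝ) < s)
    (h : potentialEnergy Ω V ρ ≠ ∞) :
    rateFunction s Ω V β ρ =
      ((∫⁻ x in Ω, ENNReal.ofReal (bulkFreeEnergy d s β (ρ x)) : ℝ≥0∞) : EReal)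
      - ((∫⁻ x in Ω, ENNReal.ofReal (-bulkFreeEnergy d s β (ρ x)) : ℝ≥0∞) : EReal)
      + ((ENNReal.ofReal β * potentialEnergy Ω V ρ : ℝ≥0∞) : EReal) + 1 := by
  rw [rateFunction, if_neg h]
  simp only [microFreeEnergy_eq hd hs, ← EReal.coe_neg, EReal.toENNReal_of_ne_top
    (EReal.coe_ne_top _), EReal.toReal_coe]

/-- For densities of finite free energy the rate function is a sum of convergent integrals. -/
lemma rateFunction_eq_coe (hd : 1 ≤ d) (hs : (d : ℝ) < s) (hβ : 0 ≤ β)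
    (hV0 : ∀ᵐ x ∂(volume.restrict Ω), 0 ≤ V x) (hpot : IntegrableOn (fun x => ρ x * V x) Ω)
    (hint : IntegrableOn (fun x => bulkFreeEnergy d s β (ρ x)) Ω) :
    rateFunction s Ω V β ρ =
      ((∫ x in Ω, bulkFreeEnergy d s β (ρ x)) + β * (∫ x in Ω, ρ x * V x) + 1 : ℝ) := by
  have h0 : 0 ≤ ∫ x in Ω, ρ x * V x := integral_nonneg_of_ae (by
    filter_upwards [hV0] with x hx
    exact mul_nonneg (ρ x).coe_nonneg hx)
  have hp := potentialEnergy_eq_ofReal hV0 hpot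
  have h1 : ∫⁻ x in Ω, ENNReal.ofReal (bulkFreeEnergy d s β (ρ x)) ≠ ∞ :=
    ne_top_of_le_ne_top hint.2.ne (lintegral_mono fun x => Real.ofReal_le_enorm _)
  have h2 : ∫⁻ x in Ω, ENNReal.ofReal (-bulkFreeEnergy d s β (ρ x)) ≠ ∞ :=
    ne_top_of_le_ne_top hint.2.ne (lintegral_mono fun x => by
      rw [← enorm_neg]; exact Real.ofReal_le_enorm _)
  rw [rateFunction_eq_of_potentialEnergy_ne_top hd hs (by rw [hp]; exact ENNReal.ofReal_ne_top),
    hp, ← ENNReal.ofReal_mul hβ, integral_eq_lintegral_pos_part_sub_lintegral_neg_part hint,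
    ← EReal.coe_ennreal_toReal h1, ← EReal.coe_ennreal_toReal h2,
    ← EReal.coe_ennreal_toReal ENNReal.ofReal_ne_top, ENNReal.toReal_ofReal (by positivity)]
  norm_cast

/-- The negative part of the free energy is controlled by the potential energy. -/
lemma neg_bulkFreeEnergy_le (hd : 1 ≤ d) (hs : (d : ℝ) < s) (hβ : 0 ≤ β) (M v : ℝ) (m : ℝ≥0) :
    -bulkFreeEnergy d s β m ≤ M * (m * v) + Real.exp (-M * v) := by
  have := linear_le_bulkFreeEnergy hd hs hβ (-M * v) m
  nlinarith

lemma integrable_bulkFreeEnergy_of_rateFunction_ne_top (hd : 1 ≤ d) (hs : (d : ℝ) < s)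
    (hβ : 0 ≤ β) (hV : AEMeasurable V (volume.restrict Ω))
    (hV0 : ∀ᵐ x ∂(volume.restrict Ω), 0 ≤ V x)
    (hexp : IntegrableOn (fun x => Real.exp (-M * V x)) Ω) (hρ : Measurable ρ)
    (hpot : potentialEnergy Ω V ρ ≠ ∞) (h : rateFunction s Ω V β ρ ≠ ⊤) :
    IntegrableOn (fun x => bulkFreeEnergy d s β (ρ x)) Ω := by
  have hneg : ∫⁻ x in Ω, ENNReal.ofReal (-bulkFreeEnergy d s β (ρ x)) ≠ ∞ := by
    have h1 : IntegrableOn (fun x => M * (ρ x * V x) + Real.exp (-M * V x)) Ω :=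
      ((integrable_mul_of_potentialEnergy_ne_top hV hV0 hρ hpot).const_mul M).add hexp
    refine ne_top_of_le_ne_top h1.2.ne (lintegral_mono fun x => ?_)
    exact (ENNReal.ofReal_le_ofReal (neg_bulkFreeEnergy_le hd hs hβ M (V x) (ρ x))).trans
      (Real.ofReal_le_enorm _)
  have hpos : ∫⁻ x in Ω, ENNReal.ofReal (bulkFreeEnergy d s β (ρ x)) ≠ ∞ := by
    intro htop
    refine h ?_
    rw [rateFunction_eq_of_potentialEnergy_ne_top hd hs hpot, htop, ← EReal.coe_ennreal_toReal hneg,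
      ← EReal.coe_ennreal_toReal (ENNReal.mul_ne_top ENNReal.ofReal_ne_top hpot)]
    rfl
  have hm := measurable_bulkFreeEnergy_comp hd hs hβ hρ
  refine ⟨hm.aestronglyMeasurable, ?_⟩
  rw [hasFiniteIntegral_iff_enorm]
  have h2 : ∀ x, ‖bulkFreeEnergy d s β (ρ x)‖ₑ ≤ ENNReal.ofReal (bulkFreeEnergy d s β (ρ x)) +
      ENNReal.ofReal (-bulkFreeEnergy d s β (ρ x)) := by
    intro x
    rw [← ofReal_norm, Real.norm_eq_abs]
    rcases abs_cases (bulkFreeEnergy d s β (ρ x)) with h3 | h3 <;> rw [h3.1]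
    · exact le_self_add
    · exact le_add_self
  refine (lintegral_mono h2).trans_lt ?_
  rw [lintegral_add_left hm.ennreal_ofReal]
  exact ENNReal.add_lt_top.2 ⟨hpos.lt_top, hneg.lt_top⟩

/-- A minimizer of the rate function has finite free energy as soon as there is a competitor of
finite free energy, and can then be compared with it. -/
lemma integral_le_of_forall_rateFunction_le (hd : 1 ≤ d) (hs : (d : ℝ) < s)
    (hβ : 0 ≤ β) (hV : AEMeasurable V (volume.restrict Ω))
    (hV0 : ∀ᵐ x ∂(volume.restrict Ω), 0 ≤ V x)
    (hexp : IntegrableOn (fun x => Real.exp (-M * V x)) Ω) (hρ : Measurable ρ)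
    (hpot : IntegrableOn (fun x => ρ' x * V x) Ω)
    (hint : IntegrableOn (fun x => bulkFreeEnergy d s β (ρ' x)) Ω)
    (h : rateFunction s Ω V β ρ ≤ rateFunction s Ω V β ρ') :
    IntegrableOn (fun x => ρ x * V x) Ω ∧
      IntegrableOn (fun x => bulkFreeEnergy d s β (ρ x)) Ω ∧
      (∫ x in Ω, bulkFreeEnergy d s β (ρ x)) + β * (∫ x in Ω, ρ x * V x) ≤
        (∫ x in Ω, bulkFreeEnergy d s β (ρ' x)) + β * (∫ x in Ω, ρ' x * V x) := by
  have h1 := rateFunction_eq_coe hd hs hβ hV0 hpot hint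
  have htop : rateFunction s Ω V β ρ ≠ ⊤ := by
    intro h2
    rw [h2, h1] at h
    exact (EReal.coe_lt_top _).not_ge h
  have hpot' : potentialEnergy Ω V ρ ≠ ∞ := fun h2 => htop (by rw [rateFunction, if_pos h2])
  have h2 := integrable_mul_of_potentialEnergy_ne_top hV hV0 hρ hpot'
  have h3 := integrable_bulkFreeEnergy_of_rateFunction_ne_top hd hs hβ hV hV0 hexp hρ hpot' htop
  refine ⟨h2, h3, ?_⟩
  rw [h1, rateFunction_eq_coe hd hs hβ hV0 h2 h3, EReal.coe_le_coe_iff] at h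
  linarith

/-- The first order conditions are sufficient for minimality. -/
lemma rateFunction_le_of_isArgmin (hd : 1 ≤ d) (hs : (d : ℝ) < s) (hM : 0 ≤ M) (hβ : M < β)
    (hV : AEMeasurable V (volume.restrict Ω)) (hV0 : ∀ᵐ x ∂(volume.restrict Ω), 0 ≤ V x)
    (hexp : IntegrableOn (fun x => Real.exp (-M * V x)) Ω) (hρ : IsProbDensity Ω ρ) {c : ℝ}
    (harg : ∀ᵐ x ∂(volume.restrict Ω), IsArgmin (bulkFreeEnergy d s β) (c - β * V x) (ρ x))
    (hρ' : IsProbDensity Ω ρ') : rateFunction s Ω V β ρ ≤ rateFunction s Ω V β ρ' := by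
  have hβ0 : 0 ≤ β := hM.trans hβ.le
  by_cases hpot' : potentialEnergy Ω V ρ' = ∞
  · rw [rateFunction, rateFunction, if_pos hpot']; exact le_top
  by_cases htop : rateFunction s Ω V β ρ' = ⊤
  · rw [htop]; exact le_top
  have i1 := integrable_mul_of_potentialEnergy_ne_top hV hV0 hρ'.1 hpot'
  have i2 := integrable_bulkFreeEnergy_of_rateFunction_ne_top hd hs hβ0 hV hV0 hexp hρ'.1 hpot' htop
  -- comparison with the value at `m = 0`
  have hzero : ∀ᵐ x ∂(volume.restrict Ω),
      bulkFreeEnergy d s β (ρ x) - (c - β * V x) * ρ x ≤ 0 := by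
    filter_upwards [harg] with x hx
    simpa [bulkFreeEnergy_zero hd hs hβ0] using hx.2 0 le_rfl
  have j1 : IntegrableOn (fun x => ρ x * V x) Ω := by
    have hb : IntegrableOn (fun x => (β - M)⁻¹ * (c * ρ x + Real.exp (-M * V x))) Ω :=
      ((hρ.integrable.const_mul c).add hexp).const_mul _
    refine hb.mono' (hρ.1.coe_nnreal_real.aemeasurable.mul hV).aestronglyMeasurable ?_
    filter_upwards [hzero, hV0] with x hx hx0
    rw [Real.norm_eq_abs, abs_of_nonneg (mul_nonneg (ρ x).coe_nonneg hx0),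
      le_inv_mul_iff₀ (by linarith)]
    have := neg_bulkFreeEnergy_le hd hs hβ0 M (V x) (ρ x)
    nlinarith
  have j2 : IntegrableOn (fun x => bulkFreeEnergy d s β (ρ x)) Ω := by
    have hb : IntegrableOn (fun x => |c| * ρ x + (M * (ρ x * V x) + Real.exp (-M * V x))) Ω :=
      (hρ.integrable.const_mul |c|).add ((j1.const_mul M).add hexp)
    refine hb.mono' (measurable_bulkFreeEnergy_comp hd hs hβ0 hρ.1).aestronglyMeasurable ?_
    filter_upwards [hzero, hV0] with x hx hx0
    have h1 := neg_bulkFreeEnergy_le hd hs hβ0 M (V x) (ρ x)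
    have h2 : c * ρ x ≤ |c| * ρ x := mul_le_mul_of_nonneg_right (le_abs_self c) (ρ x).coe_nonneg
    have h3 : 0 ≤ |c| * ρ x := by positivity
    have h4 : 0 ≤ β * (V x * ρ x) := mul_nonneg hβ0 (mul_nonneg hx0 (ρ x).coe_nonneg)
    have h5 : 0 ≤ M * (ρ x * V x) := mul_nonneg hM (mul_nonneg (ρ x).coe_nonneg hx0)
    have h6 := Real.exp_pos (-M * V x)
    rw [Real.norm_eq_abs, abs_le]
    constructor <;> nlinarith
  rw [rateFunction_eq_coe hd hs hβ0 hV0 j1 j2,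
    rateFunction_eq_coe hd hs hβ0 hV0 i1 i2, EReal.coe_le_coe_iff]
  have hle : ∫ x in Ω, (bulkFreeEnergy d s β (ρ x) + β * (ρ x * V x) - c * ρ x) ≤
      ∫ x in Ω, (bulkFreeEnergy d s β (ρ' x) + β * (ρ' x * V x) - c * ρ' x) := by
    refine integral_mono_ae ((j2.add (j1.const_mul β)).sub (hρ.integrable.const_mul c))
      ((i2.add (i1.const_mul β)).sub (hρ'.integrable.const_mul c)) ?_
    filter_upwards [harg] with x hx
    have := hx.2 (ρ' x) (ρ' x).coe_nonneg
    change _ ≤ _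
    linarith
  have hint : ∀ r : EuclideanSpace ℝ (Fin d) → ℝ≥0, IsProbDensity Ω r →
      IntegrableOn (fun x => r x * V x) Ω → IntegrableOn (fun x => bulkFreeEnergy d s β (r x)) Ω →
      ∫ x in Ω, (bulkFreeEnergy d s β (r x) + β * (r x * V x) - c * r x) =
        (∫ x in Ω, bulkFreeEnergy d s β (r x)) + β * (∫ x in Ω, r x * V x) - c := by
    intro r hr k1 k2
    have k3 : IntegrableOn (fun x => bulkFreeEnergy d s β (r x) + β * (r x * V x)) Ω :=
      k2.add (k1.const_mul β)
    rw [integral_sub k3 (hr.integrable.const_mul c), integral_add k2 (k1.const_mul β),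
      integral_const_mul, integral_const_mul, hr.integral_eq_one, mul_one]
  rw [hint ρ hρ j1 j2, hint ρ' hρ' i1 i2] at hle
  linarith

/-- Existence of minimizers of the rate function. -/
theorem exists_rateFunction_minimizer (hd : 1 ≤ d) (hs : (d : ℝ) < s) (hβ : 0 < β)
    (hβM : M < β) (hΩpos : 0 < volume Ω)
    (hV : AEMeasurable V (volume.restrict Ω)) (hV0 : ∀ᵐ x ∂(volume.restrict Ω), 0 ≤ V x)
    (hexp : IntegrableOn (fun x => Real.exp (-M * V x)) Ω) :
    ∃ ρ, IsProbDensity Ω ρ ∧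
      ∀ ρ', IsProbDensity Ω ρ' → rateFunction s Ω V β ρ ≤ rateFunction s Ω V β ρ' := by
  have hmono : ∀ M', M ≤ M' → IntegrableOn (fun x => Real.exp (-M' * V x)) Ω := by
    intro M' hM'
    refine hexp.mono' (Real.measurable_exp.comp_aemeasurable
      (hV.const_mul _)).aestronglyMeasurable ?_
    filter_upwards [hV0] with x hx
    rw [Real.norm_eq_abs, Real.abs_exp]
    gcongr
  set W : EuclideanSpace ℝ (Fin d) → ℝ := fun x => β * hV.mk V x with hW
  have hWm : Measurable W := hV.measurable_mk.const_mul β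
  have hWV : ∀ᵐ x ∂(volume.restrict Ω), W x = β * V x := by
    filter_upwards [hV.ae_eq_mk] with x hx
    rw [hW, hx]
  have hE : ∀ c, ∫⁻ x in Ω, ENNReal.ofReal (Real.exp (c - W x + 1)) =
      ENNReal.ofReal (Real.exp (c + 1)) * ∫⁻ x in Ω, ENNReal.ofReal (Real.exp (-β * V x)) := by
    intro c
    rw [← lintegral_const_mul' _ _ ENNReal.ofReal_ne_top]
    refine lintegral_congr_ae ?_
    filter_upwards [hWV] with x hx
    rw [← ENNReal.ofReal_mul (Real.exp_pos _).le, ← Real.exp_add, hx]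
    congr 2
    ring
  have hfin : ∫⁻ x in Ω, ENNReal.ofReal (Real.exp (-β * V x)) ≠ ∞ :=
    ne_top_of_le_ne_top (hmono β hβM.le).2.ne (lintegral_mono fun x => Real.ofReal_le_enorm _)
  obtain ⟨ρ, c, hρm, hρ1, harg⟩ := exists_density_isArgmin (μ := volume.restrict Ω)
    (continuousOn_bulkFreeEnergy hd hs hβ.le) (convexOn_bulkFreeEnergy hd hs β)
    (b := fun u => Real.exp (u + 1)) (fun u m hm h => by
      have h1 := linear_le_bulkFreeEnergy hd hs hβ.le (u + 1) ⟨m, hm⟩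
      change (u + 1) * m - Real.exp (u + 1) ≤ bulkFreeEnergy d s β m at h1
      rw [bulkFreeEnergy_zero hd hs hβ.le] at h
      linarith) hWm
    (fun c => by rw [hE]; exact ENNReal.mul_ne_top ENNReal.ofReal_ne_top hfin)
    (by
      have h1 : Tendsto (fun c : ℝ => ENNReal.ofReal (Real.exp (c + 1)) *
          ∫⁻ x in Ω, ENNReal.ofReal (Real.exp (-β * V x))) atBot (𝓝 0) := by
        have h2 : Tendsto (fun c : ℝ => Real.exp (c + 1)) atBot (𝓝 0) :=
          Real.tendsto_exp_atBot.comp (tendsto_atBot_add_const_right _ 1 tendsto_id)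
        have h3 := ENNReal.Tendsto.mul_const
          (b := ∫⁻ x in Ω, ENNReal.ofReal (Real.exp (-β * V x)))
          (ENNReal.tendsto_ofReal h2) (Or.inr hfin)
        simpa using h3
      obtain ⟨c, hc⟩ := (h1.eventually (ge_mem_nhds one_pos)).exists
      exact ⟨c, by rw [hE]; exact hc⟩)
    (by rw [Ne, Measure.restrict_eq_zero]; exact hΩpos.ne')
  refine ⟨ρ, ⟨hρm, hρ1⟩, fun ρ' hρ' => ?_⟩
  refine rateFunction_le_of_isArgmin hd hs (le_max_right M 0) (max_lt hβM hβ) hV hV0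
    (hmono _ (le_max_left _ _)) ⟨hρm, hρ1⟩ (c := c) ?_ hρ'
  filter_upwards [hWV] with x hx
  rw [← hx]
  exact harg x

end RateFunction

/-! ### Uniform densities and the infinite temperature limit -/

section Uniform

variable {d : ℕ} {s β : ℝ} {Ω : Set (EuclideanSpace ℝ (Fin d))}
  {V : EuclideanSpace ℝ (Fin d) → ℝ} {ρ ρ' : EuclideanSpace ℝ (Fin d) → ℝ≥0}

lemma withDensity_real_apply (hρ : Measurable ρ) {B : Set (EuclideanSpace ℝ (Fin d))}
    (hB : MeasurableSet B) :
    ((volume.restrict Ω).withDensity fun x => (ρ x : ℝ≥0∞)).real B =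
      ∫ x in B, (ρ x : ℝ) ∂(volume.restrict Ω) := by
  rw [measureReal_def, withDensity_apply _ hB, integral_eq_lintegral_of_nonneg_ae
    (Eventually.of_forall fun x => (ρ x).coe_nonneg) hρ.coe_nnreal_real.aestronglyMeasurable]
  simp only [ENNReal.ofReal_coe_nnreal]

/-- The total variation distance is at most the `L¹` distance of the densities. -/
lemma abs_withDensity_real_sub_le (hρ : IsProbDensity Ω ρ) (hρ' : IsProbDensity Ω ρ')
    {B : Set (EuclideanSpace ℝ (Fin d))} (hB : MeasurableSet B) :
    |((volume.restrict Ω).withDensity fun x => (ρ x : ℝ≥0∞)).real B -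
      ((volume.restrict Ω).withDensity fun x => (ρ' x : ℝ≥0∞)).real B| ≤
        ∫ x in Ω, |(ρ x : ℝ) - ρ' x| := by
  rw [withDensity_real_apply hρ.1 hB, withDensity_real_apply hρ'.1 hB,
    ← integral_sub hρ.integrable.integrableOn hρ'.integrable.integrableOn]
  exact (abs_integral_le_integral_abs).trans (setIntegral_le_integral
    (hρ.integrable.sub hρ'.integrable).abs (Eventually.of_forall fun x => abs_nonneg _))

/-- The value of the uniform probability density on `Ω`. -/
noncomputable def uniformDensity (Ω : Set (EuclideanSpace ℝ (Fin d))) : ℝ≥0 :=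
  ((volume Ω)⁻¹).toNNReal

lemma coe_uniformDensity (hΩ0 : volume Ω ≠ 0) :
    (uniformDensity Ω : ℝ≥0∞) = (volume Ω)⁻¹ :=
  ENNReal.coe_toNNReal (ENNReal.inv_ne_top.2 hΩ0)

lemma coe_uniformDensity_real : (uniformDensity Ω : ℝ) = (volume.real Ω)⁻¹ := by
  rw [uniformDensity, ENNReal.coe_toNNReal_eq_toReal, ENNReal.toReal_inv]
  rfl

lemma isProbDensity_uniformDensity (hΩ0 : volume Ω ≠ 0) (hΩt : volume Ω ≠ ∞) :
    IsProbDensity Ω fun _ => uniformDensity Ω := by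
  refine ⟨measurable_const, ?_⟩
  rw [lintegral_const, coe_uniformDensity hΩ0, Measure.restrict_apply_univ,
    ENNReal.inv_mul_cancel hΩ0 hΩt]

lemma cond_eq_withDensity_uniformDensity (hΩ0 : volume Ω ≠ 0) :
    volume[|Ω] = (volume.restrict Ω).withDensity fun _ => (uniformDensity Ω : ℝ≥0∞) := by
  rw [withDensity_const, coe_uniformDensity hΩ0]
  rfl

/-- Without external field the uniform density is a minimizer, by convexity of the free energy per
unit volume. -/
lemma isMinimizerOn_uniform (hd : 1 ≤ d) (hs : (d : ℝ) < s) (hβ : 0 < β) (hΩ : MeasurableSet Ω)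
    (hΩ0 : volume Ω ≠ 0) (hΩt : volume Ω ≠ ∞) (hV : ∀ x ∈ Ω, V x = 0) :
    IsMinimizerOn Ω (rateFunction s Ω V β) (volume[|Ω]) := by
  have hv : 0 < volume.real Ω := ENNReal.toReal_pos hΩ0 hΩt
  have hVae : ∀ᵐ x ∂(volume.restrict Ω), V x = 0 := (ae_restrict_mem hΩ).mono hV
  have hV0 : ∀ᵐ x ∂(volume.restrict Ω), 0 ≤ V x := hVae.mono fun x hx => hx.ge
  have hVm : AEMeasurable V (volume.restrict Ω) := ⟨fun _ => 0, measurable_const, hVae⟩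
  have hfin : IsFiniteMeasure ((volume : Measure (EuclideanSpace ℝ (Fin d))).restrict Ω) :=
    ⟨by simpa using hΩt.lt_top⟩
  have hexp : IntegrableOn (fun x => Real.exp (-0 * V x)) Ω := by simp [IntegrableOn]
  refine ⟨fun _ => uniformDensity Ω, isProbDensity_uniformDensity hΩ0 hΩt,
    cond_eq_withDensity_uniformDensity hΩ0, fun ρ hρ => ?_⟩
  have hpot : ∀ r : EuclideanSpace ℝ (Fin d) → ℝ≥0, (fun x => r x * V x) =ᵐ[volume.restrict Ω]
      fun _ => 0 := fun r => hVae.mono fun x hx => by simp [hx]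
  have hpoti : ∀ r : EuclideanSpace ℝ (Fin d) → ℝ≥0, IntegrableOn (fun x => r x * V x) Ω :=
    fun r => (integrable_zero _ _ _).congr (hpot r).symm
  have hpotz : ∀ r : EuclideanSpace ℝ (Fin d) → ℝ≥0, ∫ x in Ω, r x * V x = 0 :=
    fun r => by rw [integral_congr_ae (hpot r), integral_zero]
  by_cases htop : rateFunction s Ω V β ρ = ⊤
  · rw [htop]; exact le_top
  have hi := integrable_bulkFreeEnergy_of_rateFunction_ne_top hd hs hβ.le hVm hV0 hexp hρ.1
    (by rw [potentialEnergy_eq_ofReal hV0 (hpoti ρ)]; exact ENNReal.ofReal_ne_top) htop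
  rw [rateFunction_eq_coe hd hs hβ.le hV0 (hpoti _) (integrable_const _),
    rateFunction_eq_coe hd hs hβ.le hV0 (hpoti _) hi, EReal.coe_le_coe_iff, hpotz, hpotz]
  have hj := (convexOn_bulkFreeEnergy hd hs β).map_set_average_le
    (continuousOn_bulkFreeEnergy hd hs hβ.le) isClosed_Ici hΩ0 hΩt
    (Eventually.of_forall fun x => (ρ x).coe_nonneg) hρ.integrable hi
  rw [setAverage_eq, setAverage_eq, hρ.integral_eq_one, smul_eq_mul, smul_eq_mul, mul_one,
    ← coe_uniformDensity_real] at hj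
  have h1 : ∫ _ in Ω, bulkFreeEnergy d s β (uniformDensity Ω) =
      volume.real Ω * bulkFreeEnergy d s β (uniformDensity Ω) := by
    simp [measureReal_def]
  rw [h1]
  have h2 : volume.real Ω * bulkFreeEnergy d s β (uniformDensity Ω) ≤
      ∫ x in Ω, bulkFreeEnergy d s β (ρ x) := by
    have h3 := mul_le_mul_of_nonneg_left hj hv.le
    rw [← mul_assoc, coe_uniformDensity_real, mul_inv_cancel₀ hv.ne', one_mul] at h3
    rwa [coe_uniformDensity_real]
  linarith

/-- The tangent lines of slopes `log a ± η` to the entropy control the distance to `a`. -/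
lemma abs_sub_le_bulkFreeEnergy (hd : 1 ≤ d) (hs : (d : ℝ) < s) (hβ : 0 ≤ β) {a : ℝ} (ha : 0 < a)
    {η : ℝ} (hη : 0 < η) (hη1 : η ≤ 1) (m : ℝ≥0) :
    |(m : ℝ) - a| ≤ η⁻¹ * (bulkFreeEnergy d s β m - (Real.log a * m - a)) + a * η := by
  have h1 := linear_le_bulkFreeEnergy hd hs hβ (Real.log a + η) m
  have h2 := linear_le_bulkFreeEnergy hd hs hβ (Real.log a + -η) m
  rw [Real.exp_add, Real.exp_log ha] at h1 h2
  have e1 := (abs_le.1 (Real.abs_exp_sub_one_sub_id_le (x := η) (by rwa [abs_of_pos hη]))).2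
  have e2 := (abs_le.1 (Real.abs_exp_sub_one_sub_id_le (x := -η)
    (by rwa [abs_neg, abs_of_pos hη]))).2
  have e3 := mul_le_mul_of_nonneg_left e1 ha.le
  have e4 := mul_le_mul_of_nonneg_left e2 ha.le
  have hsplit : η⁻¹ * (bulkFreeEnergy d s β m - (Real.log a * m - a)) + a * η =
      (bulkFreeEnergy d s β m - (Real.log a * m - a) + a * η ^ 2) / η := by
    field_simp
  rw [hsplit, le_div_iff₀ hη]
  rcases abs_cases ((m : ℝ) - a) with h | h <;> rw [h.1] <;> nlinarith

/-- As `β → 0` the minimizing densities converge in `L¹` to the uniform density, uniformly. -/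
lemma eventually_integral_abs_sub_uniform_le (hd : 1 ≤ d) (hs : (d : ℝ) < s)
    (hΩ0 : volume Ω ≠ 0) (hΩt : volume Ω ≠ ∞) (hVm : AEMeasurable V (volume.restrict Ω))
    (hV0 : ∀ᵐ x ∂(volume.restrict Ω), 0 ≤ V x) {b : ℝ}
    (hVb : ∀ᵐ x ∂(volume.restrict Ω), V x ≤ b) {ε : ℝ} (hε : 0 < ε) :
    ∀ᶠ β in 𝓝[>] (0 : ℝ), ∀ ρ, IsProbDensity Ω ρ →
      (∀ ρ', IsProbDensity Ω ρ' → rateFunction s Ω V β ρ ≤ rateFunction s Ω V β ρ') →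
        ∫ x in Ω, |(ρ x : ℝ) - uniformDensity Ω| ≤ ε := by
  have hv : 0 < volume.real Ω := ENNReal.toReal_pos hΩ0 hΩt
  have hfin : IsFiniteMeasure ((volume : Measure (EuclideanSpace ℝ (Fin d))).restrict Ω) :=
    ⟨by simpa using hΩt.lt_top⟩
  set v := volume.real Ω with hvdef
  set a : ℝ := (uniformDensity Ω : ℝ) with ha
  have hav : a = v⁻¹ := coe_uniformDensity_real
  have ha0 : 0 < a := by rw [hav]; positivity
  have hav1 : a * v = 1 := by rw [hav, inv_mul_cancel₀ hv.ne']
  have hu := isProbDensity_uniformDensity hΩ0 hΩt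
  set η := min 1 (ε / 2) with hη
  have hη0 : 0 < η := lt_min one_pos (half_pos hε)
  -- compare with the uniform density, at which the energy is a bounded multiple of `β`
  obtain ⟨K, hK0, hK⟩ := exists_bulkFreeEnergy_le_entropy hd hs (uniformDensity Ω)
    (show 0 < ε * η / 4 * a by positivity)
  have hsmall : ∀ᶠ β in 𝓝[>] (0 : ℝ), β * (v * K + b) ≤ ε * η / 4 := by
    have h1 : Tendsto (fun β : ℝ => β * (v * K + b)) (𝓝[>] 0) (𝓝 0) := by
      have : ContinuousAt (fun β : ℝ => β * (v * K + b)) 0 := by fun_prop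
      have h2 := this.tendsto
      rw [zero_mul] at h2
      exact h2.mono_left nhdsWithin_le_nhds
    exact h1.eventually (ge_mem_nhds (by positivity))
  filter_upwards [hsmall, self_mem_nhdsWithin] with β hβs hβ ρ hρ hmin
  have hβ0 : 0 < β := hβ
  have hexp : IntegrableOn (fun x => Real.exp (-0 * V x)) Ω := by simp [IntegrableOn]
  have hVi : IntegrableOn V Ω := by
    refine (integrable_const b).mono' hVm.aestronglyMeasurable ?_
    filter_upwards [hV0, hVb] with x hx hx'
    rwa [Real.norm_eq_abs, abs_of_nonneg hx]
  obtain ⟨j1, j2, hle⟩ := integral_le_of_forall_rateFunction_le hd hs hβ0.le hVm hV0 hexp hρ.1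
    (hVi.const_mul _) (integrable_const _) (hmin _ hu)
  have k1 : 0 ≤ ∫ x in Ω, ρ x * V x := integral_nonneg_of_ae (by
    filter_upwards [hV0] with x hx
    exact mul_nonneg (ρ x).coe_nonneg hx)
  have k2 : ∫ x in Ω, (uniformDensity Ω : ℝ) * V x ≤ b := by
    calc ∫ x in Ω, (uniformDensity Ω : ℝ) * V x ≤ ∫ _ in Ω, a * b := by
          refine integral_mono_ae (hVi.const_mul _) (integrable_const _) ?_
          filter_upwards [hVb] with x hx
          exact mul_le_mul_of_nonneg_left hx ha0.le
      _ = (a * v) * b := by simp [measureReal_def, hvdef]; ring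
      _ = b := by rw [hav1, one_mul]
  have k3 : ∫ _ in Ω, bulkFreeEnergy d s β (uniformDensity Ω) =
      v * bulkFreeEnergy d s β (uniformDensity Ω) := by
    simp [measureReal_def, hvdef]
  rw [k3] at hle
  have k4 := mul_le_mul_of_nonneg_left (hK β hβ0.le) hv.le
  have k5 : ∫ x in Ω, bulkFreeEnergy d s β (ρ x) ≤ Real.log a - 1 + ε * η / 2 := by
    have h1 : 0 ≤ β * ∫ x in Ω, ρ x * V x := by positivity
    have h2 := mul_le_mul_of_nonneg_left k2 hβ0.le
    have h3 : v * (β * K + (a * Real.log a - a + ε * η / 4 * a)) + β * b =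
        β * (v * K + b) + (a * v) * (Real.log a - 1 + ε * η / 4) := by ring
    rw [hav1, one_mul] at h3
    linarith
  have i1 : IntegrableOn (fun x => Real.log a * ρ x - a) Ω :=
    (hρ.integrable.const_mul _).sub (integrable_const _)
  have i2 : IntegrableOn (fun x => bulkFreeEnergy d s β (ρ x) - (Real.log a * ρ x - a)) Ω :=
    j2.sub i1
  have hint : ∫ x in Ω, (η⁻¹ * (bulkFreeEnergy d s β (ρ x) - (Real.log a * ρ x - a)) + a * η) =
      η⁻¹ * ((∫ x in Ω, bulkFreeEnergy d s β (ρ x)) - (Real.log a - 1)) + η := by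
    rw [integral_add (i2.const_mul _) (integrable_const _), integral_const_mul, integral_sub j2 i1,
      integral_sub (hρ.integrable.const_mul _) (integrable_const _), integral_const_mul,
      hρ.integral_eq_one, integral_const, integral_const]
    have : (volume.restrict Ω).real univ = v := by simp [measureReal_def, hvdef]
    rw [this, smul_eq_mul, smul_eq_mul, mul_one, mul_comm v a, hav1, ← mul_assoc, mul_comm v a,
      hav1, one_mul]
  calc ∫ x in Ω, |(ρ x : ℝ) - uniformDensity Ω|
      ≤ ∫ x in Ω, (η⁻¹ * (bulkFreeEnergy d s β (ρ x) - (Real.log a * ρ x - a)) + a * η) :=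
        integral_mono (hρ.integrable.sub hu.integrable).abs
          ((i2.const_mul _).add (integrable_const _))
          fun x => abs_sub_le_bulkFreeEnergy hd hs hβ0.le ha0 hη0 (min_le_left _ _) (ρ x)
    _ = _ := hint
    _ ≤ η⁻¹ * (ε * η / 2) + ε / 2 := by
        refine add_le_add (mul_le_mul_of_nonneg_left (by linarith) (by positivity))
          (min_le_right _ _)
    _ = ε := by field_simp; ring

end Uniform

/-! ### The ground state functional -/

section Ground

/-- A scalar Clarkson inequality: uniform convexity of `x ^ p`. -/
lemma two_mul_rpow_add_le {p : ℝ} (hp : 2 ≤ p) {x y : ℝ} (hx : 0 ≤ x) (hy : 0 ≤ y) :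
    2 * ((x + y) / 2) ^ p + 2 * (|x - y| / 2) ^ p ≤ x ^ p + y ^ p := by
  have hq : 1 ≤ p / 2 := by linarith
  have hsq : ∀ z : ℝ, 0 ≤ z → (z ^ 2) ^ (p / 2) = z ^ p := fun z hz => by
    rw [← Real.rpow_natCast, ← Real.rpow_mul hz]
    congr 1
    push_cast; ring
  have h1 := (convexOn_rpow hq).2 (mem_Ici.2 (sq_nonneg x)) (mem_Ici.2 (sq_nonneg y))
    (show (0 : ℝ) ≤ 1 / 2 by norm_num) (show (0 : ℝ) ≤ 1 / 2 by norm_num) (by norm_num)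
  simp only [smul_eq_mul, hsq x hx, hsq y hy] at h1
  have h2 := Real.add_rpow_le_rpow_add (sq_nonneg ((x + y) / 2)) (sq_nonneg (|x - y| / 2)) hq
  rw [hsq _ (by positivity), hsq _ (by positivity)] at h2
  have h3 : ((x + y) / 2) ^ 2 + (|x - y| / 2) ^ 2 = 1 / 2 * x ^ 2 + 1 / 2 * y ^ 2 := by
    rw [div_pow, div_pow, sq_abs]; ring
  rw [h3] at h2
  linarith

variable {c p : ℝ}

lemma le_rpow_of_mul_rpow_le (hc : 0 < c) (hp : 1 < p) {u m : ℝ} (hm : 0 ≤ m)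
    (h : c * m ^ p ≤ u * m) : m ≤ (max u 0 / c) ^ (1 / (p - 1)) := by
  rcases hm.eq_or_lt with rfl | hm0
  · positivity
  have hp1 : 0 < p - 1 := by linarith
  have h1 : m ^ (p - 1) ≤ max u 0 / c := by
    rw [le_div_iff₀ hc, Real.rpow_sub_one hm0.ne', div_mul_eq_mul_div, div_le_iff₀ hm0]
    have := mul_le_mul_of_nonneg_right (le_max_left u 0) hm
    linarith
  calc m = (m ^ (p - 1)) ^ (1 / (p - 1)) := by
        rw [← Real.rpow_mul hm, mul_one_div_cancel hp1.ne', Real.rpow_one]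
    _ ≤ _ := Real.rpow_le_rpow (by positivity) h1 (by positivity)

lemma IsArgmin.mul_rpow_le (hp : p ≠ 0) {u a : ℝ} (h : IsArgmin (fun m => c * m ^ p) u a) :
    c * a ^ p ≤ u * a := by
  have := h.2 0 le_rfl
  simp only [Real.zero_rpow hp, mul_zero, sub_zero] at this
  linarith

lemma IsArgmin.eq_zero_of_nonpos (hc : 0 < c) (hp : 1 < p) {u a : ℝ}
    (h : IsArgmin (fun m => c * m ^ p) u a) (hu : u ≤ 0) : a = 0 := by
  have h1 := le_rpow_of_mul_rpow_le hc hp h.1 (h.mul_rpow_le (by linarith))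
  rw [max_eq_right hu, zero_div, Real.zero_rpow (by
    have : 0 < p - 1 := by linarith
    positivity)] at h1
  exact le_antisymm h1 h.1

/-- Stability of the pointwise minimizers of the ground state functional. -/
lemma IsArgmin.rpow_abs_sub_le (hc : 0 < c) (hp : 2 ≤ p) {u a m : ℝ}
    (h : IsArgmin (fun m => c * m ^ p) u a) (hm : 0 ≤ m) :
    2 * c * (|m - a| / 2) ^ p ≤ (c * m ^ p - u * m) - (c * a ^ p - u * a) := by
  have h1 := h.2 ((m + a) / 2) (by have := h.1; positivity)
  have h2 := mul_le_mul_of_nonneg_left (two_mul_rpow_add_le hp hm h.1) hc.le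
  simp only at h1
  linarith

lemma IsArgmin.abs_sub_le (hc : 0 < c) (hp : 2 ≤ p) {u a m η : ℝ}
    (h : IsArgmin (fun m => c * m ^ p) u a) (hm : 0 ≤ m) (hη : 0 < η) :
    |m - a| ≤ η + 2 ^ p / (2 * c * η ^ (p - 1)) *
      ((c * m ^ p - u * m) - (c * a ^ p - u * a)) := by
  have h1 := h.rpow_abs_sub_le hc hp hm
  have h0 : 0 ≤ (c * m ^ p - u * m) - (c * a ^ p - u * a) := le_trans (by positivity) h1
  rcases le_or_gt |m - a| η with h2 | h2
  · exact h2.trans (le_add_of_nonneg_right (by positivity))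
  · refine le_trans ?_ (le_add_of_nonneg_left hη.le)
    have hpos : 0 < |m - a| := hη.trans h2
    rw [div_mul_eq_mul_div, le_div_iff₀ (by positivity)]
    have h3 : η ^ (p - 1) ≤ |m - a| ^ (p - 1) :=
      Real.rpow_le_rpow hη.le h2.le (by linarith)
    have h4 : |m - a| * |m - a| ^ (p - 1) = |m - a| ^ p := by
      rw [Real.rpow_sub_one hpos.ne']; field_simp
    rw [Real.div_rpow hpos.le zero_le_two] at h1
    calc |m - a| * (2 * c * η ^ (p - 1)) ≤ |m - a| * (2 * c * |m - a| ^ (p - 1)) := by gcongr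
      _ = 2 ^ p * (2 * c * (|m - a| ^ p / 2 ^ p)) := by
          rw [← h4]; field_simp
      _ ≤ _ := by gcongr

variable {α : Type*} [MeasurableSpace α] {μ : Measure α} {V : α → ℝ} {ρ ρ₀ : α → ℝ≥0} {l M : ℝ}

lemma measure_le_lt_top_of_integrable_exp (hM : 0 ≤ M)
    (hexp : Integrable (fun x => Real.exp (-M * V x)) μ) (l : ℝ) : μ {x | V x ≤ l} < ∞ := by
  refine (measure_mono fun x (hx : V x ≤ l) => ?_).trans_lt
    (hexp.measure_ge_lt_top (Real.exp_pos (-M * l)))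
  exact Real.exp_le_exp.2 (by nlinarith)

/-- Existence of a density which satisfies the first order conditions for the ground state
functional. -/
lemma exists_density_isArgmin_rpow (hc : 0 < c) (hp : 1 < p) (hM : 0 ≤ M) (hμ : μ ≠ 0)
    (hV : AEMeasurable V μ) (hV0 : ∀ᵐ x ∂μ, 0 ≤ V x)
    (hexp : Integrable (fun x => Real.exp (-M * V x)) μ) :
    ∃ (ρ : α → ℝ≥0) (l : ℝ), Measurable ρ ∧ ∫⁻ x, ρ x ∂μ = 1 ∧
      ∀ᵐ x ∂μ, IsArgmin (fun m => c * m ^ p) (l - V x) (ρ x) := by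
  have hp1 : 0 < 1 / (p - 1) := one_div_pos.2 (by linarith)
  set b : ℝ → ℝ := fun u => (max u 0 / c) ^ (1 / (p - 1)) with hb
  have hbm : Monotone b := fun u u' huu' =>
    Real.rpow_le_rpow (by positivity) (by gcongr) hp1.le
  have hb0 : ∀ u, u ≤ 0 → b u = 0 := fun u hu => by
    rw [hb]; simp only [max_eq_right hu, zero_div, Real.zero_rpow hp1.ne']
  have hVW := hV.ae_eq_mk
  obtain ⟨ρ, l, hρ, hρ1, harg⟩ := exists_density_isArgmin (μ := μ) (f := fun m => c * m ^ p)
    (b := b) (W := hV.mk V) (by fun_prop (disch := linarith)) ((convexOn_rpow hp.le).smul hc.le)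
    (fun u m hm h => le_rpow_of_mul_rpow_le hc hp hm (by
      simp only [Real.zero_rpow (show p ≠ 0 by linarith), mul_zero] at h
      linarith)) hV.measurable_mk
    (fun l => by
      have h1 : ∫⁻ x, ENNReal.ofReal (b (l - hV.mk V x)) ∂μ ≤
          ∫⁻ x, {x | V x ≤ l}.indicator (fun _ => ENNReal.ofReal (b l)) x ∂μ := by
        refine lintegral_mono_ae ?_
        filter_upwards [hVW, hV0] with x hx hx0
        rw [← hx]
        by_cases h : V x ≤ l
        · rw [indicator_of_mem (by exact h)]
          exact ENNReal.ofReal_le_ofReal (hbm (by linarith))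
        · rw [hb0 _ (by linarith), ENNReal.ofReal_zero]
          exact zero_le
      refine ne_top_of_le_ne_top ?_ (h1.trans (lintegral_indicator_const_le _ _))
      exact ENNReal.mul_ne_top ENNReal.ofReal_ne_top
        (measure_le_lt_top_of_integrable_exp hM hexp l).ne)
    ⟨0, by
      have h1 : ∫⁻ x, ENNReal.ofReal (b (0 - hV.mk V x)) ∂μ = 0 := by
        refine (lintegral_congr_ae (g := fun _ => 0) ?_).trans lintegral_zero
        filter_upwards [hVW, hV0] with x hx hx0
        rw [← hx, hb0 _ (by linarith), ENNReal.ofReal_zero]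
      rw [h1]
      exact zero_le⟩ hμ
  refine ⟨ρ, l, hρ, hρ1, ?_⟩
  filter_upwards [hVW] with x hx
  rw [hx]
  exact harg x

lemma ae_le_of_isArgmin (hc : 0 < c) (hp : 1 < p) (hV0 : ∀ᵐ x ∂μ, 0 ≤ V x)
    (harg : ∀ᵐ x ∂μ, IsArgmin (fun m => c * m ^ p) (l - V x) (ρ₀ x)) :
    ∀ᵐ x ∂μ, (ρ₀ x : ℝ) ≤ (max l 0 / c) ^ (1 / (p - 1)) := by
  filter_upwards [harg, hV0] with x hx hx0
  refine (le_rpow_of_mul_rpow_le hc hp hx.1 (hx.mul_rpow_le (by linarith))).trans ?_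
  refine Real.rpow_le_rpow (by positivity) ?_ (one_div_pos.2 (by linarith)).le
  gcongr
  linarith

/-- Functions of `ρ₀` which vanish with `ρ₀` are integrable. -/
lemma integrable_of_isArgmin (hc : 0 < c) (hp : 1 < p) (hM : 0 ≤ M) (hV : AEMeasurable V μ)
    (hexp : Integrable (fun x => Real.exp (-M * V x)) μ)
    (harg : ∀ᵐ x ∂μ, IsArgmin (fun m => c * m ^ p) (l - V x) (ρ₀ x)) {g : α → ℝ}
    (hg : AEStronglyMeasurable g μ) {K : ℝ}
    (hK : ∀ᵐ x ∂μ, V x ≤ l → |g x| ≤ K) (h0 : ∀ᵐ x ∂μ, ρ₀ x = 0 → g x = 0) : Integrable g μ := by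
  have hS : NullMeasurableSet {x | V x ≤ l} μ := nullMeasurableSet_le hV aemeasurable_const
  have hi : Integrable ({x | V x ≤ l}.indicator fun _ => K) μ :=
    (integrableOn_const
      (measure_le_lt_top_of_integrable_exp hM hexp l).ne).integrable_indicator₀ hS
  refine hi.mono' hg ?_
  filter_upwards [harg, hK, h0] with x hx hxK hx0
  rw [Real.norm_eq_abs]
  by_cases h : V x ≤ l
  · rw [indicator_of_mem (by exact h)]
    exact hxK h
  · rw [indicator_of_notMem (by exact h), hx0, abs_zero]
    exact NNReal.coe_injective (hx.eq_zero_of_nonpos hc hp (by linarith))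

lemma integrable_rpow_of_isArgmin (hc : 0 < c) (hp : 1 < p) (hM : 0 ≤ M) (hV : AEMeasurable V μ)
    (hV0 : ∀ᵐ x ∂μ, 0 ≤ V x) (hexp : Integrable (fun x => Real.exp (-M * V x)) μ)
    (hρ : Measurable ρ₀)
    (harg : ∀ᵐ x ∂μ, IsArgmin (fun m => c * m ^ p) (l - V x) (ρ₀ x)) :
    Integrable (fun x => (ρ₀ x : ℝ) ^ p) μ ∧ Integrable (fun x => ρ₀ x * V x) μ := by
  have hb := ae_le_of_isArgmin hc hp hV0 harg
  constructor
  · refine integrable_of_isArgmin hc hp hM hV hexp harg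
      (hρ.coe_nnreal_real.pow_const p).aestronglyMeasurable
      (K := ((max l 0 / c) ^ (1 / (p - 1))) ^ p) ?_ ?_
    · filter_upwards [hb] with x hx _
      rw [abs_of_nonneg (by positivity)]
      exact Real.rpow_le_rpow (ρ₀ x).coe_nonneg hx (by linarith)
    · refine Eventually.of_forall fun x hx => ?_
      rw [hx, NNReal.coe_zero, Real.zero_rpow (by linarith)]
  · refine integrable_of_isArgmin hc hp hM hV hexp harg
      (hρ.coe_nnreal_real.aemeasurable.mul hV).aestronglyMeasurable
      (K := (max l 0 / c) ^ (1 / (p - 1)) * l) ?_ ?_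
    · filter_upwards [hb, hV0] with x hx hx0 hxl
      rw [abs_of_nonneg (mul_nonneg (ρ₀ x).coe_nonneg hx0)]
      exact mul_le_mul hx hxl hx0 (by positivity)
    · refine Eventually.of_forall fun x hx => ?_
      rw [hx, NNReal.coe_zero, zero_mul]

lemma integral_rpow_sub_eq (c : ℝ) (l : ℝ) (hρ : Integrable (fun x => (ρ x : ℝ)) μ)
    (hρ1 : ∫ x, (ρ x : ℝ) ∂μ = 1) (h1 : Integrable (fun x => (ρ x : ℝ) ^ p) μ)
    (h2 : Integrable (fun x => ρ x * V x) μ) :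
    Integrable (fun x => c * (ρ x : ℝ) ^ p - (l - V x) * ρ x) μ ∧
      ∫ x, (c * (ρ x : ℝ) ^ p - (l - V x) * ρ x) ∂μ =
        c * (∫ x, (ρ x : ℝ) ^ p ∂μ) + (∫ x, ρ x * V x ∂μ) - l := by
  have h3 : ∀ x, c * (ρ x : ℝ) ^ p - (l - V x) * ρ x =
      c * (ρ x : ℝ) ^ p + (ρ x * V x - l * ρ x) := fun x => by ring
  have h4 : Integrable (fun x => ρ x * V x - l * ρ x) μ := h2.sub (hρ.const_mul l)
  simp only [h3]
  refine ⟨(h1.const_mul c).add h4, ?_⟩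
  rw [integral_add (h1.const_mul c) h4, integral_sub h2 (hρ.const_mul l), integral_const_mul,
    integral_const_mul, hρ1]
  ring

/-- Stability of the minimizer of the ground state functional: an almost minimizing density is
close to `ρ₀` in `L¹`. -/
lemma integral_abs_sub_le_of_isArgmin (hc : 0 < c) (hp : 2 ≤ p) (hM : 0 ≤ M)
    (hV : AEMeasurable V μ) (hV0 : ∀ᵐ x ∂μ, 0 ≤ V x)
    (hexp : Integrable (fun x => Real.exp (-M * V x)) μ) (hρ₀ : Measurable ρ₀)
    (hρ₀i : Integrable (fun x => (ρ₀ x : ℝ)) μ) (hρ₀1 : ∫ x, (ρ₀ x : ℝ) ∂μ = 1)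
    (harg : ∀ᵐ x ∂μ, IsArgmin (fun m => c * m ^ p) (l - V x) (ρ₀ x)) {η : ℝ} (hη : 0 < η)
    (hρi : Integrable (fun x => (ρ x : ℝ)) μ) (hρ1 : ∫ x, (ρ x : ℝ) ∂μ = 1)
    (h1 : Integrable (fun x => (ρ x : ℝ) ^ p) μ) (h2 : Integrable (fun x => ρ x * V x) μ) :
    ∫ x, |(ρ x : ℝ) - ρ₀ x| ∂μ ≤ η * μ.real {x | V x ≤ l + 1} +
      (2 ^ p / (2 * c * η ^ (p - 1)) + 1) *
        ((c * (∫ x, (ρ x : ℝ) ^ p ∂μ) + ∫ x, ρ x * V x ∂μ) -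
          (c * (∫ x, (ρ₀ x : ℝ) ^ p ∂μ) + ∫ x, ρ₀ x * V x ∂μ)) := by
  obtain ⟨k1, k2⟩ := integrable_rpow_of_isArgmin hc (by linarith) hM hV hV0 hexp hρ₀ harg
  obtain ⟨e1, e2⟩ := integral_rpow_sub_eq c l hρi hρ1 h1 h2
  obtain ⟨e3, e4⟩ := integral_rpow_sub_eq c l hρ₀i hρ₀1 k1 k2
  set K := 2 ^ p / (2 * c * η ^ (p - 1)) with hK
  have hK0 : 0 ≤ K := by positivity
  have hS : NullMeasurableSet {x | V x ≤ l + 1} μ := nullMeasurableSet_le hV aemeasurable_const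
  have hi : Integrable ({x | V x ≤ l + 1}.indicator fun _ => η) μ :=
    (integrableOn_const
      (measure_le_lt_top_of_integrable_exp hM hexp _).ne).integrable_indicator₀ hS
  have e5 : Integrable (fun x => (K + 1) * ((c * (ρ x : ℝ) ^ p - (l - V x) * ρ x) -
      (c * (ρ₀ x : ℝ) ^ p - (l - V x) * ρ₀ x))) μ := (e1.sub e3).const_mul _
  have hle : ∫ x, |(ρ x : ℝ) - ρ₀ x| ∂μ ≤ ∫ x, ({x | V x ≤ l + 1}.indicator (fun _ => η) x +
      (K + 1) * ((c * (ρ x : ℝ) ^ p - (l - V x) * ρ x) -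
        (c * (ρ₀ x : ℝ) ^ p - (l - V x) * ρ₀ x))) ∂μ := by
    refine integral_mono_ae (hρi.sub hρ₀i).abs (hi.add e5) ?_
    filter_upwards [harg] with x hx
    change |(ρ x : ℝ) - ρ₀ x| ≤ _
    have h0 := (hx.rpow_abs_sub_le hc hp (ρ x).coe_nonneg)
    have h0' : 0 ≤ (c * (ρ x : ℝ) ^ p - (l - V x) * ρ x) -
        (c * (ρ₀ x : ℝ) ^ p - (l - V x) * ρ₀ x) := le_trans (by positivity) h0
    by_cases h : V x ≤ l + 1
    · rw [indicator_of_mem (by exact h)]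
      have := hx.abs_sub_le hc hp (ρ x).coe_nonneg hη
      linarith
    · -- far away `ρ₀` vanishes and the excess is at least `ρ`
      rw [indicator_of_notMem (by exact h), zero_add]
      have hz := hx.eq_zero_of_nonpos hc (by linarith) (by linarith)
      rw [hz, sub_zero, abs_of_nonneg (ρ x).coe_nonneg]
      rw [hz] at h0'
      simp only [Real.zero_rpow (show p ≠ 0 by linarith), mul_zero, sub_zero] at h0' ⊢
      have h5 : (ρ x : ℝ) ≤ c * (ρ x : ℝ) ^ p - (l - V x) * ρ x := by
        have h6 : 0 ≤ c * (ρ x : ℝ) ^ p := by positivity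
        have h7 : (1 : ℝ) * ρ x ≤ (V x - l) * ρ x :=
          mul_le_mul_of_nonneg_right (by linarith) (ρ x).coe_nonneg
        linarith
      have h8 := mul_nonneg hK0 h0'
      linarith
  refine hle.trans (le_of_eq ?_)
  rw [integral_add hi e5, integral_const_mul, integral_sub e1 e3, e2, e4,
    integral_indicator₀ hS, setIntegral_const, smul_eq_mul]
  ring

/-- Minimality in the ground state functional. -/
lemma integral_le_of_isArgmin (hc : 0 < c) (hp : 1 < p) (hM : 0 ≤ M)
    (hV : AEMeasurable V μ) (hV0 : ∀ᵐ x ∂μ, 0 ≤ V x)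
    (hexp : Integrable (fun x => Real.exp (-M * V x)) μ) (hρ₀ : Measurable ρ₀)
    (hρ₀i : Integrable (fun x => (ρ₀ x : ℝ)) μ) (hρ₀1 : ∫ x, (ρ₀ x : ℝ) ∂μ = 1)
    (harg : ∀ᵐ x ∂μ, IsArgmin (fun m => c * m ^ p) (l - V x) (ρ₀ x))
    (hρi : Integrable (fun x => (ρ x : ℝ)) μ) (hρ1 : ∫ x, (ρ x : ℝ) ∂μ = 1)
    (h1 : Integrable (fun x => (ρ x : ℝ) ^ p) μ) (h2 : Integrable (fun x => ρ x * V x) μ) :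
    c * (∫ x, (ρ₀ x : ℝ) ^ p ∂μ) + ∫ x, ρ₀ x * V x ∂μ ≤
      c * (∫ x, (ρ x : ℝ) ^ p ∂μ) + ∫ x, ρ x * V x ∂μ := by
  obtain ⟨k1, k2⟩ := integrable_rpow_of_isArgmin hc hp hM hV hV0 hexp hρ₀ harg
  obtain ⟨e1, e2⟩ := integral_rpow_sub_eq c l hρi hρ1 h1 h2
  obtain ⟨e3, e4⟩ := integral_rpow_sub_eq c l hρ₀i hρ₀1 k1 k2
  have := integral_mono_ae e3 e1 (by
    filter_upwards [harg] with x hx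
    exact hx.2 (ρ x) (ρ x).coe_nonneg)
  rw [e2, e4] at this
  linarith

end Ground

/-! ### The zero temperature limit -/

section LowTemperature

variable {d : ℕ} {s M : ℝ} {Ω : Set (EuclideanSpace ℝ (Fin d))}
  {V : EuclideanSpace ℝ (Fin d) → ℝ} {ρ ρ₀ : EuclideanSpace ℝ (Fin d) → ℝ≥0} {l : ℝ}

lemma coe_rpow_eq_ofReal (x : ℝ≥0) {p : ℝ} (hp : 0 ≤ p) :
    (x : ℝ≥0∞) ^ p = ENNReal.ofReal ((x : ℝ) ^ p) := by
  rw [← ENNReal.ofReal_rpow_of_nonneg x.coe_nonneg hp, ENNReal.ofReal_coe_nnreal]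

lemma groundFunctional_eq_coe (hd : 1 ≤ d) (hs : (d : ℝ) < s)
    (hV0 : ∀ᵐ x ∂(volume.restrict Ω), 0 ≤ V x)
    (h1 : IntegrableOn (fun x => (ρ x : ℝ) ^ (1 + s / d)) Ω)
    (h2 : IntegrableOn (fun x => ρ x * V x) Ω) :
    groundFunctional s Ω V ρ = ((rieszConstant d s).toReal *
      (∫ x in Ω, (ρ x : ℝ) ^ (1 + s / d)) + ∫ x in Ω, ρ x * V x : ℝ) := by
  have hs0 : 0 < s := (Nat.cast_nonneg d).trans_lt hs
  have hp : 0 ≤ 1 + s / d := by positivity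
  have k0 : 0 ≤ ∫ x in Ω, (ρ x : ℝ) ^ (1 + s / d) := integral_nonneg fun x => by positivity
  have k1 : 0 ≤ ∫ x in Ω, ρ x * V x := integral_nonneg_of_ae (by
    filter_upwards [hV0] with x hx
    exact mul_nonneg (ρ x).coe_nonneg hx)
  rw [groundFunctional, potentialEnergy_eq_ofReal hV0 h2]
  simp only [coe_rpow_eq_ofReal _ hp]
  rw [← ofReal_integral_eq_lintegral_ofReal h1 (Eventually.of_forall fun x => by positivity),
    ← ENNReal.ofReal_toReal (rieszConstant_ne_top hd hs),
    ← ENNReal.ofReal_mul ENNReal.toReal_nonneg,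
    ← ENNReal.ofReal_add (by positivity) k1, EReal.coe_ennreal_ofReal,
    max_eq_left (by positivity), ENNReal.toReal_ofReal ENNReal.toReal_nonneg]

lemma integrable_of_groundFunctional_ne_top (hd : 1 ≤ d) (hs : (d : ℝ) < s)
    (hV : AEMeasurable V (volume.restrict Ω)) (hV0 : ∀ᵐ x ∂(volume.restrict Ω), 0 ≤ V x)
    (hρ : Measurable ρ) (h : groundFunctional s Ω V ρ ≠ ⊤) :
    IntegrableOn (fun x => (ρ x : ℝ) ^ (1 + s / d)) Ω ∧
      IntegrableOn (fun x => ρ x * V x) Ω := by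
  have hs0 : 0 < s := (Nat.cast_nonneg d).trans_lt hs
  have hp : 0 ≤ 1 + s / d := by positivity
  rw [groundFunctional, Ne, EReal.coe_ennreal_eq_top_iff, ENNReal.add_eq_top, not_or] at h
  refine ⟨⟨(hρ.coe_nnreal_real.pow_const _).aestronglyMeasurable, ?_⟩,
    integrable_mul_of_potentialEnergy_ne_top hV hV0 hρ h.2⟩
  rw [hasFiniteIntegral_iff_ofReal (Eventually.of_forall fun x => by positivity)]
  simp only [← coe_rpow_eq_ofReal _ hp]
  refine lt_top_iff_ne_top.2 fun h1 => h.1 ?_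
  rw [h1, ENNReal.mul_top (rieszConstant_pos hd hs).ne']

lemma tendsto_bulkFreeEnergy_div (hd : 1 ≤ d) (hs : (d : ℝ) < s) (m : ℝ≥0) :
    Tendsto (fun β => bulkFreeEnergy d s β m / β) atTop
      (𝓝 ((rieszConstant d s).toReal * (m : ℝ) ^ (1 + s / d))) := by
  have hs0 : 0 < s := (Nat.cast_nonneg d).trans_lt hs
  rcases eq_or_ne m 0 with rfl | hm
  · refine tendsto_const_nhds.congr' ?_
    filter_upwards [eventually_ge_atTop 0] with β hβ
    rw [NNReal.coe_zero, bulkFreeEnergy_zero hd hs hβ, zero_div,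
      Real.zero_rpow (by positivity), mul_zero]
  have hinv := tendsto_inv_atTop_zero (𝕜 := ℝ)
  rw [Metric.tendsto_nhds]
  intro ε hε
  obtain ⟨K, hK⟩ := exists_bulkFreeEnergy_le_rpow hd hs (pos_iff_ne_zero.2 hm) (half_pos hε)
  have h1 : ∀ᶠ β : ℝ in atTop, K * β⁻¹ < ε / 2 := by
    have := hinv.const_mul K
    rw [mul_zero] at this
    exact this.eventually (gt_mem_nhds (half_pos hε))
  filter_upwards [h1, hinv.eventually (gt_mem_nhds hε), eventually_gt_atTop 0] with β hβ1 hβ2 hβ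
  have h2 := hK β hβ.le
  have h3 := le_bulkFreeEnergy hd hs hβ.le 0 m
  rw [zero_mul, Real.exp_zero] at h3
  set A := (rieszConstant d s).toReal * (m : ℝ) ^ (1 + s / d)
  rw [Real.dist_eq, abs_lt]
  rw [← div_eq_mul_inv, div_lt_iff₀ hβ] at hβ1
  rw [inv_lt_iff_one_lt_mul₀ hβ] at hβ2
  constructor
  · rw [lt_sub_iff_add_lt, lt_div_iff₀ hβ]; nlinarith
  · rw [sub_lt_iff_lt_add, div_lt_iff₀ hβ]; nlinarith

/-- A common bound, for all `β ≥ 1`, of the rescaled free energies of bounded intensities. -/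
lemma exists_abs_bulkFreeEnergy_div_le (hd : 1 ≤ d) (hs : (d : ℝ) < s) (R : ℝ) :
    ∃ K, ∀ β, 1 ≤ β → ∀ m : ℝ≥0, (m : ℝ) ≤ R → |bulkFreeEnergy d s β m / β| ≤ K := by
  obtain ⟨K, hK⟩ := (isCompact_Icc (a := (0 : ℝ)) (b := R)).exists_bound_of_continuousOn
    ((continuousOn_bulkFreeEnergy hd hs zero_le_one).mono Icc_subset_Ici_self)
  refine ⟨K + 1, fun β hβ m hm => ?_⟩
  have hβ0 : 0 < β := by linarith
  have h1 := (abs_le.1 (hK m ⟨m.coe_nonneg, hm⟩)).2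
  have h2 := bulkFreeEnergy_le_mul hd hs hβ m
  have h3 := linear_le_bulkFreeEnergy hd hs hβ0.le 0 m
  rw [zero_mul, Real.exp_zero] at h3
  have hK0 : 0 ≤ K := (abs_nonneg _).trans (hK m ⟨m.coe_nonneg, hm⟩)
  rw [abs_le]
  constructor
  · rw [le_div_iff₀ hβ0]; nlinarith
  · rw [div_le_iff₀ hβ0]; nlinarith

/-- The free energy of the ground state density is asymptotically its ground state energy. -/
lemma tendsto_integral_bulkFreeEnergy_div (hd : 1 ≤ d) (hs : (d : ℝ) < s) (hM : 0 ≤ M)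
    (hV : AEMeasurable V (volume.restrict Ω)) (hV0 : ∀ᵐ x ∂(volume.restrict Ω), 0 ≤ V x)
    (hexp : IntegrableOn (fun x => Real.exp (-M * V x)) Ω) (hρ₀ : Measurable ρ₀)
    (harg : ∀ᵐ x ∂(volume.restrict Ω),
      IsArgmin (fun m => (rieszConstant d s).toReal * m ^ (1 + s / d)) (l - V x) (ρ₀ x)) :
    (∀ β, 1 ≤ β → IntegrableOn (fun x => bulkFreeEnergy d s β (ρ₀ x) / β) Ω) ∧
    Tendsto (fun β => ∫ x in Ω, bulkFreeEnergy d s β (ρ₀ x) / β) atTop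
      (𝓝 ((rieszConstant d s).toReal * ∫ x in Ω, (ρ₀ x : ℝ) ^ (1 + s / d))) := by
  have hd0 : (0 : ℝ) < d := by exact_mod_cast hd
  have hs0 : 0 < s := hd0.trans hs
  have hp : 1 < 1 + s / d := by have : 0 < s / d := by positivity
                                linarith
  have hc : 0 < (rieszConstant d s).toReal :=
    ENNReal.toReal_pos (rieszConstant_pos hd hs).ne' (rieszConstant_ne_top hd hs)
  have hb := ae_le_of_isArgmin hc hp hV0 harg
  obtain ⟨K, hK⟩ := exists_abs_bulkFreeEnergy_div_le hd hs
    ((max l 0 / (rieszConstant d s).toReal) ^ (1 / (1 + s / d - 1)))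
  have hmeas : ∀ β, 1 ≤ β → AEStronglyMeasurable
      (fun x => bulkFreeEnergy d s β (ρ₀ x) / β) (volume.restrict Ω) := fun β hβ =>
    ((measurable_bulkFreeEnergy_comp hd hs (by linarith) hρ₀).div_const β).aestronglyMeasurable
  have hzero : ∀ β, 1 ≤ β → ∀ x, ρ₀ x = 0 → bulkFreeEnergy d s β (ρ₀ x) / β = 0 := by
    intro β hβ x hx
    rw [hx, NNReal.coe_zero, bulkFreeEnergy_zero hd hs (by linarith), zero_div]
  refine ⟨fun β hβ => ?_, ?_⟩
  · refine integrable_of_isArgmin hc hp hM hV hexp harg (hmeas β hβ) (K := K) ?_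
      (Eventually.of_forall (hzero β hβ))
    filter_upwards [hb] with x hx _
    exact hK β hβ _ hx
  · have hS : NullMeasurableSet {x | V x ≤ l} (volume.restrict Ω) :=
      nullMeasurableSet_le hV aemeasurable_const
    rw [← integral_const_mul]
    refine tendsto_integral_filter_of_dominated_convergence ({x | V x ≤ l}.indicator fun _ => K)
      ?_ ?_ ((integrableOn_const
        (measure_le_lt_top_of_integrable_exp hM hexp l).ne).integrable_indicator₀ hS) ?_
    · filter_upwards [eventually_ge_atTop 1] with β hβ
      exact hmeas β hβ
    · filter_upwards [eventually_ge_atTop 1] with β hβ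
      filter_upwards [hb, harg] with x hx hxa
      rw [Real.norm_eq_abs]
      by_cases h : V x ≤ l
      · rw [indicator_of_mem (by exact h)]
        exact hK β hβ _ hx
      · rw [indicator_of_notMem (by exact h), hzero β hβ x
          (NNReal.coe_injective (hxa.eq_zero_of_nonpos hc hp (by linarith))), abs_zero]
    · exact Eventually.of_forall fun x => tendsto_bulkFreeEnergy_div hd hs (ρ₀ x)

/-- The minimizers of the rate function almost minimize the ground state functional as
`β → ∞`. -/
lemma exists_excess_tendsto_zero (hd : 1 ≤ d) (hs : (d : ℝ) < s) (hM : 0 ≤ M)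
    (hV : AEMeasurable V (volume.restrict Ω)) (hV0 : ∀ᵐ x ∂(volume.restrict Ω), 0 ≤ V x)
    (hexp : IntegrableOn (fun x => Real.exp (-M * V x)) Ω) (hρ₀ : IsProbDensity Ω ρ₀)
    (harg : ∀ᵐ x ∂(volume.restrict Ω),
      IsArgmin (fun m => (rieszConstant d s).toReal * m ^ (1 + s / d)) (l - V x) (ρ₀ x)) :
    ∃ e : ℝ → ℝ, Tendsto e atTop (𝓝 0) ∧ ∀ᶠ β in atTop, ∀ ρ, IsProbDensity Ω ρ →
      (∀ ρ', IsProbDensity Ω ρ' → rateFunction s Ω V β ρ ≤ rateFunction s Ω V β ρ') →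
        IntegrableOn (fun x => (ρ x : ℝ) ^ (1 + s / d)) Ω ∧
        IntegrableOn (fun x => ρ x * V x) Ω ∧
        ((rieszConstant d s).toReal * (∫ x in Ω, (ρ x : ℝ) ^ (1 + s / d)) +
            ∫ x in Ω, ρ x * V x) -
          ((rieszConstant d s).toReal * (∫ x in Ω, (ρ₀ x : ℝ) ^ (1 + s / d)) +
            ∫ x in Ω, ρ₀ x * V x) ≤ e β := by
  have hd0 : (0 : ℝ) < d := by exact_mod_cast hd
  have hs0 : 0 < s := hd0.trans hs
  have hp : 1 < 1 + s / d := by have : 0 < s / d := by positivity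
                                linarith
  obtain ⟨hFi, hF⟩ := tendsto_integral_bulkFreeEnergy_div hd hs hM hV hV0 hexp hρ₀.1 harg
  set c := (rieszConstant d s).toReal with hcdef
  have hc : 0 < c := ENNReal.toReal_pos (rieszConstant_pos hd hs).ne' (rieszConstant_ne_top hd hs)
  obtain ⟨k1, k2⟩ := integrable_rpow_of_isArgmin hc hp hM hV hV0 hexp hρ₀.1 harg
  set X₀ := ∫ x in Ω, (ρ₀ x : ℝ) ^ (1 + s / d) with hX₀
  set Y₀ := ∫ x in Ω, ρ₀ x * V x with hY₀
  set F : ℝ → ℝ := fun β => ∫ x in Ω, bulkFreeEnergy d s β (ρ₀ x) / β with hFdef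
  set E := ∫ x in Ω, Real.exp (-M * V x) with hE
  have hinv := tendsto_inv_atTop_zero (𝕜 := ℝ)
  refine ⟨fun β => (F β - c * X₀) + E * β⁻¹ + M * β⁻¹ * (2 * (F β + Y₀ + E * β⁻¹)), ?_, ?_⟩
  · have h1 : Tendsto (fun β => (F β - c * X₀) + E * β⁻¹ +
        M * β⁻¹ * (2 * (F β + Y₀ + E * β⁻¹))) atTop
        (𝓝 ((c * X₀ - c * X₀) + E * 0 + M * 0 * (2 * (c * X₀ + Y₀ + E * 0)))) :=
      ((hF.sub_const _).add (hinv.const_mul E)).add ((hinv.const_mul M).mul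
        (((hF.add_const Y₀).add (hinv.const_mul E)).const_mul 2))
    simpa using h1
  · filter_upwards [eventually_ge_atTop 1, eventually_ge_atTop (2 * M)] with β hβ1 hβM ρ hρ hmin
    have hβ0 : 0 < β := by linarith
    have hF' : ∫ x in Ω, bulkFreeEnergy d s β (ρ₀ x) = β * F β := by
      rw [hFdef]
      simp only [integral_div]
      field_simp
    have hFi' : IntegrableOn (fun x => bulkFreeEnergy d s β (ρ₀ x)) Ω := by
      refine ((hFi β hβ1).const_mul β).congr (Eventually.of_forall fun x => ?_)
      change β * (bulkFreeEnergy d s β (ρ₀ x) / β) = _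
      field_simp
    obtain ⟨j1, j2, hle⟩ := integral_le_of_forall_rateFunction_le hd hs hβ0.le hV hV0 hexp hρ.1
      k2 hFi' (hmin ρ₀ hρ₀)
    -- the lower bound for the free energy with slope `-M V`
    have hlow : ∀ x, β * (c * (ρ x : ℝ) ^ (1 + s / d)) ≤ bulkFreeEnergy d s β (ρ x) +
        (M * (ρ x * V x) + Real.exp (-M * V x)) := by
      intro x
      have := le_bulkFreeEnergy hd hs hβ0.le (-M * V x) (ρ x)
      linarith
    have j3 : IntegrableOn (fun x => bulkFreeEnergy d s β (ρ x) +
        (M * (ρ x * V x) + Real.exp (-M * V x))) Ω := j2.add ((j1.const_mul M).add hexp)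
    have j4 : IntegrableOn (fun x => (ρ x : ℝ) ^ (1 + s / d)) Ω := by
      refine (j3.const_mul (β * c)⁻¹).mono'
        (hρ.1.coe_nnreal_real.pow_const _).aestronglyMeasurable (Eventually.of_forall fun x => ?_)
      rw [Real.norm_eq_abs, abs_of_nonneg (by positivity), le_inv_mul_iff₀ (by positivity)]
      linarith [hlow x]
    refine ⟨j4, j1, ?_⟩
    set X := ∫ x in Ω, (ρ x : ℝ) ^ (1 + s / d) with hX
    set Y := ∫ x in Ω, ρ x * V x with hY
    have hX0 : 0 ≤ X := integral_nonneg fun x => by positivity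
    have hY0 : 0 ≤ Y := integral_nonneg_of_ae (by
      filter_upwards [hV0] with x hx
      exact mul_nonneg (ρ x).coe_nonneg hx)
    have hint : β * (c * X) ≤ (∫ x in Ω, bulkFreeEnergy d s β (ρ x)) + (M * Y + E) := by
      have h1 := integral_mono ((j4.const_mul c).const_mul β) j3 hlow
      have h2 : IntegrableOn (fun x => M * (ρ x * V x) + Real.exp (-M * V x)) Ω :=
        (j1.const_mul M).add hexp
      rwa [integral_const_mul, integral_const_mul, integral_add j2 h2,
        integral_add (j1.const_mul M) hexp, integral_const_mul] at h1
    rw [hF'] at hle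
    have h3 : β * (c * X + Y) ≤ β * (F β + Y₀) + M * Y + E := by linarith
    have hcX : 0 ≤ c * X := by positivity
    have hββ : β * β⁻¹ = 1 := mul_inv_cancel₀ hβ0.ne'
    have hYb : Y ≤ 2 * (F β + Y₀ + E * β⁻¹) := by
      have h4 : 0 ≤ (β - 2 * M) * Y := mul_nonneg (by linarith) hY0
      have h5 : β * Y ≤ β * (2 * (F β + Y₀ + E * β⁻¹)) := by
        have h6 : β * (2 * (F β + Y₀ + E * β⁻¹)) =
            2 * (β * (F β + Y₀)) + 2 * E * (β * β⁻¹) := by ring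
        have h7 : 0 ≤ β * (c * X) := by positivity
        rw [h6, hββ]
        linarith
      exact le_of_mul_le_mul_left h5 hβ0
    have h8 : c * X + Y ≤ F β + Y₀ + M * β⁻¹ * Y + E * β⁻¹ := by
      refine le_of_mul_le_mul_left (h3.trans (le_of_eq ?_)) hβ0
      have : β * (F β + Y₀ + M * β⁻¹ * Y + E * β⁻¹) =
          β * (F β + Y₀) + (β * β⁻¹) * (M * Y) + (β * β⁻¹) * E := by ring
      rw [this, hββ]
      ring
    have h9 := mul_le_mul_of_nonneg_left hYb (show 0 ≤ M * β⁻¹ by positivity)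
    linarith

lemma isProbabilityMeasure_withDensity_of_isProbDensity (hρ : IsProbDensity Ω ρ) :
    IsProbabilityMeasure ((volume.restrict Ω).withDensity fun x => (ρ x : ℝ≥0∞)) :=
  ⟨by rw [withDensity_apply _ MeasurableSet.univ, Measure.restrict_univ]; exact hρ.2⟩

lemma abs_integral_withDensity_sub_le (hρ : IsProbDensity Ω ρ) (hρ₀ : IsProbDensity Ω ρ₀)
    (φ : BoundedContinuousFunction (EuclideanSpace ℝ (Fin d)) ℝ) :
    |(∫ x, φ x ∂((volume.restrict Ω).withDensity fun x => (ρ x : ℝ≥0∞))) -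
      ∫ x, φ x ∂((volume.restrict Ω).withDensity fun x => (ρ₀ x : ℝ≥0∞))| ≤
        ‖φ‖ * ∫ x in Ω, |(ρ x : ℝ) - ρ₀ x| := by
  have hi : ∀ r : EuclideanSpace ℝ (Fin d) → ℝ≥0, IsProbDensity Ω r →
      IntegrableOn (fun x => (r x : ℝ) * φ x) Ω := fun r hr =>
    hr.integrable.mul_bdd φ.continuous.aestronglyMeasurable
      (Eventually.of_forall fun x => φ.norm_coe_le_norm x)
  rw [integral_withDensity_eq_integral_smul hρ.1, integral_withDensity_eq_integral_smul hρ₀.1]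
  simp only [NNReal.smul_def, smul_eq_mul]
  rw [← integral_sub (hi ρ hρ) (hi ρ₀ hρ₀), ← integral_const_mul]
  refine abs_integral_le_integral_abs.trans (integral_mono ((hi ρ hρ).sub (hi ρ₀ hρ₀)).abs
    ((hρ.integrable.sub hρ₀.integrable).abs.const_mul _) fun x => ?_)
  change |(ρ x : ℝ) * φ x - ρ₀ x * φ x| ≤ ‖φ‖ * |(ρ x : ℝ) - ρ₀ x|
  rw [← sub_mul, abs_mul, mul_comm]
  exact mul_le_mul_of_nonneg_right (φ.norm_coe_le_norm x) (abs_nonneg _)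

/-- The ground state functional has a unique minimizer, and it is the limit of the minimizers of
the rate functions as `β → ∞`. -/
theorem exists_ground_minimizer_and_tendsto (hd : 1 ≤ d) (hs : (d : ℝ) < s) (hM : 0 ≤ M)
    (hΩpos : 0 < volume Ω) (hV : AEMeasurable V (volume.restrict Ω))
    (hV0 : ∀ᵐ x ∂(volume.restrict Ω), 0 ≤ V x)
    (hexp : IntegrableOn (fun x => Real.exp (-M * V x)) Ω) :
    ∃ μinf : ProbabilityMeasure (EuclideanSpace ℝ (Fin d)),
      IsMinimizerOn Ω (groundFunctional s Ω V) (μinf : Measure (EuclideanSpace ℝ (Fin d))) ∧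
      (∀ ν : Measure (EuclideanSpace ℝ (Fin d)),
        IsMinimizerOn Ω (groundFunctional s Ω V) ν → ν = μinf) ∧
      ∀ μ : ℝ → ProbabilityMeasure (EuclideanSpace ℝ (Fin d)),
        (∀ᶠ β in atTop, IsMinimizerOn Ω (rateFunction s Ω V β)
          (μ β : Measure (EuclideanSpace ℝ (Fin d)))) →
        Tendsto μ atTop (𝓝 μinf) := by
  have hd0 : (0 : ℝ) < d := by exact_mod_cast hd
  have hp2 : 2 ≤ 1 + s / d := by
    have := (one_lt_div hd0).2 hs
    linarith
  have hp1 : 1 < 1 + s / d := by linarith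
  have hc : 0 < (rieszConstant d s).toReal :=
    ENNReal.toReal_pos (rieszConstant_pos hd hs).ne' (rieszConstant_ne_top hd hs)
  obtain ⟨ρ₀, l, hρ₀m, hρ₀1, harg⟩ := exists_density_isArgmin_rpow hc hp1 hM
    (by rw [Ne, Measure.restrict_eq_zero]; exact hΩpos.ne') hV hV0 hexp
  have hρ₀ : IsProbDensity Ω ρ₀ := ⟨hρ₀m, hρ₀1⟩
  obtain ⟨k1, k2⟩ := integrable_rpow_of_isArgmin hc hp1 hM hV hV0 hexp hρ₀m harg
  have hg₀ := groundFunctional_eq_coe hd hs hV0 k1 k2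
  -- an almost minimizer of the ground state functional is close to `ρ₀` in `L¹`
  have hL1 : ∀ {η : ℝ}, 0 < η → ∀ {ρ}, IsProbDensity Ω ρ →
      IntegrableOn (fun x => (ρ x : ℝ) ^ (1 + s / d)) Ω → IntegrableOn (fun x => ρ x * V x) Ω → _ :=
    fun {η} hη {ρ} hρ h1 h2 => integral_abs_sub_le_of_isArgmin hc hp2 hM hV hV0 hexp hρ₀m
      hρ₀.integrable hρ₀.integral_eq_one harg hη hρ.integrable hρ.integral_eq_one h1 h2
  refine ⟨⟨_, isProbabilityMeasure_withDensity_of_isProbDensity hρ₀⟩, ⟨ρ₀, hρ₀, rfl, ?_⟩, ?_, ?_⟩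
  · intro ρ' hρ'
    by_cases htop : groundFunctional s Ω V ρ' = ⊤
    · rw [htop]; exact le_top
    obtain ⟨h1, h2⟩ := integrable_of_groundFunctional_ne_top hd hs hV hV0 hρ'.1 htop
    rw [hg₀, groundFunctional_eq_coe hd hs hV0 h1 h2, EReal.coe_le_coe_iff]
    exact integral_le_of_isArgmin hc hp1 hM hV hV0 hexp hρ₀m hρ₀.integrable hρ₀.integral_eq_one
      harg hρ'.integrable hρ'.integral_eq_one h1 h2
  · rintro ν ⟨ρ, hρ, rfl, hmin⟩
    have hle := hmin ρ₀ hρ₀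
    have htop : groundFunctional s Ω V ρ ≠ ⊤ := by
      intro h
      rw [h, hg₀] at hle
      exact (EReal.coe_lt_top _).not_ge hle
    obtain ⟨h1, h2⟩ := integrable_of_groundFunctional_ne_top hd hs hV hV0 hρ.1 htop
    rw [hg₀, groundFunctional_eq_coe hd hs hV0 h1 h2, EReal.coe_le_coe_iff] at hle
    have hzero : ∫ x in Ω, |(ρ x : ℝ) - ρ₀ x| ≤ 0 := by
      have hlim : Tendsto (fun η : ℝ => η * (volume.restrict Ω).real {x | V x ≤ l + 1})
          (𝓝[>] 0) (𝓝 0) := by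
        have : Tendsto (fun η : ℝ => η * (volume.restrict Ω).real {x | V x ≤ l + 1})
          (𝓝 0) (𝓝 (0 * _)) := tendsto_id.mul_const _
        rw [zero_mul] at this
        exact this.mono_left nhdsWithin_le_nhds
      refine ge_of_tendsto hlim ?_
      filter_upwards [self_mem_nhdsWithin] with η hη
      have hη0 : (0 : ℝ) < η := hη
      refine (hL1 hη0 hρ h1 h2).trans (add_le_of_nonpos_right ?_)
      exact mul_nonpos_of_nonneg_of_nonpos (by positivity) (by linarith)
    have hae := (integral_eq_zero_iff_of_nonneg (fun x => abs_nonneg _)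
      (hρ.integrable.sub hρ₀.integrable).abs).1
      (le_antisymm hzero (integral_nonneg fun x => abs_nonneg _))
    refine withDensity_congr_ae ?_
    filter_upwards [hae] with x hx
    have : (ρ x : ℝ) = ρ₀ x := sub_eq_zero.1 (abs_eq_zero.1 hx)
    rw [NNReal.coe_injective this]
  · intro μ hμ
    obtain ⟨e, he, hee⟩ := exists_excess_tendsto_zero hd hs hM hV hV0 hexp hρ₀ harg
    refine ProbabilityMeasure.tendsto_iff_forall_integral_tendsto.2 fun φ => ?_
    rw [Metric.tendsto_nhds]
    intro ε hε
    -- choose `η` so that the first term of the stability estimate is small; the second one is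
    -- the excess `e β` multiplied by a constant
    set A := (volume.restrict Ω).real {x | V x ≤ l + 1} with hA
    have hA0 : 0 ≤ A := measureReal_nonneg
    set η := ε / (4 * (‖φ‖ + 1) * (A + 1)) with hη
    have hφ : 0 ≤ ‖φ‖ := norm_nonneg φ
    have hη0 : 0 < η := by positivity
    set K := 2 ^ (1 + s / d) / (2 * (rieszConstant d s).toReal * η ^ (1 + s / d - 1)) + 1 with hK
    have hK0 : 0 < K := by positivity
    have hsmall : ∀ᶠ β in atTop, K * e β ≤ ε / (4 * (‖φ‖ + 1)) := by
      have := he.const_mul K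
      rw [mul_zero] at this
      exact this.eventually (ge_mem_nhds (by positivity))
    filter_upwards [hμ, hee, hsmall] with β hβ hβe hβs
    obtain ⟨ρ, hρ, hμρ, hmin⟩ := hβ
    obtain ⟨h1, h2, h3⟩ := hβe ρ hρ hmin
    have h4 := (hL1 hη0 hρ h1 h2).trans
      (add_le_add_right (mul_le_mul_of_nonneg_left h3 hK0.le) _)
    have h5 : η * A ≤ ε / (4 * (‖φ‖ + 1)) := by
      rw [hη, div_mul_eq_mul_div, div_le_div_iff₀ (by positivity) (by positivity)]
      nlinarith [mul_nonneg hε.le (add_nonneg hφ zero_le_one)]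
    rw [Real.dist_eq, hμρ]
    refine (abs_integral_withDensity_sub_le hρ hρ₀ φ).trans_lt ?_
    calc ‖φ‖ * ∫ x in Ω, |(ρ x : ℝ) - ρ₀ x|
        ≤ ‖φ‖ * (ε / (4 * (‖φ‖ + 1)) + ε / (4 * (‖φ‖ + 1))) :=
          mul_le_mul_of_nonneg_left (h4.trans (add_le_add h5 hβs)) hφ
      _ = (‖φ‖ / (‖φ‖ + 1)) * (ε / 2) := by field_simp; ring
      _ ≤ 1 * (ε / 2) := by
          gcongr
          rw [div_le_one (by positivity)]
          linarith
      _ < ε := by linarith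

end LowTemperature

theorem mainTheorem5 (d : ℕ) (hd : 1 ≤ d) (s : ℝ) (hs : (d : ℝ) < s)
    (Ω : Set (EuclideanSpace ℝ (Fin d))) (hΩ : IsClosed Ω) (hΩpos : 0 < volume Ω)
    (hΩreg : HasC1Boundary Ω)
    (V : EuclideanSpace ℝ (Fin d) → ℝ) (hVcont : ContinuousOn V Ω) (hVnonneg : ∀ x ∈ Ω, 0 ≤ V x)
    (hVgrowth : ¬ Bornology.IsBounded Ω →
      Tendsto V (Bornology.cobounded (EuclideanSpace ℝ (Fin d)) ⊓ 𝓟 Ω) atTop ∧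
      ∃ M > 0, IntegrableOn (fun x => Real.exp (-M * V x)) Ω) :
    -- existence of minimizers
    (∀ β > 0, (∃ M < β, IntegrableOn (fun x => Real.exp (-M * V x)) Ω) →
      ∃ μ : ProbabilityMeasure (EuclideanSpace ℝ (Fin d)),
        IsMinimizerOn Ω (rateFunction s Ω V β) (μ : Measure (EuclideanSpace ℝ (Fin d)))) ∧
    -- no external field
    (Bornology.IsBounded Ω → (∀ x ∈ Ω, V x = 0) → ∀ β > 0,
      IsMinimizerOn Ω (rateFunction s Ω V β) (volume[|Ω]) ∧
      ∀ μ : Measure (EuclideanSpace ℝ (Fin d)), IsMinimizerOn Ω (rateFunction s Ω V β) μ →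
        (∀ ν : Measure (EuclideanSpace ℝ (Fin d)),
          IsMinimizerOn Ω (rateFunction s Ω V β) ν → ν = μ) →
        μ = volume[|Ω]) ∧
    -- infinite temperature limit, in total variation
    (Bornology.IsBounded Ω → ∀ ε > 0, ∀ᶠ β in 𝓝[>] (0 : ℝ),
      ∀ μ : Measure (EuclideanSpace ℝ (Fin d)), IsMinimizerOn Ω (rateFunction s Ω V β) μ →
        ∀ B, MeasurableSet B → |μ.real B - (volume[|Ω]).real B| ≤ ε) ∧
    -- zero temperature limit
    (∃ μinf : ProbabilityMeasure (EuclideanSpace ℝ (Fin d)),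
      IsMinimizerOn Ω (groundFunctional s Ω V) (μinf : Measure (EuclideanSpace ℝ (Fin d))) ∧
      (∀ ν : Measure (EuclideanSpace ℝ (Fin d)),
        IsMinimizerOn Ω (groundFunctional s Ω V) ν → ν = μinf) ∧
      ∀ μ : ℝ → ProbabilityMeasure (EuclideanSpace ℝ (Fin d)),
        (∀ᶠ β in atTop, IsMinimizerOn Ω (rateFunction s Ω V β)
          (μ β : Measure (EuclideanSpace ℝ (Fin d)))) →
        Tendsto μ atTop (𝓝 μinf)) := by
  have hV : AEMeasurable V (volume.restrict Ω) := hVcont.aemeasurable hΩ.measurableSet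
  have hV0 : ∀ᵐ x ∂(volume.restrict Ω), 0 ≤ V x :=
    (ae_restrict_mem hΩ.measurableSet).mono hVnonneg
  refine ⟨?_, ?_, ?_, ?_⟩
  · rintro β hβ ⟨M, hMβ, hexp⟩
    obtain ⟨ρ, hρ, hmin⟩ := exists_rateFunction_minimizer hd hs hβ hMβ hΩpos hV hV0 hexp
    exact ⟨⟨_, isProbabilityMeasure_withDensity_of_isProbDensity hρ⟩, ρ, hρ, rfl, hmin⟩
  · intro hb hVzero β hβ
    have h := isMinimizerOn_uniform hd hs hβ hΩ.measurableSet hΩpos.ne' hb.measure_lt_top.ne hVzero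
    exact ⟨h, fun μ _ huniq => (huniq _ h).symm⟩
  · intro hb ε hε
    have hcomp : IsCompact Ω := Metric.isCompact_of_isClosed_isBounded hΩ hb
    obtain ⟨b, hbV⟩ := hcomp.exists_bound_of_continuousOn hVcont
    have hVb : ∀ᵐ x ∂(volume.restrict Ω), V x ≤ b :=
      (ae_restrict_mem hΩ.measurableSet).mono fun x hx => (le_abs_self _).trans (hbV x hx)
    filter_upwards [eventually_integral_abs_sub_uniform_le hd hs hΩpos.ne' hb.measure_lt_top.ne hV
      hV0 hVb hε] with β hβ
    rintro _ ⟨ρ, hρ, rfl, hmin⟩ B hB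
    rw [cond_eq_withDensity_uniformDensity hΩpos.ne']
    exact (abs_withDensity_real_sub_le hρ (isProbDensity_uniformDensity hΩpos.ne'
      hb.measure_lt_top.ne) hB).trans (hβ ρ hρ hmin)
  · obtain ⟨M, hM, hexp⟩ : ∃ M > 0, IntegrableOn (fun x => Real.exp (-M * V x)) Ω := by
      by_cases hb : Bornology.IsBounded Ω
      · refine ⟨1, one_pos, ?_⟩
        refine (integrableOn_const (C := (1 : ℝ)) hb.measure_lt_top.ne).mono'
          (Real.measurable_exp.comp_aemeasurable (hV.const_mul _)).aestronglyMeasurable ?_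
        filter_upwards [hV0] with x hx
        rw [Real.norm_eq_abs, Real.abs_exp]
        exact Real.exp_le_one_iff.2 (by linarith)
      · exact (hVgrowth hb).2
    exact exists_ground_minimizer_and_tendsto hd hs hM.le hΩpos hV hV0 hexp
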